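/- Let $d\ge 2$ and $r\ge 1$ be integers, let $\lambda>1$, $a>0$, $b\in\mathbb{R}$, and let $w(\mathbf{x})=\prod_{i=1}^d \exp(-a|x_i|^\lambda+b)$ for $\mathbf{x}\in\mathbb{R}^d$. Let $W^r_{1,w}(\mathbb{R}^d)$ be the weighted Sobolev space of mixed smoothness $r$, that is, the space of all functions $f$ on $\mathbb{R}^d$ whose weak partial derivatives $D^{\mathbf{k}}f$ exist and satisfy $\int_{\mathbb{R}^d}|D^{\mathbf{k}}f|\,w\,d\mathbf{x}<\infty$ for every $\mathbf{k}\in\mathbb{N}_0^d$ with $|\mathbf{k}|_\infty=\max_i k_i\le r$, with the norm $$\|f\|_{W^r_{1,w}(\mathbb{R}^d)}=\sum_{|\mathbf{k}|_\infty\le r}\int_{\mathbb{R}^d}|D^{\mathbf{k}}f(\mathbf{x})|\,w(\mathbf{x})\,d\mathbf{x};$$ every such function agrees almost everywhere with a continuous function, and is taken to be continuous. Let $\boldsymbol{W}^r_{1,w}(\mathbb{R}^d)$ be the unit ball of this space. For $n\in\mathbb{N}$ put $$\mathrm{Int}_n=\inf_{Q}\ \sup_{f\in\boldsymbol{W}^r_{1,w}(\mathbb{R}^d)}\left|\int_{\mathbb{R}^d}f(\mathbf{x})w(\mathbf{x})\,d\mathbf{x}-Qf\right|,$$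 where the infimum is over all quadratures $Qf=\sum_{i=1}^m c_i f(\mathbf{x}_i)$ with $m\le n$ nodes $\mathbf{x}_i\in\mathbb{R}^d$ and weights $c_i\in\mathbb{R}$. Put $r_\lambda=(1-1/\lambda)r$. Then there are constants $C_1,C_2>0$, independent of $n$, such that for all integers $n\ge 2$ $$C_1\,n^{-r_\lambda}(\log n)^{r_\lambda(d-1)}\ \le\ \mathrm{Int}_n\ \le\ C_2\,n^{-r_\lambda}(\log n)^{(r_\lambda+1)(d-1)}.$$ -/

import Mathlib

open MeasureTheory
open scoped ContDiff ENNReal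

noncomputable section

namespace FreudQuadrature

/-- The univariate Freud-type weight `w(x) = exp (-a |x| ^ lam + b)`. -/
def freudWeight (lam a b : ℝ) (x : ℝ) : ℝ :=
  Real.exp (-a * |x| ^ lam + b)

/-- The product weight `w(x) = ∏ i, w(x i)` on `ℝ^d`. -/
def productWeight (d : ℕ) (lam a b : ℝ) (x : Fin d → ℝ) : ℝ :=
  ∏ i, freudWeight lam a b (x i)

/-- The classical partial derivative `∂φ/∂x_i`. -/
def partialDeriv {d : ℕ} (i : Fin d) (φ : (Fin d → ℝ) → ℝ) : (Fin d → ℝ) → ℝ :=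
  fun x => fderiv ℝ φ x (Pi.single i 1)

/-- The classical mixed derivative `D^k φ = ∂_0^{k 0} ⋯ ∂_{d-1}^{k (d-1)} φ`
(only applied to smooth functions, for which the order of differentiation is immaterial). -/
def mixedDeriv {d : ℕ} (k : Fin d → ℕ) (φ : (Fin d → ℝ) → ℝ) : (Fin d → ℝ) → ℝ :=
  (List.finRange d).foldr (fun i ψ => (partialDeriv i)^[k i] ψ) φ

/-- `g` is the weak derivative `D^k f` on `ℝ^d`: both functions are locally integrable and
`∫ f D^k φ = (-1)^{|k|_1} ∫ g φ` for every infinitely differentiable, compactly supported `φ`. -/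
structure HasWeakDeriv {d : ℕ} (k : Fin d → ℕ) (f g : (Fin d → ℝ) → ℝ) : Prop where
  locallyIntegrable_left : LocallyIntegrable f volume
  locallyIntegrable_right : LocallyIntegrable g volume
  integral_eq : ∀ φ : (Fin d → ℝ) → ℝ, ContDiff ℝ ∞ φ → HasCompactSupport φ →
    ∫ x, f x * mixedDeriv k φ x = (-1) ^ (∑ i, k i) * ∫ x, g x * φ x

/-- The (closed) unit ball of the weighted Sobolev space `W^r_{1,w}(ℝ^d)` of mixed smoothness `r`,
whose elements are identified with their continuous representatives: the continuous functions `f`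
such that, for every multi-index `k` with `|k|_∞ ≤ r`, the weak derivative `D^k f` exists and
lies in the weighted space `L^1_w`, and such that
`‖f‖ = ∑_{|k|_∞ ≤ r} ∫ |D^k f| w ≤ 1`.
Here `g k` is `D^k f`, which is determined up to a null set; in particular `g 0 = f` a.e. -/
def sobolevUnitBall {d : ℕ} (r : ℕ) (w : (Fin d → ℝ) → ℝ) : Set ((Fin d → ℝ) → ℝ) :=
  {f | Continuous f ∧ ∃ g : (Fin d → ℕ) → (Fin d → ℝ) → ℝ,
    (∀ k : Fin d → ℕ, (∀ i, k i ≤ r) →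
      HasWeakDeriv k f (g k) ∧ Integrable (fun x => g k x * w x) volume) ∧
    ∑ k ∈ Fintype.piFinset (fun _ : Fin d => Finset.range (r + 1)),
      ∫ x, |g k x * w x| ≤ 1}

/-- The quadrature `Q f = ∑ i, c i * f (ξ i)` with `m` nodes `ξ i` (not necessarily distinct)
and real integration weights `c i`. -/
def quadrature {d m : ℕ} (ξ : Fin m → Fin d → ℝ) (c : Fin m → ℝ)
    (f : (Fin d → ℝ) → ℝ) : ℝ :=
  ∑ i, c i * f (ξ i)

/-- The optimal quadrature error
`Int_n(F) = inf_Q sup_{f ∈ F} |∫ f w - Q f|`, the infimum being over all quadratures `Q` with at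
most `n` nodes; it takes values in `[0, ∞]`. -/
def optimalError {d : ℕ} (w : (Fin d → ℝ) → ℝ) (F : Set ((Fin d → ℝ) → ℝ)) (n : ℕ) : ℝ≥0∞ :=
  ⨅ (m : ℕ) (_ : m ≤ n) (ξ : Fin m → Fin d → ℝ) (c : Fin m → ℝ),
    ⨆ f ∈ F, ENNReal.ofReal |(∫ x, f x * w x) - quadrature ξ c f|

end FreudQuadrature

end

namespace FreudQuadrature

/-! ### The univariate weight: variation on short cells, decay of tails, and a local rule of order
`r`. -/

section UnivariateWeight

/-! Write `α = (1 - 1/lam) * r`.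

Upper bound. In one variable, divide `[0, T]` with `T = 2^(k/lam)` into `2^k` cells of length `h`,
so that `T^(lam-1) * h = 1`. Then the weight varies by a bounded factor on each cell, and beyond `T`
it decays exponentially at rate at least `a / h`. A composite rule exact for degree `< r`, reflected
to the negative half-line, therefore has an error functional of the form `f ↦ ∑_{j ≤ r} ∫ f^(j) *
h_j` with kernels bounded by `C * h^r * w`, where `h^r = 2^(-k*α)` (`exists_univariate_rules`). Such
bounds multiply under tensor products, because the weighted `L¹` norm of mixed derivatives is an
iterated sum of integrals (`abs_tensor_le`). Smolyak's combination of the differences of consecutive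
rules then has, up to constants, at most `2^m (m+1)^(d-1)` nodes (`isQuadrature_smolyak`) and error
at most `2^(-m*α) (m+1)^(d-1)` (`abs_boxIntegral_sub_smolyak_le`). All this is done for smooth
functions on cubes `[-R, R]^d` with constants independent of `R`; mollification and `R → ∞` carry it
to the Sobolev ball (`abs_integral_sub_le_of_smooth`).

Lower bound. Cut the positive half-line at the points `j^(1/lam)`. On the `j`-th cell the weight
drops by exactly the factor `exp (-a)` and the length is at least of order `j^(1/lam - 1)`, so a
normalised bump there has integral at least of order `j^(-α)` (`exists_univariate_bump`). Tensor
products over cells with `∏ j_i ≤ x` lie in the unit ball and have integral at least of order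
`x^(-α)`, and there are at least of the order of `x (log x)^(d-1)` such cells
(`exists_hyperbolic_cross`). With `x` a large multiple of `n / (log n)^(d-1)` there are more than
`n` cells, so some cell contains no node and every quadrature on these nodes gives zero on its bump
(`exists_fooling_function`). -/

theorem freudWeight_pos (lam a b x : ℝ) : 0 < freudWeight lam a b x := Real.exp_pos _

theorem continuous_freudWeight {lam : ℝ} (hlam : 0 < lam) (a b : ℝ) :
    Continuous (freudWeight lam a b) := by
  unfold freudWeight
  have : Continuous fun x : ℝ => |x| ^ lam := continuous_abs.rpow_const fun _ => Or.inr hlam.le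
  fun_prop

theorem freudWeight_neg (lam a b x : ℝ) : freudWeight lam a b (-x) = freudWeight lam a b x := by
  simp [freudWeight]

theorem freudWeight_anti {lam a : ℝ} (hlam : 0 < lam) (ha : 0 < a) (b : ℝ) {s t : ℝ}
    (hs : 0 ≤ s) (hst : s ≤ t) : freudWeight lam a b t ≤ freudWeight lam a b s := by
  unfold freudWeight
  rw [abs_of_nonneg hs, abs_of_nonneg (hs.trans hst)]
  have := Real.rpow_le_rpow hs hst hlam.le
  exact Real.exp_le_exp.2 (by nlinarith)

/-- Bernoulli's inequality gives `s^lam - p^lam ≤ lam * s^(lam-1) * (s - p) ≤ lam`. So on `[0, T]`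
the weight is essentially constant at scale `T^(1-lam)`, which dictates the mesh size. -/
theorem freudWeight_le_of_near {lam a : ℝ} (hlam : 1 < lam) (ha : 0 < a) (b : ℝ) {p s T : ℝ}
    (hp : 0 ≤ p) (hps : p ≤ s) (hsT : s ≤ T) (h : T ^ (lam - 1) * (s - p) ≤ 1) :
    freudWeight lam a b p ≤ Real.exp (a * lam) * freudWeight lam a b s := by
  unfold freudWeight
  rw [← Real.exp_add, abs_of_nonneg hp, abs_of_nonneg (hp.trans hps)]
  apply Real.exp_le_exp.2
  suffices H : s ^ lam - p ^ lam ≤ lam by nlinarith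
  rcases (hp.trans hps).eq_or_lt with h0 | hs
  · have : p = s := by linarith
    subst this; simp; linarith
  have h1 := one_add_mul_self_le_rpow_one_add (s := p / s - 1)
    (by have := div_nonneg hp hs.le; linarith) hlam.le
  have h2 : (1 + (p / s - 1)) ^ lam = p ^ lam / s ^ lam := by
    rw [← Real.div_rpow hp hs.le]; congr 1; ring
  have hsl : 0 < s ^ lam := Real.rpow_pos_of_pos hs _
  rw [h2, le_div_iff₀ hsl] at h1
  have h3 : s ^ lam = s ^ (lam - 1) * s := by
    rw [← Real.rpow_add_one hs.ne']; congr 1; ring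
  have h4 : s ^ (lam - 1) * (s - p) ≤ 1 :=
    (mul_le_mul_of_nonneg_right (Real.rpow_le_rpow hs.le hsT (by linarith)) (by linarith)).trans h
  have h5 : (1 + lam * (p / s - 1)) * s ^ lam = s ^ lam - lam * (s ^ (lam - 1) * (s - p)) := by
    rw [h3]; field_simp; ring
  rw [h5] at h1
  nlinarith

/-- Since `s^lam ≤ t^(lam-1) * s`, the exponent grows by at least `t^(lam-1) * (t - s)`, and `t ≥
T`. The point `s` itself may lie on either side of `T`. -/
theorem freudWeight_le_mul_exp {lam a : ℝ} (hlam : 1 < lam) (ha : 0 < a) (b : ℝ) {s t T : ℝ}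
    (hT : 0 < T) (hs : 0 ≤ s) (hst : s ≤ t) (hTt : T ≤ t) :
    freudWeight lam a b t ≤
      freudWeight lam a b s * Real.exp (-(a * T ^ (lam - 1) * (t - s))) := by
  unfold freudWeight
  rw [← Real.exp_add, abs_of_nonneg hs, abs_of_nonneg (hs.trans hst)]
  apply Real.exp_le_exp.2
  suffices H : T ^ (lam - 1) * (t - s) ≤ t ^ lam - s ^ lam by nlinarith
  have ht : 0 < t := hT.trans_le hTt
  have h3 : t ^ lam = t ^ (lam - 1) * t := by
    rw [← Real.rpow_add_one ht.ne']; congr 1; ring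
  have h4 : s ^ lam ≤ t ^ (lam - 1) * s := by
    rcases hs.eq_or_lt with rfl | hs
    · rw [Real.zero_rpow (by linarith)]; simp
    · have : s ^ lam = s ^ (lam - 1) * s := by
        rw [← Real.rpow_add_one hs.ne']; congr 1; ring
      rw [this]
      exact mul_le_mul_of_nonneg_right (Real.rpow_le_rpow hs.le hst (by linarith)) hs.le
  have h5 : T ^ (lam - 1) * (t - s) ≤ t ^ (lam - 1) * (t - s) :=
    mul_le_mul_of_nonneg_right (Real.rpow_le_rpow hT.le hTt (by linarith)) (by linarith)
  nlinarith

/-- The Peano kernel `(t - s)_+ ^ (r - 1) / (r - 1)!`. -/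
noncomputable def peanoKernel (r : ℕ) (s t : ℝ) : ℝ :=
  if s ≤ t then (t - s) ^ (r - 1) / (r - 1).factorial else 0

theorem measurable_peanoKernel (r : ℕ) : Measurable (Function.uncurry (peanoKernel r)) := by
  unfold peanoKernel Function.uncurry
  refine Measurable.ite (measurableSet_le measurable_fst measurable_snd) ?_ measurable_const
  fun_prop

theorem peanoKernel_nonneg (r : ℕ) (s t : ℝ) : 0 ≤ peanoKernel r s t := by
  unfold peanoKernel
  split_ifs with h
  · have := sub_nonneg.2 h; positivity
  · rfl

theorem peanoKernel_le (r : ℕ) {s t h : ℝ} (hh : 0 ≤ h) (hst : t - s ≤ h) :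
    peanoKernel r s t ≤ h ^ (r - 1) := by
  unfold peanoKernel
  split_ifs with h1
  · have h2 := sub_nonneg.2 h1
    calc (t - s) ^ (r - 1) / (r - 1).factorial ≤ (t - s) ^ (r - 1) / 1 := by
          gcongr; exact_mod_cast Nat.one_le_iff_ne_zero.2 (Nat.factorial_ne_zero _)
      _ ≤ _ := by rw [div_one]; gcongr
  · positivity

theorem intervalIntegrable_peanoKernel_mul (r : ℕ) (s : ℝ) {w : ℝ → ℝ} (hw : Continuous w)
    (x y : ℝ) : IntervalIntegrable (fun t => peanoKernel r s t * w t) volume x y := by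
  have h : (fun t => peanoKernel r s t * w t) =
      (Set.Ici s).indicator (fun t => (t - s) ^ (r - 1) / (r - 1).factorial * w t) := by
    ext t; simp only [peanoKernel, Set.indicator, Set.mem_Ici]; split_ifs <;> simp
  rw [h]
  have h2 : Continuous (fun t => (t - s) ^ (r - 1) / (r - 1).factorial * w t) := by fun_prop
  exact ⟨(h2.integrableOn_Ioc).indicator measurableSet_Ici,
    (h2.integrableOn_Ioc).indicator measurableSet_Ici⟩

/-- The exponential decay of the weight past `T` dominates the integrand by a Gamma density with
rate `κ = a * T^(lam-1)`; the value `Γ(r) = (r-1)!` cancels the factorial of the kernel and leaves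
`κ^(-r)`. -/
theorem integral_peanoKernel_tail_le {lam a : ℝ} (hlam : 1 < lam) (ha : 0 < a) (b : ℝ) {r : ℕ}
    (hr : 1 ≤ r) {s T R : ℝ} (hT : 0 < T) (hTR : T ≤ R) (hs : 0 ≤ s) :
    ∫ t in T..R, peanoKernel r s t * freudWeight lam a b t ≤
      (1 / (a * T ^ (lam - 1))) ^ r * freudWeight lam a b s := by
  set κ := a * T ^ (lam - 1) with hκ
  have hκ0 : 0 < κ := by positivity
  set g : ℝ → ℝ := fun u => u ^ ((r : ℝ) - 1) * Real.exp (-(κ * u)) with hg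
  have hr' : (0 : ℝ) < r := by exact_mod_cast hr
  have hI : ∫ u in Set.Ioi (0 : ℝ), g u = (1 / κ) ^ (r : ℝ) * Real.Gamma r :=
    Real.integral_rpow_mul_exp_neg_mul_Ioi hr' hκ0
  have hG : Real.Gamma r = (r - 1).factorial := by
    obtain ⟨q, rfl⟩ : ∃ q, r = q + 1 := ⟨r - 1, by omega⟩
    push_cast; simpa using Real.Gamma_nat_eq_factorial q
  have hpos : 0 < ∫ u in Set.Ioi (0 : ℝ), g u := by rw [hI, hG]; positivity
  have hint : IntegrableOn g (Set.Ioi 0) := by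
    by_contra h
    rw [integral_undef h] at hpos
    exact lt_irrefl _ hpos
  have hint2 : IntegrableOn (fun t => g (t - s)) (Set.Ioi s) := by
    have := (measurePreserving_sub_right (volume : Measure ℝ) s).integrableOn_comp_preimage
      (measurableEmbedding_subRight s) (f := g) (s := Set.Ioi 0)
    rw [show (fun x => x - s) ⁻¹' Set.Ioi (0 : ℝ) = Set.Ioi s by ext; simp] at this
    exact this.2 hint
  have hint3 : ∀ C, IntegrableOn (fun t => C * g (t - s)) (Set.Ioi s) :=
    fun C => hint2.const_mul C
  have hI2 : ∫ t in Set.Ioi s, g (t - s) = ∫ u in Set.Ioi (0 : ℝ), g u := by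
    have := (measurePreserving_sub_right (volume : Measure ℝ) s).setIntegral_preimage_emb
      (measurableEmbedding_subRight s) g (Set.Ioi 0)
    rwa [show (fun x => x - s) ⁻¹' Set.Ioi (0 : ℝ) = Set.Ioi s by ext; simp] at this
  have hw := continuous_freudWeight (by linarith : 0 < lam) a b
  rw [intervalIntegral.integral_of_le hTR]
  have hfac : (0 : ℝ) < (r - 1).factorial := by positivity
  calc ∫ t in Set.Ioc T R, peanoKernel r s t * freudWeight lam a b t
      ≤ ∫ t in Set.Ioc T R, (Set.Ioi s).indicator
          (fun t => freudWeight lam a b s / (r - 1).factorial * g (t - s)) t := by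
        apply setIntegral_mono_on_ae (intervalIntegrable_peanoKernel_mul r s hw T R).1
        · exact ((hint3 _).integrable_indicator measurableSet_Ioi).integrableOn
        · exact measurableSet_Ioc
        · filter_upwards [Measure.ae_ne volume s] with t hts ht
          unfold peanoKernel
          split_ifs with h
          · have h' : s < t := lt_of_le_of_ne h (Ne.symm hts)
            rw [Set.indicator_of_mem (by exact h')]
            have h1 := freudWeight_le_mul_exp hlam ha b hT hs h ht.1.le
            have h2 : (t - s) ^ ((r : ℝ) - 1) = (t - s) ^ (r - 1) := by
              rw [← Real.rpow_natCast, Nat.cast_sub hr]; simp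
            simp only [hg, h2]
            have h3 : 0 ≤ (t - s) ^ (r - 1) / (r - 1).factorial := by
              have := sub_nonneg.2 h; positivity
            calc _ ≤ (t - s) ^ (r - 1) / (r - 1).factorial *
                  (freudWeight lam a b s * Real.exp (-(κ * (t - s)))) := by gcongr
              _ = _ := by ring
          · rw [Set.indicator_of_notMem (by simpa using (not_le.1 h).le)]; simp
    _ ≤ ∫ t, (Set.Ioi s).indicator
          (fun t => freudWeight lam a b s / (r - 1).factorial * g (t - s)) t := by
        apply setIntegral_le_integral ((hint3 _).integrable_indicator measurableSet_Ioi)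
        refine Filter.Eventually.of_forall fun t => ?_
        apply Set.indicator_nonneg
        intro t ht
        have h1 : 0 ≤ t - s := sub_nonneg.2 (le_of_lt ht)
        have h2 := (freudWeight_pos lam a b s).le
        positivity
    _ = _ := by
        rw [integral_indicator measurableSet_Ioi, integral_const_mul, hI2, hI, hG,
          Real.rpow_natCast]
        field_simp

/-- A quadrature of order `r` on an interval, for a weight that is largest at the left end. -/
theorem exists_local_rule {r : ℕ} (hr : 1 ≤ r) :
    ∃ M : ℝ, 0 < M ∧ ∀ (w : ℝ → ℝ) (p h : ℝ), Continuous w → (∀ t, 0 ≤ w t) → 0 < h →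
      (∀ t ∈ Set.Icc p (p + h), w t ≤ w p) → ∃ c : Fin r → ℝ,
        (∀ P : Polynomial ℝ, P.degree < r →
          ∫ t in p..p + h, P.eval t * w t = ∑ j, c j * P.eval (p + h * (j / r))) ∧
        ∑ j, |c j| ≤ M * h * w p := by
  have hr0 : (0 : ℝ) < r := by exact_mod_cast hr
  -- The right endpoint is not a node, so every node of a cell lies strictly to the left of the next
  -- cell.
  set v : Fin r → ℝ := fun j => (j : ℝ) / r with hv
  set ℓ : Fin r → Polynomial ℝ := Lagrange.basis Finset.univ v with hℓ
  have hb : ∀ j, ∃ C, ∀ u ∈ Set.Icc (0 : ℝ) 1, |(ℓ j).eval u| ≤ C := fun j =>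
    isCompact_Icc.exists_bound_of_continuousOn (ℓ j).continuous.continuousOn
  choose C hC using hb
  have hC0 : ∀ j, 0 ≤ C j := fun j => (abs_nonneg _).trans (hC j 0 (by simp))
  refine ⟨∑ j, C j + 1, by have := Finset.sum_nonneg fun j (_ : j ∈ Finset.univ) => hC0 j; linarith,
    fun w p h hw hw0 hh hwp => ?_⟩
  have hinj : Set.InjOn v (Finset.univ : Finset (Fin r)) := by
    intro i _ j _ hij
    simp only [hv, div_left_inj' hr0.ne'] at hij
    exact Fin.ext (by exact_mod_cast hij)
  refine ⟨fun j => ∫ t in p..p + h, (ℓ j).eval ((t - p) / h) * w t, fun P hP => ?_, ?_⟩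
  · set P' : Polynomial ℝ := P.comp (Polynomial.C h * Polynomial.X + Polynomial.C p) with hP'
    have hdeg : P'.degree < (Finset.univ : Finset (Fin r)).card := by
      rw [Finset.card_univ, Fintype.card_fin]
      rcases eq_or_ne P 0 with rfl | h0
      · simp [hP']
      · refine lt_of_le_of_lt Polynomial.degree_le_natDegree (lt_of_le_of_lt ?_ hP)
        rw [hP', Polynomial.natDegree_comp, Polynomial.natDegree_linear hh.ne', mul_one,
          Polynomial.degree_eq_natDegree h0]
    have key := Lagrange.eq_interpolate hinj hdeg
    have hev : ∀ t, P.eval t = ∑ j, P.eval (p + h * v j) * (ℓ j).eval ((t - p) / h) := by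
      intro t
      have h1 : P.eval t = P'.eval ((t - p) / h) := by
        simp [hP', Polynomial.eval_comp, mul_div_cancel₀ _ hh.ne']
      have h2 : ∀ u, P'.eval u = P.eval (p + h * u) := fun u => by
        rw [hP', Polynomial.eval_comp]; simp [add_comm]
      rw [h1]
      conv_lhs => rw [key]
      rw [Lagrange.interpolate_apply, Polynomial.eval_finsetSum]
      refine Finset.sum_congr rfl fun j _ => ?_
      rw [Polynomial.eval_mul, Polynomial.eval_C, h2]
    have hev' : ∀ t, P.eval t * w t =
        ∑ j, P.eval (p + h * v j) * ((ℓ j).eval ((t - p) / h) * w t) := fun t => by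
      conv_lhs => rw [hev, Finset.sum_mul]
      exact Finset.sum_congr rfl fun j _ => by ring
    rw [intervalIntegral.integral_congr fun t _ => hev' t, intervalIntegral.integral_finsetSum]
    · refine Finset.sum_congr rfl fun j _ => ?_
      rw [intervalIntegral.integral_const_mul, mul_comm]
    · intro j _
      apply Continuous.intervalIntegrable
      have := (ℓ j).continuous
      fun_prop
  · calc ∑ j, |∫ t in p..p + h, (ℓ j).eval ((t - p) / h) * w t|
        ≤ ∑ j, C j * w p * h := by
          refine Finset.sum_le_sum fun j _ => ?_
          have := intervalIntegral.norm_integral_le_of_norm_le_const (a := p) (b := p + h)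
            (C := C j * w p) (f := fun t => (ℓ j).eval ((t - p) / h) * w t) ?_
          · simpa [abs_of_pos hh] using this
          · intro t ht
            rw [Set.uIoc_of_le (by linarith)] at ht
            rw [Real.norm_eq_abs, abs_mul, abs_of_nonneg (hw0 t)]
            refine mul_le_mul (hC j _ ⟨div_nonneg (by linarith [ht.1]) hh.le, ?_⟩)
              (hwp t ⟨ht.1.le, ht.2⟩) (hw0 t) (hC0 j)
            rw [div_le_one hh]; linarith [ht.2]
      _ ≤ _ := by
          rw [← Finset.sum_mul, ← Finset.sum_mul]
          have : 0 ≤ w p * h := mul_nonneg (hw0 p) hh.le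
          nlinarith

end UnivariateWeight

/-! ### Composite rules on the half-line and their Peano kernels. -/

section HalfLine

variable {lam a : ℝ}

/-- As a function of `t`, the kernel is a polynomial of degree `r - 1` on cells to the right of `s`,
where the rule is exact, and it vanishes almost everywhere and at all nodes on cells to the left of
`s`. Only the cell containing `s` contributes; there the integral and the rule are bounded
separately, the weight being comparable with its value at `s`. -/
theorem abs_local_error_le (hlam : 1 < lam) (ha : 0 < a) (b : ℝ) {r : ℕ} (hr : 1 ≤ r)
    {M h T : ℝ} (hM : 0 < M) (hh : 0 < h) (hT : T ^ (lam - 1) * h ≤ 1) {i : ℕ}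
    (hi : h * i + h ≤ T) {c : Fin r → ℝ}
    (hex : ∀ P : Polynomial ℝ, P.degree < r →
      ∫ t in (h * i)..(h * i + h), P.eval t * freudWeight lam a b t =
        ∑ j, c j * P.eval (h * i + h * (j / r)))
    (hc : ∑ j, |c j| ≤ M * h * freudWeight lam a b (h * i)) {s : ℝ} (hs : 0 ≤ s) :
    |(∫ t in (h * i)..(h * i + h), peanoKernel r s t * freudWeight lam a b t) -
        ∑ j, c j * peanoKernel r s (h * i + h * (j / r))| ≤
      if i = ⌊s / h⌋₊ then (M + 1) * Real.exp (a * lam) * h ^ r * freudWeight lam a b s else 0 := by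
  have hr0 : (0 : ℝ) < r := by exact_mod_cast hr
  have hp0 : 0 ≤ h * i := by positivity
  have hwpos := freudWeight_pos lam a b
  have hfr : ∀ j : Fin r, (0 : ℝ) ≤ h * (j / r) ∧ h * ((j : ℝ) / r) < h := by
    intro j
    have h1 : ((j : ℕ) : ℝ) / r < 1 := by
      rw [div_lt_one hr0]; exact_mod_cast j.2
    exact ⟨by positivity, by nlinarith⟩
  have hrhs : 0 ≤ if i = ⌊s / h⌋₊ then
      (M + 1) * Real.exp (a * lam) * h ^ r * freudWeight lam a b s else 0 := by
    split_ifs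
    · have := hwpos s; positivity
    · rfl
  rcases le_or_gt s (h * i) with h1 | h1
  · set P : Polynomial ℝ := Polynomial.C (((r - 1).factorial : ℝ)⁻¹) *
      (Polynomial.X - Polynomial.C s) ^ (r - 1) with hP
    have hPev : ∀ t, s ≤ t → peanoKernel r s t = P.eval t := by
      intro t ht
      rw [peanoKernel, if_pos ht, hP]
      simp [div_eq_inv_mul]
    have hdeg : P.degree < r := by
      rw [hP, Polynomial.degree_C_mul (by positivity), Polynomial.degree_pow,
        Polynomial.degree_X_sub_C]
      simp only [nsmul_eq_mul, mul_one]
      exact_mod_cast (by omega : r - 1 < r)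
    have e1 : ∫ t in (h * i)..(h * i + h), peanoKernel r s t * freudWeight lam a b t =
        ∫ t in (h * i)..(h * i + h), P.eval t * freudWeight lam a b t := by
      apply intervalIntegral.integral_congr
      intro t ht
      rw [Set.uIcc_of_le (by linarith)] at ht
      simp only
      rw [hPev t (h1.trans ht.1)]
    have e2 : ∑ j, c j * peanoKernel r s (h * i + h * (j / r)) =
        ∑ j, c j * P.eval (h * i + h * (j / r)) :=
      Finset.sum_congr rfl fun j _ => by rw [hPev _ (by linarith [(hfr j).1])]
    rw [e1, e2, hex P hdeg]
    simpa using hrhs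
  rcases le_or_gt (h * i + h) s with h2 | h2
  · have e1 : ∫ t in (h * i)..(h * i + h), peanoKernel r s t * freudWeight lam a b t = 0 := by
      apply intervalIntegral.integral_zero_ae
      filter_upwards [Measure.ae_ne volume (h * i + h)] with t hts ht
      rw [Set.uIoc_of_le (by linarith)] at ht
      have : t < h * i + h := lt_of_le_of_ne ht.2 hts
      rw [peanoKernel, if_neg (by linarith), zero_mul]
    have e2 : ∑ j, c j * peanoKernel r s (h * i + h * (j / r)) = 0 :=
      Finset.sum_eq_zero fun j _ => by
        rw [peanoKernel, if_neg (by linarith [(hfr j).2]), mul_zero]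
    rw [e1, e2]
    simpa using hrhs
  · have hfl : i = ⌊s / h⌋₊ := by
      symm
      rw [Nat.floor_eq_iff (by positivity)]
      constructor
      · rw [le_div_iff₀ hh]; linarith
      · rw [div_lt_iff₀ hh]; linarith
    rw [if_pos hfl]
    have hwp : freudWeight lam a b (h * i) ≤ Real.exp (a * lam) * freudWeight lam a b s := by
      apply freudWeight_le_of_near hlam ha b hp0 h1.le (h2.le.trans hi)
      refine le_trans (mul_le_mul_of_nonneg_left (by linarith) ?_) hT
      apply Real.rpow_nonneg; linarith
    have hG : ∀ t, t ≤ h * i + h → peanoKernel r s t ≤ h ^ (r - 1) := fun t ht =>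
      peanoKernel_le r hh.le (by linarith)
    have b1 : |∫ t in (h * i)..(h * i + h), peanoKernel r s t * freudWeight lam a b t| ≤
        h ^ (r - 1) * freudWeight lam a b (h * i) * h := by
      have := intervalIntegral.norm_integral_le_of_norm_le_const (a := h * i) (b := h * i + h)
        (C := h ^ (r - 1) * freudWeight lam a b (h * i))
        (f := fun t => peanoKernel r s t * freudWeight lam a b t) ?_
      · simpa [abs_of_pos hh] using this
      · intro t ht
        rw [Set.uIoc_of_le (by linarith)] at ht
        rw [Real.norm_eq_abs, abs_mul, abs_of_nonneg (peanoKernel_nonneg r s t),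
          abs_of_pos (hwpos t)]
        exact mul_le_mul (hG t ht.2) (freudWeight_anti (by linarith) ha b hp0 ht.1.le)
          (hwpos t).le (by positivity)
    have b2 : |∑ j, c j * peanoKernel r s (h * i + h * (j / r))| ≤
        M * h * freudWeight lam a b (h * i) * h ^ (r - 1) := by
      calc _ ≤ ∑ j, |c j| * h ^ (r - 1) := by
            refine (Finset.abs_sum_le_sum_abs _ _).trans (Finset.sum_le_sum fun j _ => ?_)
            rw [abs_mul, abs_of_nonneg (peanoKernel_nonneg r s _)]
            exact mul_le_mul_of_nonneg_left (hG _ (by linarith [(hfr j).2])) (abs_nonneg _)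
        _ ≤ _ := by
            rw [← Finset.sum_mul]
            exact mul_le_mul_of_nonneg_right hc (by positivity)
    have hpow : h ^ r = h ^ (r - 1) * h := by
      rw [← pow_succ]; congr 1; omega
    calc _ ≤ _ := abs_sub _ _
      _ ≤ (M + 1) * h ^ r * freudWeight lam a b (h * i) := by
          rw [hpow]; linarith
      _ ≤ (M + 1) * h ^ r * (Real.exp (a * lam) * freudWeight lam a b s) := by gcongr
      _ = _ := by ring

/-- Composite rules on `[0, T]`: the Peano kernel of the error on `[0, R]` is dominated by the
weight, and powers of degree less than `r` are integrated exactly up to the tail. -/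
theorem exists_composite_rule (hlam : 1 < lam) (ha : 0 < a) (b : ℝ) {r : ℕ} (hr : 1 ≤ r) :
    ∃ C : ℝ, 0 < C ∧ ∀ (n : ℕ) (h T : ℝ), 0 < h → T = h * n → 0 < T → T ^ (lam - 1) * h ≤ 1 →
      ∃ c : Fin n → Fin r → ℝ, ∀ R, T ≤ R →
        (∀ s, 0 ≤ s → |(∫ t in (0 : ℝ)..R, peanoKernel r s t * freudWeight lam a b t) -
            ∑ i, ∑ j, c i j * peanoKernel r s (h * i + h * (j / r))| ≤
          (C * h ^ r + (1 / (a * T ^ (lam - 1))) ^ r) * freudWeight lam a b s) ∧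
        ∀ q < r, (∫ t in (0 : ℝ)..R, t ^ q * freudWeight lam a b t) -
            ∑ i, ∑ j, c i j * (h * i + h * (j / r)) ^ q =
          ∫ t in T..R, t ^ q * freudWeight lam a b t := by
  obtain ⟨M, hM, hrule⟩ := exists_local_rule hr
  have hw := continuous_freudWeight (by linarith : 0 < lam) a b
  have hwpos := freudWeight_pos lam a b
  refine ⟨(M + 1) * Real.exp (a * lam), by positivity, fun n h T hh hTn hT0 hT => ?_⟩
  have hloc : ∀ i : Fin n, ∃ c : Fin r → ℝ,
        (∀ P : Polynomial ℝ, P.degree < r →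
          ∫ t in (h * i)..(h * i + h), P.eval t * freudWeight lam a b t =
            ∑ j, c j * P.eval (h * i + h * (j / r))) ∧
        ∑ j, |c j| ≤ M * h * freudWeight lam a b (h * i) := fun i =>
    hrule _ _ _ hw (fun t => (hwpos t).le) hh fun t ht =>
      freudWeight_anti (by linarith) ha b (by positivity) ht.1
  choose c hc1 hc2 using hloc
  have hsplit : ∀ (R : ℝ) (f : ℝ → ℝ), (∀ x y, IntervalIntegrable f volume x y) →
      ∫ t in (0 : ℝ)..R, f t =
        (∑ i : Fin n, ∫ t in (h * (i : ℕ))..(h * (i : ℕ) + h), f t) + ∫ t in T..R, f t := by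
    intro R f hf
    rw [← intervalIntegral.integral_add_adjacent_intervals (hf 0 T) (hf T R)]
    congr 1
    have := intervalIntegral.sum_integral_adjacent_intervals (f := f) (μ := volume)
      (a := fun k : ℕ => h * k) (n := n) fun k _ => hf _ _
    simp only [Nat.cast_zero, mul_zero, ← hTn] at this
    rw [← this, Finset.sum_range]
    refine Finset.sum_congr rfl fun i _ => ?_
    congr 1; push_cast; ring
  refine ⟨c, fun R hR => ⟨fun s hs => ?_, fun q hq => ?_⟩⟩
  · rw [hsplit R _ (intervalIntegrable_peanoKernel_mul r s hw), add_sub_right_comm,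
      ← Finset.sum_sub_distrib]
    have t1 := integral_peanoKernel_tail_le hlam ha b hr hT0 hR hs
    have t0 : 0 ≤ ∫ t in T..R, peanoKernel r s t * freudWeight lam a b t :=
      intervalIntegral.integral_nonneg hR fun t _ =>
        mul_nonneg (peanoKernel_nonneg r s t) (hwpos t).le
    have t2 : |∑ i : Fin n, ((∫ t in (h * (i : ℕ))..(h * (i : ℕ) + h),
          peanoKernel r s t * freudWeight lam a b t) -
        ∑ j, c i j * peanoKernel r s (h * i + h * (j / r)))| ≤
        (M + 1) * Real.exp (a * lam) * h ^ r * freudWeight lam a b s := by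
      have hB : 0 ≤ (M + 1) * Real.exp (a * lam) * h ^ r * freudWeight lam a b s := by
        have := hwpos s; positivity
      -- At most one cell contributes for a given `s`, so summing over cells costs no factor `n`.
      calc _ ≤ ∑ i : Fin n, (if (i : ℕ) = ⌊s / h⌋₊ then
              (M + 1) * Real.exp (a * lam) * h ^ r * freudWeight lam a b s else 0) := by
            refine (Finset.abs_sum_le_sum_abs _ _).trans (Finset.sum_le_sum fun i _ => ?_)
            refine abs_local_error_le hlam ha b hr hM hh hT ?_ (hc1 i) (hc2 i) hs
            have : ((i : ℕ) : ℝ) + 1 ≤ n := by exact_mod_cast i.2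
            rw [hTn]; nlinarith
        _ = ∑ i ∈ Finset.range n, (if i = ⌊s / h⌋₊ then
              (M + 1) * Real.exp (a * lam) * h ^ r * freudWeight lam a b s else 0) := by
            rw [Finset.sum_range]
        _ ≤ _ := by
            rw [Finset.sum_ite_eq']
            split_ifs
            · rfl
            · exact hB
    rw [add_mul]
    exact (abs_add_le _ _).trans (add_le_add t2 (by rwa [abs_of_nonneg t0]))
  · rw [hsplit R _ fun x y => (by fun_prop : Continuous fun t => t ^ q * freudWeight lam a b t).intervalIntegrable x y,
      add_sub_right_comm, ← Finset.sum_sub_distrib, Finset.sum_eq_zero, zero_add]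
    intro i _
    have := hc1 i (Polynomial.X ^ q) (by rw [Polynomial.degree_X_pow]; exact_mod_cast hq)
    simp only [Polynomial.eval_pow, Polynomial.eval_X] at this
    rw [this, sub_self]

/-- For `t ≥ 1` one has `t^q ≤ t^(r-1)`, and `t^(r-1)` is `(r-1)!` times the Peano kernel at `s =
0`, so the kernel tail bound applies. -/
theorem integral_pow_tail_le (hlam : 1 < lam) (ha : 0 < a) (b : ℝ) {r : ℕ} (hr : 1 ≤ r)
    {T R : ℝ} (hT : 1 ≤ T) (hR : T ≤ R) {q : ℕ} (hq : q < r) :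
    |∫ t in T..R, t ^ q * freudWeight lam a b t| ≤
      (r - 1).factorial * ((1 / (a * T ^ (lam - 1))) ^ r * freudWeight lam a b 0) := by
  have hw := continuous_freudWeight (by linarith : 0 < lam) a b
  have hwpos := freudWeight_pos lam a b
  have h1 := integral_peanoKernel_tail_le hlam ha b hr (by linarith : 0 < T) hR le_rfl
  rw [abs_of_nonneg (intervalIntegral.integral_nonneg hR fun t ht =>
    mul_nonneg (pow_nonneg (by linarith [ht.1]) _) (hwpos t).le)]
  refine le_trans ?_ (mul_le_mul_of_nonneg_left h1 (Nat.cast_nonneg _))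
  rw [← intervalIntegral.integral_const_mul]
  apply intervalIntegral.integral_mono_on hR
  · exact (by fun_prop : Continuous fun t => t ^ q * freudWeight lam a b t).intervalIntegrable _ _
  · exact (intervalIntegrable_peanoKernel_mul r 0 hw T R).const_mul _
  · intro t ht
    have ht1 : 1 ≤ t := hT.trans ht.1
    rw [peanoKernel, if_pos (by linarith), ← mul_assoc, sub_zero,
      mul_div_cancel₀ _ (by positivity)]
    exact mul_le_mul_of_nonneg_right (pow_le_pow_right₀ ht1 (by omega)) (hwpos t).le

end HalfLine

/-! ### Functionals represented by kernels dominated by the weight. -/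

section KernelBound

theorem contDiff_nat_of_smooth {E : Type*} [NormedAddCommGroup E] [NormedSpace ℝ E] {f : E → ℝ}
    (hf : ContDiff ℝ ∞ f) (n : ℕ) : ContDiff ℝ n f :=
  hf.of_le (by exact_mod_cast le_top)

/-- Taylor's formula with integral remainder. The kernel vanishes for `s > t`, so the remainder can
be taken over an interval independent of `t`, ready for Fubini. -/
theorem taylor_peanoKernel {r : ℕ} (hr : 1 ≤ r) {f : ℝ → ℝ} (hf : ContDiff ℝ ∞ f) {t R : ℝ}
    (ht : 0 ≤ t) (htR : t ≤ R) :
    f t = (∑ j ∈ Finset.range r, iteratedDeriv j f 0 * (t ^ j / j.factorial)) +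
      ∫ s in Set.Ioc 0 R, iteratedDeriv r f s * peanoKernel r s t := by
  obtain ⟨q, rfl⟩ : ∃ q, r = q + 1 := ⟨r - 1, by omega⟩
  -- For `t = 0` the interval degenerates to a point and derivatives within it are not unique.
  rcases ht.eq_or_lt with rfl | ht0
  · rw [Finset.sum_eq_single_of_mem 0 (by simp) (fun j _ hj => by simp [hj]),
      setIntegral_congr_fun (g := fun _ => 0) measurableSet_Ioc]
    · simp
    · intro s hs
      simp only [peanoKernel]
      rw [if_neg (not_le.2 hs.1), mul_zero]
  have hu : UniqueDiffOn ℝ (Set.uIcc 0 t) := uniqueDiffOn_uIcc ht0.ne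
  have hmem : (0 : ℝ) ∈ Set.uIcc 0 t := Set.left_mem_uIcc
  have hfn := contDiff_nat_of_smooth hf
  have key := taylor_integral_remainder (f := f) (x := t) (x₀ := 0) (n := q) (hfn _).contDiffOn
  rw [taylor_within_apply] at key
  have e1 : ∑ k ∈ Finset.range (q + 1), ((k.factorial : ℝ)⁻¹ * (t - 0) ^ k) •
      iteratedDerivWithin k f (Set.uIcc 0 t) 0 =
      ∑ j ∈ Finset.range (q + 1), iteratedDeriv j f 0 * (t ^ j / j.factorial) := by
    refine Finset.sum_congr rfl fun j _ => ?_
    rw [iteratedDerivWithin_eq_iteratedDeriv hu (hfn j).contDiffAt hmem, sub_zero, smul_eq_mul]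
    ring
  rw [e1] at key
  rw [sub_eq_iff_eq_add'.1 key, intervalIntegral.integral_of_le ht]
  congr 1
  have e2 : ∫ s in Set.Ioc 0 R, iteratedDeriv (q + 1) f s * peanoKernel (q + 1) s t =
      ∫ s in Set.Ioc 0 t, iteratedDeriv (q + 1) f s * peanoKernel (q + 1) s t := by
    apply setIntegral_eq_of_subset_of_forall_sdiff_eq_zero measurableSet_Ioc
      (Set.Ioc_subset_Ioc_right htR)
    intro s hs
    have : ¬ s ≤ t := fun h => hs.2 ⟨hs.1.1, h⟩
    rw [peanoKernel, if_neg this, mul_zero]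
  rw [e2]
  refine setIntegral_congr_fun measurableSet_Ioc fun s hs => ?_
  simp only [peanoKernel]
  rw [if_pos hs.2, iteratedDerivWithin_eq_iteratedDeriv hu (hfn _).contDiffAt
    (by rw [Set.uIcc_of_le ht]; exact ⟨hs.1.le, hs.2⟩), smul_eq_mul]
  simp only [Nat.add_sub_cancel]
  ring

/-- The functional `L` is given by kernels against the derivatives of order at most `r`,
supported in `[-R, R]` and dominated by `ε * w`. -/
def KernelBound (w : ℝ → ℝ) (r : ℕ) (R ε : ℝ) (L : (ℝ → ℝ) → ℝ) : Prop :=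
  ∃ h : ℕ → ℝ → ℝ, (∀ k, Measurable (h k)) ∧ (∀ k s, |h k s| ≤ ε * w s) ∧
    (∀ k s, s ∉ Set.Icc (-R) R → h k s = 0) ∧
    ∀ f, ContDiff ℝ ∞ f → L f = ∑ k ∈ Finset.range (r + 1), ∫ s, iteratedDeriv k f s * h k s

theorem continuous_iteratedDeriv_of_smooth {f : ℝ → ℝ} (hf : ContDiff ℝ ∞ f) (k : ℕ) :
    Continuous (iteratedDeriv k f) :=
  (contDiff_nat_of_smooth hf k).continuous_iteratedDeriv k le_rfl

theorem integrable_mul_of_bound_of_support {w g h : ℝ → ℝ} {R ε : ℝ} (hw : Continuous w)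
    (hg : Continuous g) (hh : Measurable h) (hb : ∀ s, |h s| ≤ ε * w s)
    (hs : ∀ s, s ∉ Set.Icc (-R) R → h s = 0) : Integrable fun s => g s * h s := by
  have h1 : Integrable ((Set.Icc (-R) R).indicator fun s => g s * (ε * w s)) :=
    (Continuous.integrableOn_Icc (by fun_prop)).integrable_indicator measurableSet_Icc
  refine h1.mono (hg.measurable.mul hh).aestronglyMeasurable
    (Filter.Eventually.of_forall fun s => ?_)
  by_cases hm : s ∈ Set.Icc (-R) R
  · rw [Set.indicator_of_mem hm, norm_mul, norm_mul]
    exact mul_le_mul_of_nonneg_left ((hb s).trans (le_abs_self _)) (norm_nonneg _)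
  · rw [hs s hm]; simp

variable {w : ℝ → ℝ} {r : ℕ} {R ε ε' : ℝ} {L L' : (ℝ → ℝ) → ℝ}

theorem KernelBound.mono (hw0 : ∀ s, 0 ≤ w s) (h : KernelBound w r R ε L) (hε : ε ≤ ε') :
    KernelBound w r R ε' L := by
  obtain ⟨k, h1, h2, h3, h4⟩ := h
  exact ⟨k, h1, fun i s => (h2 i s).trans (mul_le_mul_of_nonneg_right hε (hw0 s)), h3, h4⟩

theorem KernelBound.congr (h : KernelBound w r R ε L)
    (hL : ∀ f, ContDiff ℝ ∞ f → L' f = L f) : KernelBound w r R ε L' := by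
  obtain ⟨k, h1, h2, h3, h4⟩ := h
  exact ⟨k, h1, h2, h3, fun f hf => (hL f hf).trans (h4 f hf)⟩

theorem KernelBound.add (hw : Continuous w) (h : KernelBound w r R ε L)
    (h' : KernelBound w r R ε' L') : KernelBound w r R (ε + ε') (fun f => L f + L' f) := by
  obtain ⟨k, h1, h2, h3, h4⟩ := h
  obtain ⟨k', h1', h2', h3', h4'⟩ := h'
  refine ⟨fun i s => k i s + k' i s, fun i => (h1 i).add (h1' i), fun i s => ?_, fun i s hs => ?_,
    fun f hf => ?_⟩
  · rw [add_mul]; exact (abs_add_le _ _).trans (add_le_add (h2 i s) (h2' i s))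
  · simp [h3 i s hs, h3' i s hs]
  · simp only [h4 f hf, h4' f hf]
    rw [← Finset.sum_add_distrib]
    refine Finset.sum_congr rfl fun i _ => ?_
    have hc := continuous_iteratedDeriv_of_smooth hf i
    rw [← integral_add (integrable_mul_of_bound_of_support hw hc (h1 i) (h2 i) (h3 i))
      (integrable_mul_of_bound_of_support hw hc (h1' i) (h2' i) (h3' i))]
    simp_rw [mul_add]

theorem KernelBound.const_mul (c : ℝ) (h : KernelBound w r R ε L) :
    KernelBound w r R (|c| * ε) (fun f => c * L f) := by
  obtain ⟨k, h1, h2, h3, h4⟩ := h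
  refine ⟨fun i s => c * k i s, fun i => (h1 i).const_mul c, fun i s => ?_, fun i s hs => ?_,
    fun f hf => ?_⟩
  · rw [abs_mul, mul_assoc]; exact mul_le_mul_of_nonneg_left (h2 i s) (abs_nonneg c)
  · simp [h3 i s hs]
  · simp only [h4 f hf]
    rw [Finset.mul_sum]
    refine Finset.sum_congr rfl fun i _ => ?_
    rw [← integral_const_mul]
    congr 1; ext s; ring

theorem KernelBound.sub (hw : Continuous w) (h : KernelBound w r R ε L)
    (h' : KernelBound w r R ε' L') : KernelBound w r R (ε + ε') (fun f => L f - L' f) := by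
  have := h.add hw (h'.const_mul (-1))
  simp only [abs_neg, abs_one, one_mul, neg_one_mul] at this
  simpa only [sub_eq_add_neg] using this

theorem KernelBound.zero : KernelBound w r R 0 (fun _ => 0) :=
  ⟨fun _ _ => 0, fun _ => measurable_const, by simp, by simp, by simp⟩

theorem KernelBound.sum (hw : Continuous w) {ι : Type*} (s : Finset ι) {ε : ι → ℝ}
    {L : ι → (ℝ → ℝ) → ℝ} (h : ∀ i ∈ s, KernelBound w r R (ε i) (L i)) :
    KernelBound w r R (∑ i ∈ s, ε i) (fun f => ∑ i ∈ s, L i f) := by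
  classical
  induction s using Finset.induction_on with
  | empty => simpa using KernelBound.zero
  | insert i s hi ih =>
    simp only [Finset.sum_insert hi]
    exact (h i (by simp)).add hw (ih fun j hj => h j (by simp [hj]))

theorem KernelBound.comp_neg (hw1 : ∀ s, w (-s) = w s) (h : KernelBound w r R ε L) :
    KernelBound w r R ε (fun f => L fun s => f (-s)) := by
  obtain ⟨k, h1, h2, h3, h4⟩ := h
  refine ⟨fun i s => (-1) ^ i * k i (-s), fun i => ((h1 i).comp measurable_neg).const_mul _,
    fun i s => ?_, fun i s hs => ?_, fun f hf => ?_⟩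
  · rw [abs_mul, abs_pow, abs_neg, abs_one, one_pow, one_mul, ← hw1 s]; exact h2 i (-s)
  · simp only
    rw [h3 i (-s), mul_zero]
    contrapose! hs
    exact ⟨by linarith [hs.2], by linarith [hs.1]⟩
  · simp only
    rw [h4 (fun s => f (-s)) (hf.comp contDiff_neg)]
    refine Finset.sum_congr rfl fun i _ => ?_
    rw [← integral_neg_eq_self]
    congr 1; ext s
    rw [iteratedDeriv_comp_neg, neg_neg, smul_eq_mul]; ring

theorem KernelBound.of_single {K : ℝ → ℝ} (hK : Measurable K) (hb : ∀ s, |K s| ≤ ε * w s)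
    (hs : ∀ s, s ∉ Set.Icc (-R) R → K s = 0) (hε : 0 ≤ ε) (hw0 : ∀ s, 0 ≤ w s) {q : ℕ}
    (hq : q ≤ r) : KernelBound w r R ε (fun f => ∫ s, iteratedDeriv q f s * K s) := by
  refine ⟨fun i => if i = q then K else 0, fun i => ?_, fun i s => ?_, fun i s h => ?_,
    fun f _ => ?_⟩
  · dsimp only; split_ifs
    · exact hK
    · exact measurable_const
  · dsimp only; split_ifs
    · exact hb s
    · simpa using mul_nonneg hε (hw0 s)
  · dsimp only; split_ifs
    · exact hs s h
    · rfl
  · rw [Finset.sum_eq_single_of_mem q (by simpa using Nat.lt_succ_of_le hq)]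
    · simp
    · intro j _ hj; simp [hj]

/-- Integration by parts gives `g 0 = ∫₀¹ g - ∫₀¹ (1 - s) g'(s) ds`, with both kernels at most `1 ≤
w / δ` on `[0, 1]`. This makes the Taylor coefficients of order `< r` at `0` admissible functionals.
-/
theorem KernelBound.iteratedDeriv_zero (hw : Continuous w) (hw0 : ∀ s, 0 ≤ w s) {δ : ℝ}
    (hδ : 0 < δ) (hwδ : ∀ s ∈ Set.Icc (0 : ℝ) 1, δ ≤ w s) (hR : 1 ≤ R) {q : ℕ} (hq : q < r) :
    KernelBound w r R (2 / δ) (fun f => iteratedDeriv q f 0) := by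
  have hsub : ∀ s, s ∉ Set.Icc (-R) R → s ∉ Set.Icc (0 : ℝ) 1 := fun s hs h =>
    hs ⟨by linarith [h.1], h.2.trans hR⟩
  have hbd : ∀ g : ℝ → ℝ, (∀ s ∈ Set.Icc (0 : ℝ) 1, |g s| ≤ 1) →
      ∀ s, |(Set.Icc (0 : ℝ) 1).indicator g s| ≤ 1 / δ * w s := by
    intro g hg s
    by_cases hs : s ∈ Set.Icc (0 : ℝ) 1
    · rw [Set.indicator_of_mem hs]
      refine (hg s hs).trans ?_
      rw [one_div, inv_mul_eq_div, one_le_div hδ]; exact hwδ s hs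
    · rw [Set.indicator_of_notMem hs, abs_zero]; exact mul_nonneg (by positivity) (hw0 s)
  have k1 : KernelBound w r R (1 / δ) (fun f => ∫ s, iteratedDeriv q f s *
      (Set.Icc (0 : ℝ) 1).indicator (fun _ => 1) s) :=
    KernelBound.of_single (measurable_const.indicator measurableSet_Icc) (hbd _ (by simp))
      (fun s hs => Set.indicator_of_notMem (hsub s hs) _) (by positivity) hw0 hq.le
  have k2 : KernelBound w r R (1 / δ) (fun f => ∫ s, iteratedDeriv (q + 1) f s *
      (Set.Icc (0 : ℝ) 1).indicator (fun s => 1 - s) s) :=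
    KernelBound.of_single ((measurable_const.sub measurable_id).indicator measurableSet_Icc)
      (hbd _ fun s hs => by simp only [Pi.sub_apply, id]; rw [abs_le]; constructor <;> linarith [hs.1, hs.2])
      (fun s hs => Set.indicator_of_notMem (hsub s hs) _) (by positivity) hw0 hq
  refine (k1.sub hw k2).mono hw0 (by rw [← add_div]; norm_num) |>.congr fun f hf => ?_
  have e : ∀ g G : ℝ → ℝ, ∫ s, G s * (Set.Icc (0 : ℝ) 1).indicator g s =
      ∫ s in (0 : ℝ)..1, G s * g s := by
    intro g G
    rw [intervalIntegral.integral_of_le zero_le_one, ← integral_Icc_eq_integral_Ioc,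
      ← integral_indicator measurableSet_Icc]
    congr 1; ext s
    by_cases hs : s ∈ Set.Icc (0 : ℝ) 1 <;> simp [Set.indicator, hs]
  rw [e, e]
  have hd : ∀ x, HasDerivAt (iteratedDeriv q f) (iteratedDeriv (q + 1) f x) x := by
    intro x
    rw [iteratedDeriv_succ]
    exact ((contDiff_nat_of_smooth hf (q + 1)).differentiable_iteratedDeriv q
      (by exact_mod_cast Nat.lt_succ_self q) x).hasDerivAt
  have hd1 : ∀ x : ℝ, HasDerivAt (fun s : ℝ => 1 - s) (-1) x := fun x => by
    simpa using (hasDerivAt_id x).const_sub 1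
  have hc := continuous_iteratedDeriv_of_smooth hf q
  have hc' := continuous_iteratedDeriv_of_smooth hf (q + 1)
  have := intervalIntegral.integral_eq_sub_of_hasDerivAt (a := 0) (b := 1)
    (fun x _ => (hd x).mul (hd1 x))
    (Continuous.intervalIntegrable (by fun_prop) 0 1)
  simp only [Pi.mul_apply] at this
  rw [intervalIntegral.integral_add (Continuous.intervalIntegrable (by fun_prop) 0 1)
    (Continuous.intervalIntegrable (by fun_prop) 0 1)] at this
  simp only [mul_neg, mul_one, intervalIntegral.integral_neg, sub_self, mul_zero, sub_zero,
    zero_sub] at this ⊢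
  linarith

end KernelBound

/-! ### Univariate quadratures with `O(2^k)` nodes and error of order `2^(-k*α)`. -/

section UnivariateRule

/-- Peano representation of the error of a quadrature on `[0, R]`. -/
theorem quadrature_error_eq {r : ℕ} (hr : 1 ≤ r) {w : ℝ → ℝ} (hw : Continuous w) {R : ℝ}
    (hR : 0 ≤ R) {ι : Type*} [Fintype ι] (c x : ι → ℝ) (hx : ∀ i, 0 ≤ x i ∧ x i ≤ R) {f : ℝ → ℝ}
    (hf : ContDiff ℝ ∞ f) :
    (∫ t in (0 : ℝ)..R, f t * w t) - ∑ i, c i * f (x i) =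
      (∑ q ∈ Finset.range r, ((∫ t in (0 : ℝ)..R, t ^ q * w t) - ∑ i, c i * x i ^ q) /
        q.factorial * iteratedDeriv q f 0) +
      ∫ s in Set.Ioc 0 R, iteratedDeriv r f s *
        ((∫ t in (0 : ℝ)..R, peanoKernel r s t * w t) - ∑ i, c i * peanoKernel r s (x i)) := by
  have hc := continuous_iteratedDeriv_of_smooth hf r
  set ν : Measure ℝ := volume.restrict (Set.Ioc 0 R) with hν
  have hfin : IsFiniteMeasure ν := ⟨by simp [hν]⟩
  obtain ⟨D, hD⟩ := isCompact_Icc (a := (0 : ℝ)) (b := R) |>.exists_bound_of_continuousOn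
    hc.continuousOn
  obtain ⟨W, hW⟩ := isCompact_Icc (a := (0 : ℝ)) (b := R) |>.exists_bound_of_continuousOn
    hw.continuousOn
  have hD0 : 0 ≤ D := (norm_nonneg _).trans (hD 0 ⟨le_rfl, hR⟩)
  have hG : ∀ s t, 0 ≤ s → t ≤ R → ‖peanoKernel r s t‖ ≤ R ^ (r - 1) := fun s t hs ht => by
    rw [Real.norm_of_nonneg (peanoKernel_nonneg r s t)]
    exact peanoKernel_le r hR (by linarith)
  have hGm := measurable_peanoKernel r
  have hint : ∀ t ≤ R, Integrable (fun s => iteratedDeriv r f s * peanoKernel r s t) ν := by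
    intro t ht
    refine Integrable.of_bound (C := D * R ^ (r - 1)) ?_ ?_
    · exact (hc.measurable.mul (hGm.comp (measurable_id.prodMk measurable_const))).aestronglyMeasurable
    · rw [hν]
      filter_upwards [ae_restrict_mem measurableSet_Ioc] with s hs
      rw [norm_mul]
      exact mul_le_mul (hD s ⟨hs.1.le, hs.2⟩) (hG s t hs.1.le ht) (norm_nonneg _) hD0
  -- All factors are bounded on the square, so the `s` and `t` integrations may be exchanged.
  have hint2 : Integrable (Function.uncurry fun t s =>
      iteratedDeriv r f s * peanoKernel r s t * w t) (ν.prod ν) := by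
    refine Integrable.of_bound (C := D * R ^ (r - 1) * W) ?_ ?_
    · have h1 : Measurable fun p : ℝ × ℝ => peanoKernel r p.2 p.1 := hGm.comp measurable_swap
      exact (((hc.measurable.comp measurable_snd).mul h1).mul
        (hw.measurable.comp measurable_fst)).aestronglyMeasurable
    · rw [hν, Measure.prod_restrict]
      filter_upwards [ae_restrict_mem (measurableSet_Ioc.prod measurableSet_Ioc)] with p hp
      simp only [Function.uncurry, norm_mul]
      have h1 := hD p.2 ⟨hp.2.1.le, hp.2.2⟩
      have h2 := hG p.2 p.1 hp.2.1.le hp.1.2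
      have h3 := hW p.1 ⟨hp.1.1.le, hp.1.2⟩
      have : 0 ≤ R ^ (r - 1) := by positivity
      gcongr
  have ii : ∀ g : ℝ → ℝ, ∫ t in (0 : ℝ)..R, g t = ∫ t, g t ∂ν := fun g =>
    intervalIntegral.integral_of_le hR
  have e1 : ∫ t in (0 : ℝ)..R, f t * w t =
      (∑ q ∈ Finset.range r, (∫ t in (0 : ℝ)..R, t ^ q * w t) / q.factorial *
        iteratedDeriv q f 0) +
      ∫ s, iteratedDeriv r f s * (∫ t in (0 : ℝ)..R, peanoKernel r s t * w t) ∂ν := by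
    simp only [ii]
    have h1 : ∀ᵐ t ∂ν, f t * w t =
        (∑ q ∈ Finset.range r, iteratedDeriv q f 0 / q.factorial * (t ^ q * w t)) +
        ∫ s, iteratedDeriv r f s * peanoKernel r s t * w t ∂ν := by
      filter_upwards [ae_restrict_mem measurableSet_Ioc] with t ht
      rw [integral_mul_const]
      conv_lhs => rw [taylor_peanoKernel hr hf ht.1.le ht.2, add_mul, Finset.sum_mul]
      congr 1
      exact Finset.sum_congr rfl fun q _ => by ring
    have hi : ∀ q ∈ Finset.range r, Integrable (fun t => iteratedDeriv q f 0 / q.factorial *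
        (t ^ q * w t)) ν := fun q _ =>
      (Continuous.integrableOn_Ioc (by fun_prop))
    have hil : Integrable (fun t => ∫ s, iteratedDeriv r f s * peanoKernel r s t * w t ∂ν) ν :=
      hint2.integral_prod_left
    rw [integral_congr_ae h1, integral_add (integrable_finsetSum _ hi) hil,
      integral_finsetSum _ hi, integral_integral_swap hint2]
    congr 1
    · refine Finset.sum_congr rfl fun q _ => ?_
      rw [integral_const_mul]; ring
    · congr 1; ext s
      rw [← integral_const_mul]
      congr 1; ext t; ring
  have e2 : ∀ i, f (x i) = (∑ q ∈ Finset.range r, x i ^ q / q.factorial * iteratedDeriv q f 0) +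
      ∫ s, iteratedDeriv r f s * peanoKernel r s (x i) ∂ν := fun i => by
    rw [taylor_peanoKernel hr hf (hx i).1 (hx i).2]
    congr 1
    exact Finset.sum_congr rfl fun q _ => by ring
  have e3 : ∑ i, c i * f (x i) = (∑ q ∈ Finset.range r, (∑ i, c i * x i ^ q) / q.factorial *
        iteratedDeriv q f 0) +
      ∫ s, iteratedDeriv r f s * ∑ i, c i * peanoKernel r s (x i) ∂ν := by
    have h1 : ∀ s, iteratedDeriv r f s * ∑ i, c i * peanoKernel r s (x i) =
        ∑ i, c i * (iteratedDeriv r f s * peanoKernel r s (x i)) := fun s => by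
      rw [Finset.mul_sum]; exact Finset.sum_congr rfl fun i _ => by ring
    simp_rw [h1]
    rw [integral_finsetSum _ fun i _ => (hint (x i) (hx i).2).const_mul _]
    simp_rw [integral_const_mul]
    rw [Finset.sum_congr rfl fun i _ => by rw [e2 i, mul_add]]
    rw [Finset.sum_add_distrib]
    congr 1
    simp_rw [Finset.mul_sum, Finset.sum_div, Finset.sum_mul]
    rw [Finset.sum_comm]
    exact Finset.sum_congr rfl fun q _ => Finset.sum_congr rfl fun i _ => by ring
  have hi1 : Integrable (fun s => iteratedDeriv r f s *
      ∫ t in (0 : ℝ)..R, peanoKernel r s t * w t) ν := by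
    simp only [ii]
    refine hint2.integral_prod_right.congr (Filter.Eventually.of_forall fun s => ?_)
    simp only [Function.uncurry]
    rw [← integral_const_mul]
    congr 1; ext t; ring
  have hi2 : Integrable (fun s => iteratedDeriv r f s * ∑ i, c i * peanoKernel r s (x i)) ν := by
    have : Integrable (fun s => ∑ i, c i * (iteratedDeriv r f s * peanoKernel r s (x i))) ν :=
      integrable_finsetSum _ fun i _ => (hint (x i) (hx i).2).const_mul _
    refine this.congr (Filter.Eventually.of_forall fun s => ?_)
    simp only
    rw [Finset.mul_sum]; exact Finset.sum_congr rfl fun i _ => by ring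
  simp_rw [mul_sub]
  rw [integral_sub hi1 hi2, e1, e3]
  simp_rw [sub_div, sub_mul, Finset.sum_sub_distrib]
  ring

theorem measurable_kernel_error (r : ℕ) {w : ℝ → ℝ} (hw : Continuous w) {R : ℝ} (hR : 0 ≤ R)
    {ι : Type*} [Fintype ι] (c x : ι → ℝ) : Measurable fun s =>
      (∫ t in (0 : ℝ)..R, peanoKernel r s t * w t) - ∑ i, c i * peanoKernel r s (x i) := by
  have hGm := measurable_peanoKernel r
  refine Measurable.sub ?_ (Finset.measurable_fun_sum _ fun i _ =>
    (hGm.comp (measurable_id.prodMk measurable_const)).const_mul _)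
  simp only [intervalIntegral.integral_of_le hR]
  have : StronglyMeasurable (Function.uncurry fun s t => peanoKernel r s t * w t) :=
    (hGm.mul (hw.measurable.comp measurable_snd)).stronglyMeasurable
  exact this.integral_prod_right.measurable

/-- The condition `T^(lam-1) * h = 1` balances the two errors: the tail factor `(1 / (a *
T^(lam-1)))^r` becomes `(h / a)^r`, of the same order as the cell error. The constant does not
depend on `R`, which is later sent to infinity. -/
theorem exists_halfline_rule {lam a : ℝ} (hlam : 1 < lam) (ha : 0 < a) (b : ℝ) {r : ℕ}
    (hr : 1 ≤ r) :
    ∃ C : ℝ, 0 < C ∧ ∀ (n : ℕ) (h T : ℝ), 0 < h → T = h * n → 1 ≤ T → T ^ (lam - 1) * h = 1 →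
      ∃ c x : Fin n × Fin r → ℝ, ∀ R, T ≤ R →
        KernelBound (freudWeight lam a b) r R (C * h ^ r) (fun f =>
          (∫ t in (0 : ℝ)..R, f t * freudWeight lam a b t) - ∑ i, c i * f (x i)) := by
  obtain ⟨C, hC, hrule⟩ := exists_composite_rule hlam ha b hr
  have hw := continuous_freudWeight (by linarith : 0 < lam) a b
  have hwpos := freudWeight_pos lam a b
  have hr0 : (0 : ℝ) < r := by exact_mod_cast hr
  set w := freudWeight lam a b with hwdef
  set A : ℝ := (r - 1).factorial * ((1 / a) ^ r * w 0) with hA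
  have hA0 : 0 < A := by have := hwpos 0; positivity
  -- The first summand pays for the `r` moments missed beyond `T`, each multiplied by a Taylor
  -- coefficient at `0`; the second is the bound for the Peano kernel of the error.
  refine ⟨r * (A * (2 / w 1)) + (C + (1 / a) ^ r), by have := hwpos 1; positivity,
    fun n h T hh hTn hT hTh => ?_⟩
  obtain ⟨c, hc⟩ := hrule n h T hh hTn (by linarith) hTh.le
  set x : Fin n × Fin r → ℝ := fun i => h * (i.1 : ℕ) + h * ((i.2 : ℕ) / r) with hx
  refine ⟨fun i => c i.1 i.2, x, fun R hR => ?_⟩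
  obtain ⟨hc1, hc2⟩ := hc R hR
  have hR0 : 0 ≤ R := by linarith
  have hxR : ∀ i, 0 ≤ x i ∧ x i ≤ R := by
    intro i
    refine ⟨by positivity, le_trans ?_ hR⟩
    have h1 : ((i.2 : ℕ) : ℝ) / r ≤ 1 := by
      rw [div_le_one hr0]; exact_mod_cast i.2.2.le
    have h2 : ((i.1 : ℕ) : ℝ) + 1 ≤ n := by exact_mod_cast i.1.2
    rw [hTn]; simp only [hx]; nlinarith
  have hκ : 1 / (a * T ^ (lam - 1)) = 1 / a * h := by
    have : T ^ (lam - 1) = h⁻¹ := eq_inv_of_mul_eq_one_left hTh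
    rw [this]; field_simp
  set K : ℝ → ℝ := (Set.Ioc 0 R).indicator fun s => (∫ t in (0 : ℝ)..R, peanoKernel r s t * w t) -
    ∑ i, c i.1 i.2 * peanoKernel r s (x i) with hK
  have hKb : KernelBound w r R ((C + (1 / a) ^ r) * h ^ r)
      (fun f => ∫ s, iteratedDeriv r f s * K s) := by
    have hpos : 0 ≤ (C + (1 / a) ^ r) * h ^ r := by positivity
    refine KernelBound.of_single
      ((measurable_kernel_error r hw hR0 _ x).indicator measurableSet_Ioc) (fun s => ?_)
      (fun s hs => ?_) hpos (fun s => (hwpos s).le) le_rfl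
    · by_cases hs : s ∈ Set.Ioc 0 R
      · rw [Set.indicator_of_mem hs]
        have := hc1 s hs.1.le
        rw [hκ, mul_pow, ← add_mul] at this
        simpa only [hx, Fintype.sum_prod_type] using this
      · rw [Set.indicator_of_notMem hs, abs_zero]
        exact mul_nonneg hpos (hwpos s).le
    · exact Set.indicator_of_notMem (fun h' => hs ⟨by linarith [h'.1], h'.2⟩) _
  set B : ℕ → ℝ := fun q => (∫ t in T..R, t ^ q * w t) / q.factorial with hB
  have hBb : ∀ q ∈ Finset.range r, |B q| ≤ A * h ^ r := by
    intro q hq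
    have := integral_pow_tail_le hlam ha b hr hT hR (Finset.mem_range.1 hq)
    rw [hκ, mul_pow] at this
    rw [hB, abs_div, Nat.abs_cast]
    calc _ ≤ |∫ t in T..R, t ^ q * w t| / 1 := by
          gcongr; exact_mod_cast Nat.one_le_iff_ne_zero.2 (Nat.factorial_ne_zero _)
      _ ≤ _ := by rw [div_one]; refine this.trans (le_of_eq ?_); rw [hA]; ring
  have hPb : KernelBound w r R (∑ q ∈ Finset.range r, |B q| * (2 / w 1))
      (fun f => ∑ q ∈ Finset.range r, B q * iteratedDeriv q f 0) :=
    KernelBound.sum hw _ fun q hq => (KernelBound.iteratedDeriv_zero hw (fun s => (hwpos s).le)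
      (hwpos 1) (fun s hs => freudWeight_anti (by linarith) ha b hs.1 hs.2) (hT.trans hR)
      (Finset.mem_range.1 hq)).const_mul _
  refine ((hPb.add hw hKb).mono (fun s => (hwpos s).le) ?_).congr fun f hf => ?_
  · rw [add_mul (_ * _)]
    refine add_le_add ?_ le_rfl
    calc _ ≤ ∑ q ∈ Finset.range r, A * h ^ r * (2 / w 1) :=
          Finset.sum_le_sum fun q hq => mul_le_mul_of_nonneg_right (hBb q hq)
            (by have := hwpos 1; positivity)
      _ = _ := by rw [Finset.sum_const, Finset.card_range, nsmul_eq_mul]; ring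
  · rw [quadrature_error_eq hr hw hR0 _ x hxR hf]
    congr 1
    · refine Finset.sum_congr rfl fun q hq => ?_
      have := hc2 q (Finset.mem_range.1 hq)
      simp only [hB]
      rw [← this]
      simp only [hx, Fintype.sum_prod_type]
    · rw [← integral_indicator measurableSet_Ioc]
      congr 1; ext s
      simp only [hK, Set.indicator]
      split_ifs <;> simp

/-- `Q` is a quadrature on `α` with at most `N` nodes. -/
def IsQuadrature {α : Type*} (N : ℕ) (Q : (α → ℝ) → ℝ) : Prop :=
  ∃ (ι : Type) (_ : Fintype ι) (c : ι → ℝ) (x : ι → α), Fintype.card ι ≤ N ∧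
    ∀ f, Q f = ∑ i, c i * f (x i)

theorem exists_univariate_rules {lam a : ℝ} (hlam : 1 < lam) (ha : 0 < a) (b : ℝ) {r : ℕ}
    (hr : 1 ≤ r) : ∃ C : ℝ, 0 < C ∧ ∃ Q : ℕ → (ℝ → ℝ) → ℝ, ∀ k : ℕ,
      IsQuadrature (2 * r * 2 ^ k) (Q k) ∧ ∀ R, ((2 : ℝ) ^ k) ^ (1 / lam) ≤ R →
        KernelBound (freudWeight lam a b) r R (C * ((2 : ℝ) ^ k) ^ (-((1 - 1 / lam) * r)))
          (fun f => (∫ t in Set.Icc (-R) R, f t * freudWeight lam a b t) - Q k f) := by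
  obtain ⟨C, hC, hrule⟩ := exists_halfline_rule hlam ha b hr
  have hw := continuous_freudWeight (by linarith : 0 < lam) a b
  have hlam0 : 0 < lam := by linarith
  have main : ∀ k : ℕ, ∃ Q : (ℝ → ℝ) → ℝ,
      IsQuadrature (2 * r * 2 ^ k) Q ∧ ∀ R, ((2 : ℝ) ^ k) ^ (1 / lam) ≤ R →
        KernelBound (freudWeight lam a b) r R (2 * C * ((2 : ℝ) ^ k) ^ (-((1 - 1 / lam) * r)))
          (fun f => (∫ t in Set.Icc (-R) R, f t * freudWeight lam a b t) - Q f) := by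
    intro k
    set n : ℝ := (2 : ℝ) ^ k with hn
    have hn1 : 1 ≤ n := one_le_pow₀ (by norm_num)
    have hn0 : 0 < n := by linarith
    -- With `n` cells on `[0, T]` this is the choice satisfying `T^(lam-1) * (T/n) = 1`, and then
    -- `(T/n)^r = n^(-(1 - 1/lam) * r)`.
    set T : ℝ := n ^ (1 / lam) with hT
    have hT1 : 1 ≤ T := Real.one_le_rpow hn1 (by positivity)
    have hT0 : 0 < T := by linarith
    have hTl : T ^ lam = n := by
      rw [hT, ← Real.rpow_mul hn0.le]; field_simp; exact Real.rpow_one n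
    have hTh : T ^ (lam - 1) * (T / n) = 1 := by
      rw [← mul_div_assoc, ← Real.rpow_add_one hT0.ne', sub_add_cancel, hTl, div_self hn0.ne']
    obtain ⟨c, x, hcx⟩ := hrule (2 ^ k) (T / n) T (by positivity)
      (by push_cast; rw [← hn]; field_simp) hT1 hTh
    have hh : (T / n) ^ r = n ^ (-((1 - 1 / lam) * r)) := by
      have : T / n = n ^ (1 / lam - 1) := by rw [Real.rpow_sub_one hn0.ne']
      rw [this, ← Real.rpow_natCast, ← Real.rpow_mul hn0.le]
      congr 1; ring
    refine ⟨fun f => (∑ i, c i * f (x i)) + ∑ i, c i * f (-x i), ?_, fun R hR => ?_⟩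
    · refine ⟨(Fin (2 ^ k) × Fin r) ⊕ (Fin (2 ^ k) × Fin r), inferInstance, Sum.elim c c,
        Sum.elim x fun i => -x i, ?_, fun f => ?_⟩
      · simp only [Fintype.card_sum, Fintype.card_prod, Fintype.card_fin]
        apply le_of_eq; ring
      · rw [Fintype.sum_sum_type]; rfl
    · have hR0 : 0 ≤ R := by linarith
      have h1 := hcx R hR
      rw [hh] at h1
      have h2 := h1.add hw (h1.comp_neg (freudWeight_neg lam a b))
      rw [← two_mul, ← mul_assoc] at h2
      refine h2.congr fun f hf => ?_
      have hfc := hf.continuous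
      have e : ∫ t in Set.Icc (-R) R, f t * freudWeight lam a b t =
          (∫ t in (0 : ℝ)..R, f t * freudWeight lam a b t) +
            ∫ t in (0 : ℝ)..R, f (-t) * freudWeight lam a b t := by
        have hci : ∀ u v, IntervalIntegrable (fun t => f t * freudWeight lam a b t) volume u v :=
          fun u v => Continuous.intervalIntegrable (by fun_prop) u v
        have h3 : ∫ t in (0 : ℝ)..R, f (-t) * freudWeight lam a b t =
            ∫ t in (-R)..0, f t * freudWeight lam a b t := by
          have := intervalIntegral.integral_comp_neg (a := 0) (b := R)
            (fun t => f t * freudWeight lam a b t)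
          simpa only [freudWeight_neg, neg_zero] using this
        rw [h3, add_comm, intervalIntegral.integral_add_adjacent_intervals (hci _ _) (hci _ _),
          intervalIntegral.integral_of_le (by linarith), integral_Icc_eq_integral_Ioc]
      simp only [e]
      ring
  choose Q hQ using main
  exact ⟨2 * C, by positivity, Q, hQ⟩

end UnivariateRule

/-! ### Derivatives and integrals on slices with the last coordinate fixed. -/

section Slices

variable {d : ℕ}

theorem contDiff_partialDeriv (i : Fin d) {φ : (Fin d → ℝ) → ℝ} (hφ : ContDiff ℝ ∞ φ) :
    ContDiff ℝ ∞ (partialDeriv i φ) := by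
  unfold partialDeriv
  exact (hφ.fderiv_right (by simp)).clm_apply contDiff_const

theorem contDiff_partialDeriv_iterate (i : Fin d) (n : ℕ) {φ : (Fin d → ℝ) → ℝ}
    (hφ : ContDiff ℝ ∞ φ) : ContDiff ℝ ∞ ((partialDeriv i)^[n] φ) := by
  induction n with
  | zero => exact hφ
  | succ n ih => rw [Function.iterate_succ_apply']; exact contDiff_partialDeriv i ih

theorem contDiff_foldr_partialDeriv (l : List (Fin d)) (k : Fin d → ℕ) {φ : (Fin d → ℝ) → ℝ}
    (hφ : ContDiff ℝ ∞ φ) :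
    ContDiff ℝ ∞ (l.foldr (fun i ψ => (partialDeriv i)^[k i] ψ) φ) := by
  induction l with
  | nil => exact hφ
  | cons i l ih => exact contDiff_partialDeriv_iterate i _ ih

theorem contDiff_mixedDeriv (k : Fin d → ℕ) {φ : (Fin d → ℝ) → ℝ} (hφ : ContDiff ℝ ∞ φ) :
    ContDiff ℝ ∞ (mixedDeriv k φ) := contDiff_foldr_partialDeriv _ k hφ

theorem partialDeriv_eq_lineDeriv (i : Fin d) {φ : (Fin d → ℝ) → ℝ} (hφ : ContDiff ℝ ∞ φ)
    (x : Fin d → ℝ) : partialDeriv i φ x = lineDeriv ℝ φ x (Pi.single i 1) :=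
  ((hφ.differentiable (by simp)) x).lineDeriv_eq_fderiv.symm

theorem contDiff_snoc_left (t : ℝ) :
    ContDiff ℝ ∞ fun y : Fin d → ℝ => (Fin.snoc y t : Fin (d + 1) → ℝ) := by
  rw [contDiff_pi]
  intro i
  refine Fin.lastCases ?_ (fun j => ?_) i
  · simpa using contDiff_const
  · simpa using contDiff_apply ℝ ℝ j

theorem contDiff_snoc_right (y : Fin d → ℝ) :
    ContDiff ℝ ∞ fun t : ℝ => (Fin.snoc y t : Fin (d + 1) → ℝ) := by
  rw [contDiff_pi]
  intro i
  refine Fin.lastCases ?_ (fun j => ?_) i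
  · simpa using contDiff_fun_id
  · simpa using contDiff_const

theorem continuous_snoc :
    Continuous fun p : ℝ × (Fin d → ℝ) => (Fin.snoc p.2 p.1 : Fin (d + 1) → ℝ) := by
  rw [continuous_pi_iff]
  intro i
  refine Fin.lastCases ?_ (fun j => ?_) i
  · simpa using continuous_fst
  · simp only [Fin.snoc_castSucc]; fun_prop

theorem partialDeriv_castSucc_slice (i : Fin d) {φ : (Fin (d + 1) → ℝ) → ℝ}
    (hφ : ContDiff ℝ ∞ φ) (t : ℝ) :
    (fun y => partialDeriv i.castSucc φ (Fin.snoc y t)) =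
      partialDeriv i (fun y : Fin d → ℝ => φ (Fin.snoc y t)) := by
  ext y
  rw [partialDeriv_eq_lineDeriv _ hφ,
    partialDeriv_eq_lineDeriv (φ := fun y : Fin d → ℝ => φ (Fin.snoc y t)) _
      (hφ.comp (contDiff_snoc_left t))]
  simp only [lineDeriv]
  congr 1; ext s; congr 1; ext j
  refine Fin.lastCases ?_ (fun j => ?_) j
  · simp [Pi.single_apply, Fin.ext_iff]; intro h; exact absurd h (by omega)
  · simp [Pi.single_apply]

theorem partialDeriv_castSucc_iterate_slice (i : Fin d) (n : ℕ) {φ : (Fin (d + 1) → ℝ) → ℝ}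
    (hφ : ContDiff ℝ ∞ φ) (t : ℝ) :
    (fun y => (partialDeriv i.castSucc)^[n] φ (Fin.snoc y t)) =
      (partialDeriv i)^[n] (fun y : Fin d → ℝ => φ (Fin.snoc y t)) := by
  induction n with
  | zero => rfl
  | succ n ih =>
    rw [Function.iterate_succ_apply', Function.iterate_succ_apply', ← ih]
    exact partialDeriv_castSucc_slice i (contDiff_partialDeriv_iterate _ n hφ) t

theorem partialDeriv_last_slice {φ : (Fin (d + 1) → ℝ) → ℝ} (hφ : ContDiff ℝ ∞ φ)
    (y : Fin d → ℝ) : (fun t => partialDeriv (Fin.last d) φ (Fin.snoc y t)) =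
      deriv (fun t => φ (Fin.snoc y t)) := by
  ext t
  rw [partialDeriv_eq_lineDeriv _ hφ]
  simp only [lineDeriv]
  have h : (fun s : ℝ => φ (Fin.snoc y t + s • Pi.single (Fin.last d) 1)) =
      fun s => (fun t => φ (Fin.snoc y t)) (t + s) := by
    ext s; simp only; congr 1; ext j
    refine Fin.lastCases ?_ (fun j => ?_) j
    · simp
    · simp [Pi.single_apply, Fin.ext_iff]; intro h; exact absurd h (by omega)
  rw [h]
  have := deriv_comp_const_add (fun t => φ (Fin.snoc y t)) t 0
  rwa [add_zero] at this

theorem partialDeriv_last_iterate_slice (n : ℕ) {φ : (Fin (d + 1) → ℝ) → ℝ}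
    (hφ : ContDiff ℝ ∞ φ) (y : Fin d → ℝ) :
    (fun t => (partialDeriv (Fin.last d))^[n] φ (Fin.snoc y t)) =
      iteratedDeriv n (fun t => φ (Fin.snoc y t)) := by
  induction n with
  | zero => simp
  | succ n ih =>
    rw [iteratedDeriv_succ, ← ih, Function.iterate_succ_apply']
    exact partialDeriv_last_slice (contDiff_partialDeriv_iterate _ n hφ) y

/-- The fold in `mixedDeriv` applies the last partial derivative first, so the last variable splits
off without commuting partial derivatives. -/
theorem mixedDeriv_snoc (k : Fin d → ℕ) (n : ℕ) {φ : (Fin (d + 1) → ℝ) → ℝ}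
    (hφ : ContDiff ℝ ∞ φ) (y : Fin d → ℝ) (t : ℝ) :
    mixedDeriv (Fin.snoc k n : Fin (d + 1) → ℕ) φ (Fin.snoc y t) =
      mixedDeriv k (fun y : Fin d → ℝ => (partialDeriv (Fin.last d))^[n] φ (Fin.snoc y t)) y := by
  have key : ∀ (l : List (Fin d)) (ψ : (Fin (d + 1) → ℝ) → ℝ), ContDiff ℝ ∞ ψ →
      (fun y : Fin d → ℝ => (l.map Fin.castSucc).foldr
        (fun i ψ => (partialDeriv i)^[(Fin.snoc k n : Fin (d + 1) → ℕ) i] ψ) ψ (Fin.snoc y t)) =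
      l.foldr (fun i ψ => (partialDeriv i)^[k i] ψ) (fun y : Fin d → ℝ => ψ (Fin.snoc y t)) := by
    intro l ψ hψ
    induction l with
    | nil => rfl
    | cons i l ih =>
      simp only [List.map_cons, List.foldr_cons]
      rw [← ih, Fin.snoc_castSucc]
      exact partialDeriv_castSucc_iterate_slice i _ (contDiff_foldr_partialDeriv _ _ hψ) t
  unfold mixedDeriv
  rw [List.finRange_succ_last, List.foldr_append]
  simp only [List.foldr_cons, List.foldr_nil, Fin.snoc_last]
  exact congrFun (key _ _ (contDiff_partialDeriv_iterate _ _ hφ)) y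

/-- The cube `[-R, R] ^ d`. -/
def box (d : ℕ) (R : ℝ) : Set (Fin d → ℝ) := Set.Icc (fun _ => -R) fun _ => R

theorem isCompact_box (d : ℕ) (R : ℝ) : IsCompact (box d R) := isCompact_Icc

theorem measurableSet_box (d : ℕ) (R : ℝ) : MeasurableSet (box d R) := measurableSet_Icc

theorem snoc_mem_box {R t : ℝ} {y : Fin d → ℝ} :
    (Fin.snoc y t : Fin (d + 1) → ℝ) ∈ box (d + 1) R ↔ t ∈ Set.Icc (-R) R ∧ y ∈ box d R := by
  simp only [box, Set.mem_Icc, Pi.le_def]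
  constructor
  · rintro ⟨h1, h2⟩
    refine ⟨⟨by simpa using h1 (Fin.last d), by simpa using h2 (Fin.last d)⟩,
      fun i => by simpa using h1 i.castSucc, fun i => by simpa using h2 i.castSucc⟩
  · rintro ⟨⟨h1, h2⟩, h3, h4⟩
    refine ⟨fun i => ?_, fun i => ?_⟩
    · refine Fin.lastCases ?_ (fun j => ?_) i
      · simpa using h1
      · simpa using h3 j
    · refine Fin.lastCases ?_ (fun j => ?_) i
      · simpa using h2
      · simpa using h4 j

theorem setIntegral_box_succ (R : ℝ) {g : (Fin (d + 1) → ℝ) → ℝ} (hg : Continuous g) :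
    ∫ x in box (d + 1) R, g x = ∫ t in Set.Icc (-R) R, ∫ y in box d R, g (Fin.snoc y t) := by
  have hmp := (volume_preserving_piFinSuccAbove (fun _ : Fin (d + 1) => ℝ) (Fin.last d)).symm
  have h1 := hmp.setIntegral_preimage_emb (MeasurableEquiv.measurableEmbedding _) g (box (d + 1) R)
  rw [← h1]
  have he : ∀ p : ℝ × (Fin d → ℝ),
      (MeasurableEquiv.piFinSuccAbove (fun _ : Fin (d + 1) => ℝ) (Fin.last d)).symm p =
        (Fin.snoc p.2 p.1 : Fin (d + 1) → ℝ) := fun p => by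
    rw [← Fin.insertNth_last']; rfl
  have hpre : (MeasurableEquiv.piFinSuccAbove (fun _ : Fin (d + 1) => ℝ) (Fin.last d)).symm ⁻¹'
      (box (d + 1) R) = Set.Icc (-R) R ×ˢ box d R := by
    ext p
    rw [Set.mem_preimage, he, snoc_mem_box, Set.mem_prod]
  rw [hpre]
  simp only [he]
  rw [Measure.volume_eq_prod]
  exact setIntegral_prod (fun p : ℝ × (Fin d → ℝ) => g (Fin.snoc p.2 p.1))
    ((hg.comp continuous_snoc).continuousOn.integrableOn_compact
      (isCompact_Icc.prod (isCompact_box d R)))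

theorem sum_piFinset_snoc (r : ℕ) (A : (Fin (d + 1) → ℕ) → ℝ) :
    ∑ k ∈ Fintype.piFinset (fun _ : Fin (d + 1) => Finset.range (r + 1)), A k =
      ∑ n ∈ Finset.range (r + 1),
        ∑ k ∈ Fintype.piFinset (fun _ : Fin d => Finset.range (r + 1)),
          A (Fin.snoc k n : Fin (d + 1) → ℕ) := by
  rw [← Finset.sum_product']
  symm
  refine Finset.sum_nbij' (fun p => (Fin.snoc p.2 p.1 : Fin (d + 1) → ℕ))
    (fun k => (k (Fin.last d), fun i => k i.castSucc)) ?_ ?_ ?_ ?_ ?_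
  · intro p hp
    simp only [Finset.mem_product, Fintype.mem_piFinset] at hp ⊢
    intro i
    refine Fin.lastCases ?_ (fun j => ?_) i
    · simpa using hp.1
    · simpa using hp.2 j
  · intro k hk
    simp only [Finset.mem_product, Fintype.mem_piFinset] at hk ⊢
    exact ⟨hk _, fun i => hk _⟩
  · intro p _
    simp
  · intro k _
    ext i
    refine Fin.lastCases ?_ (fun j => ?_) i <;> simp
  · intro p _; rfl

end Slices

/-! ### Sums, differences and tensor products of quadratures, with node counts. -/

section Quadratures

variable {α : Type*} {N N' : ℕ} {Q Q' : (α → ℝ) → ℝ}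

theorem IsQuadrature.mono (h : IsQuadrature N Q) (hN : N ≤ N') : IsQuadrature N' Q := by
  obtain ⟨ι, hι, c, x, hc, hQ⟩ := h
  exact ⟨ι, hι, c, x, hc.trans hN, hQ⟩

theorem IsQuadrature.zero : IsQuadrature 0 (fun _ : α → ℝ => 0) :=
  ⟨Empty, inferInstance, Empty.elim, Empty.elim, by simp, by simp⟩

theorem IsQuadrature.eval (x : α) : IsQuadrature 1 (fun f : α → ℝ => f x) :=
  ⟨Unit, inferInstance, fun _ => 1, fun _ => x, by simp, by simp⟩

theorem IsQuadrature.add (h : IsQuadrature N Q) (h' : IsQuadrature N' Q') :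
    IsQuadrature (N + N') (fun f => Q f + Q' f) := by
  obtain ⟨ι, hι, c, x, hc, hQ⟩ := h
  obtain ⟨ι', hι', c', x', hc', hQ'⟩ := h'
  refine ⟨ι ⊕ ι', inferInstance, Sum.elim c c', Sum.elim x x', ?_, fun f => ?_⟩
  · rw [Fintype.card_sum]; omega
  · simp [hQ, hQ']

theorem IsQuadrature.sub (h : IsQuadrature N Q) (h' : IsQuadrature N' Q') :
    IsQuadrature (N + N') (fun f => Q f - Q' f) := by
  obtain ⟨ι, hι, c, x, hc, hQ⟩ := h
  obtain ⟨ι', hι', c', x', hc', hQ'⟩ := h'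
  refine ⟨ι ⊕ ι', inferInstance, Sum.elim c fun i => -c' i, Sum.elim x x', ?_, fun f => ?_⟩
  · rw [Fintype.card_sum]; omega
  · simp [hQ, hQ', sub_eq_add_neg]

theorem IsQuadrature.sum {κ : Type*} (s : Finset κ) {N : κ → ℕ} {Q : κ → (α → ℝ) → ℝ}
    (h : ∀ i ∈ s, IsQuadrature (N i) (Q i)) :
    IsQuadrature (∑ i ∈ s, N i) (fun f => ∑ i ∈ s, Q i f) := by
  classical
  induction s using Finset.induction_on with
  | empty => simpa using IsQuadrature.zero
  | insert i s hi ih =>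
    simp only [Finset.sum_insert hi]
    exact (h i (by simp)).add (ih fun j hj => h j (by simp [hj]))

theorem IsQuadrature.tensor {d : ℕ} {M : ((Fin d → ℝ) → ℝ) → ℝ} {L : (ℝ → ℝ) → ℝ}
    (hM : IsQuadrature N M) (hL : IsQuadrature N' L) :
    IsQuadrature (N * N') (fun F : (Fin (d + 1) → ℝ) → ℝ =>
      M fun y => L fun t => F (Fin.snoc y t)) := by
  obtain ⟨ι, hι, c, x, hc, hQ⟩ := hM
  obtain ⟨ι', hι', c', x', hc', hQ'⟩ := hL
  refine ⟨ι × ι', inferInstance, fun p => c p.1 * c' p.2, fun p => Fin.snoc (x p.1) (x' p.2), ?_,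
    fun f => ?_⟩
  · rw [Fintype.card_prod]; exact Nat.mul_le_mul hc hc'
  · simp only [hQ, hQ', Fintype.sum_prod_type, Finset.mul_sum, mul_assoc]

theorem IsQuadrature.continuous_slice {d : ℕ} {L : (ℝ → ℝ) → ℝ} (hL : IsQuadrature N L)
    {F : (Fin (d + 1) → ℝ) → ℝ} (hF : Continuous F) :
    Continuous fun y : Fin d → ℝ => L fun t => F (Fin.snoc y t) := by
  obtain ⟨ι, hι, c, x, hc, hQ⟩ := hL
  simp only [hQ]
  exact continuous_finsetSum _ fun i _ =>
    continuous_const.mul (hF.comp (contDiff_snoc_left (x i)).continuous)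

theorem IsQuadrature.exists_fin {d : ℕ} {Q : ((Fin d → ℝ) → ℝ) → ℝ} (h : IsQuadrature N Q) :
    ∃ (m : ℕ) (_ : m ≤ N) (ξ : Fin m → Fin d → ℝ) (c : Fin m → ℝ),
      ∀ f, Q f = quadrature ξ c f := by
  obtain ⟨ι, hι, c, x, hc, hQ⟩ := h
  let e := (Fintype.equivFin ι).symm
  refine ⟨Fintype.card ι, hc, fun i => x (e i), fun i => c (e i), fun f => ?_⟩
  rw [hQ, quadrature]
  exact (e.sum_comp fun i => c i * f (x i)).symm

end Quadratures

/-! ### Tensor products of error functionals on cubes. -/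

section Tensor

variable {d : ℕ} {w : ℝ → ℝ} {R : ℝ}

/-- The weighted integral over the cube `[-R, R] ^ d`. -/
noncomputable def boxIntegral (w : ℝ → ℝ) (R : ℝ) (d : ℕ) (F : (Fin d → ℝ) → ℝ) : ℝ :=
  ∫ x in box d R, F x * ∏ i, w (x i)

/-- The weighted Sobolev norm of mixed smoothness `r` over the cube `[-R, R] ^ d`. -/
noncomputable def boxNorm (w : ℝ → ℝ) (r : ℕ) (R : ℝ) (d : ℕ) (F : (Fin d → ℝ) → ℝ) : ℝ :=
  ∑ k ∈ Fintype.piFinset (fun _ : Fin d => Finset.range (r + 1)),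
    ∫ x in box d R, |mixedDeriv k F x| * ∏ i, w (x i)

theorem continuous_prod_weight (hw : Continuous w) (d : ℕ) :
    Continuous fun x : Fin d → ℝ => ∏ i, w (x i) := by fun_prop

theorem prod_weight_nonneg (hw0 : ∀ s, 0 ≤ w s) (x : Fin d → ℝ) : 0 ≤ ∏ i, w (x i) :=
  Finset.prod_nonneg fun i _ => hw0 (x i)

theorem integrable_slices {G : ℝ → (Fin d → ℝ) → ℝ} (hG : Continuous (Function.uncurry G))
    {h : ℝ → ℝ} (hh : Measurable h) {B : ℝ} (hB : ∀ s ∈ Set.Icc (-R) R, |h s| ≤ B) :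
    Integrable (Function.uncurry fun t y => G t y * h t)
      ((volume.restrict (Set.Icc (-R) R)).prod (volume.restrict (box d R))) := by
  have h1 : IntegrableOn (Function.uncurry G) (Set.Icc (-R) R ×ˢ box d R)
      ((volume : Measure ℝ).prod (volume : Measure (Fin d → ℝ))) :=
    hG.continuousOn.integrableOn_compact (isCompact_Icc.prod (isCompact_box d R))
  rw [IntegrableOn, ← Measure.prod_restrict] at h1
  have h2 : (Function.uncurry fun t y => G t y * h t) =
      fun p : ℝ × (Fin d → ℝ) => h p.1 * Function.uncurry G p := by
    ext p; simp only [Function.uncurry]; ring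
  rw [h2]
  refine h1.bdd_mul (c := B) (hh.comp measurable_fst).aestronglyMeasurable ?_
  rw [Measure.prod_restrict]
  filter_upwards [ae_restrict_mem (measurableSet_Icc.prod (measurableSet_box d R))] with p hp
  exact hB _ hp.1

/-- By Fubini the norm is an iterated one: an `L¹` norm in `t` of `d`-dimensional norms of the
slices. This identity is what makes functional bounds multiply. -/
theorem boxNorm_succ (hw : Continuous w) (r : ℕ) {F : (Fin (d + 1) → ℝ) → ℝ}
    (hF : ContDiff ℝ ∞ F) :
    boxNorm w r R (d + 1) F = ∑ n ∈ Finset.range (r + 1), ∫ t in Set.Icc (-R) R,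
      boxNorm w r R d (fun y => (partialDeriv (Fin.last d))^[n] F (Fin.snoc y t)) * w t ∧
    ∀ n, IntegrableOn (fun t => boxNorm w r R d
      (fun y => (partialDeriv (Fin.last d))^[n] F (Fin.snoc y t)) * w t) (Set.Icc (-R) R) := by
  have hW := continuous_prod_weight hw d
  have hcont : ∀ (k : Fin d → ℕ) (n : ℕ), Continuous (fun x => |mixedDeriv (Fin.snoc k n) F x| *
      ∏ i, w (x i)) := fun k n =>
    ((contDiff_mixedDeriv _ hF).continuous.abs).mul (continuous_prod_weight hw (d + 1))
  have hint : ∀ (k : Fin d → ℕ) (n : ℕ), IntegrableOn (fun t => (∫ y in box d R,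
      |mixedDeriv k (fun y => (partialDeriv (Fin.last d))^[n] F (Fin.snoc y t)) y| *
        ∏ i, w (y i)) * w t) (Set.Icc (-R) R) := by
    intro k n
    have h1 : Continuous (Function.uncurry fun (t : ℝ) (y : Fin d → ℝ) =>
        |mixedDeriv (Fin.snoc k n) F (Fin.snoc y t)| * ∏ i, w (y i)) :=
      ((contDiff_mixedDeriv _ hF).continuous.comp continuous_snoc).abs.mul
        (hW.comp continuous_snd)
    obtain ⟨B, hB⟩ := isCompact_Icc (a := -R) (b := R) |>.exists_bound_of_continuousOn
      hw.continuousOn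
    have := (integrable_slices h1 hw.measurable hB).integral_prod_left
    simp only [Function.uncurry, integral_mul_const] at this
    simp only [mixedDeriv_snoc _ _ hF] at this
    exact this
  constructor
  · rw [boxNorm, sum_piFinset_snoc]
    refine Finset.sum_congr rfl fun n _ => ?_
    simp only [boxNorm, Finset.sum_mul]
    rw [integral_finsetSum _ fun k _ => hint k n]
    refine Finset.sum_congr rfl fun k _ => ?_
    rw [setIntegral_box_succ R (hcont k n)]
    congr 1; ext t
    rw [← integral_mul_const]
    congr 1; ext y
    rw [Fin.prod_univ_castSucc, mixedDeriv_snoc _ _ hF]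
    simp only [Fin.snoc_castSucc, Fin.snoc_last]
    ring
  · intro n
    simp only [boxNorm, Finset.sum_mul]
    exact integrable_finsetSum _ fun k _ => hint k n

theorem boxNorm_nonneg (hw0 : ∀ s, 0 ≤ w s) (r : ℕ) (F : (Fin d → ℝ) → ℝ) :
    0 ≤ boxNorm w r R d F :=
  Finset.sum_nonneg fun _ _ => integral_nonneg fun x =>
    mul_nonneg (abs_nonneg _) (prod_weight_nonneg hw0 x)

theorem mixedDeriv_zero (F : (Fin d → ℝ) → ℝ) : mixedDeriv 0 F = F := by
  simp [mixedDeriv]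

theorem abs_boxIntegral_le (hw0 : ∀ s, 0 ≤ w s) (r : ℕ) (F : (Fin d → ℝ) → ℝ) :
    |boxIntegral w R d F| ≤ boxNorm w r R d F := by
  have h1 : |boxIntegral w R d F| ≤ ∫ x in box d R, |mixedDeriv 0 F x| * ∏ i, w (x i) := by
    rw [mixedDeriv_zero]
    refine (abs_integral_le_integral_abs).trans (le_of_eq ?_)
    congr 1; ext x
    rw [abs_mul, abs_of_nonneg (prod_weight_nonneg hw0 x)]
  refine h1.trans ?_
  exact Finset.single_le_sum (f := fun k => ∫ x in box d R, |mixedDeriv k F x| * ∏ i, w (x i))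
    (fun _ _ => integral_nonneg fun x => mul_nonneg (abs_nonneg _) (prod_weight_nonneg hw0 x))
    (by simp)

/-- The norm of a tensor product of functionals is at most the product of the norms. -/
theorem abs_tensor_le (hw : Continuous w) (hw0 : ∀ s, 0 ≤ w s) {r N : ℕ} {ε ε' : ℝ}
    {Q : ((Fin d → ℝ) → ℝ) → ℝ} (hQ : IsQuadrature N Q)
    (hM : ∀ G, ContDiff ℝ ∞ G → |boxIntegral w R d G - Q G| ≤ ε' * boxNorm w r R d G)
    (hε' : 0 ≤ ε') {L : (ℝ → ℝ) → ℝ} (hL : KernelBound w r R ε L)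
    {F : (Fin (d + 1) → ℝ) → ℝ} (hF : ContDiff ℝ ∞ F) :
    |boxIntegral w R d (fun y => L fun t => F (Fin.snoc y t)) -
        Q (fun y => L fun t => F (Fin.snoc y t))| ≤ ε * ε' * boxNorm w r R (d + 1) F := by
  obtain ⟨h, hm, hb, hs, hrep⟩ := hL
  obtain ⟨ι, hι, c, x, -, hQ⟩ := hQ
  set D : ℕ → ℝ → (Fin d → ℝ) → ℝ :=
    fun n t y => (partialDeriv (Fin.last d))^[n] F (Fin.snoc y t) with hD
  have hDs : ∀ n, ContDiff ℝ ∞ ((partialDeriv (Fin.last d))^[n] F) := fun n =>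
    contDiff_partialDeriv_iterate _ n hF
  have hDt : ∀ n t, ContDiff ℝ ∞ (D n t) := fun n t => (hDs n).comp (contDiff_snoc_left t)
  have hDc : ∀ n, Continuous (Function.uncurry (D n)) := fun n =>
    (hDs n).continuous.comp continuous_snoc
  have hbB : ∀ n, ∃ B, ∀ s ∈ Set.Icc (-R) R, |h n s| ≤ B := fun n => by
    obtain ⟨B, hB⟩ := isCompact_Icc (a := -R) (b := R) |>.exists_bound_of_continuousOn
      (f := fun s => ε * w s) (by fun_prop)
    exact ⟨B, fun s hs => (hb n s).trans ((le_abs_self _).trans (hB s hs))⟩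
  choose B hB using hbB
  have hLy : ∀ y, (L fun t => F (Fin.snoc y t)) =
      ∑ n ∈ Finset.range (r + 1), ∫ t in Set.Icc (-R) R, D n t y * h n t := by
    intro y
    rw [hrep (fun t => F (Fin.snoc y t)) (hF.comp (contDiff_snoc_right y))]
    refine Finset.sum_congr rfl fun n _ => ?_
    rw [← partialDeriv_last_iterate_slice n hF y,
      setIntegral_eq_integral_of_forall_compl_eq_zero]
    intro t ht
    rw [hs n t ht, mul_zero]
  have hint : ∀ n, Integrable (Function.uncurry fun t y => D n t y * (∏ i, w (y i)) * h n t)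
      ((volume.restrict (Set.Icc (-R) R)).prod (volume.restrict (box d R))) := fun n =>
    integrable_slices (G := fun t y => D n t y * ∏ i, w (y i))
      ((hDc n).mul ((continuous_prod_weight hw d).comp continuous_snd)) (hm n) (hB n)
  have hint1 : ∀ n y, IntegrableOn (fun t => D n t y * h n t) (Set.Icc (-R) R) := by
    intro n y
    have hc : Continuous fun t => D n t y :=
      (hDs n).continuous.comp (contDiff_snoc_right y).continuous
    exact (integrable_mul_of_bound_of_support hw hc (hm n) (hb n) (hs n)).integrableOn
  -- The box integral (by Fubini) and `Q` (by linearity) both pass under the `t`-integral against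
  -- the kernels of `L`, so the `d`-dimensional error acts on the slices `D n t`.
  have hI : boxIntegral w R d (fun y => L fun t => F (Fin.snoc y t)) =
      ∑ n ∈ Finset.range (r + 1), ∫ t in Set.Icc (-R) R, boxIntegral w R d (D n t) * h n t := by
    have hil : ∀ n, Integrable (fun y => ∫ t in Set.Icc (-R) R,
        D n t y * (∏ i, w (y i)) * h n t) (volume.restrict (box d R)) := fun n =>
      (hint n).integral_prod_right
    have e1 : ∀ y, (L fun t => F (Fin.snoc y t)) * ∏ i, w (y i) =
        ∑ n ∈ Finset.range (r + 1), ∫ t in Set.Icc (-R) R, D n t y * (∏ i, w (y i)) * h n t := by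
      intro y
      rw [hLy, Finset.sum_mul]
      refine Finset.sum_congr rfl fun n _ => ?_
      rw [← integral_mul_const]
      congr 1; ext t; ring
    simp only [boxIntegral, e1]
    rw [integral_finsetSum _ fun n _ => hil n]
    refine Finset.sum_congr rfl fun n _ => ?_
    rw [← integral_integral_swap (hint n)]
    simp only [integral_mul_const]
  have hQI : Q (fun y => L fun t => F (Fin.snoc y t)) =
      ∑ n ∈ Finset.range (r + 1), ∫ t in Set.Icc (-R) R, Q (D n t) * h n t := by
    simp only [hQ, hLy, Finset.mul_sum]
    rw [Finset.sum_comm]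
    refine Finset.sum_congr rfl fun n _ => ?_
    simp only [Finset.sum_mul]
    rw [integral_finsetSum _ fun i _ => by
      simpa only [mul_assoc] using (hint1 n (x i)).const_mul (c i)]
    refine Finset.sum_congr rfl fun i _ => ?_
    rw [← integral_const_mul]
    congr 1; ext t; ring
  have hiI : ∀ n, IntegrableOn (fun t => boxIntegral w R d (D n t) * h n t)
      (Set.Icc (-R) R) := by
    intro n
    have := (hint n).integral_prod_left
    simp only [Function.uncurry, integral_mul_const] at this
    exact this
  have hiQ : ∀ n, IntegrableOn (fun t => Q (D n t) * h n t) (Set.Icc (-R) R) := by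
    intro n
    simp only [hQ, Finset.sum_mul, mul_assoc]
    exact integrable_finsetSum _ fun i _ => (hint1 n (x i)).const_mul (c i)
  obtain ⟨hN, hNi⟩ := boxNorm_succ (R := R) hw r hF
  rw [hI, hQI, ← Finset.sum_sub_distrib, hN, Finset.mul_sum]
  refine (Finset.abs_sum_le_sum_abs _ _).trans (Finset.sum_le_sum fun n _ => ?_)
  rw [← integral_sub (hiI n) (hiQ n), ← integral_const_mul]
  rw [← Real.norm_eq_abs]
  refine norm_integral_le_of_norm_le ((hNi n).const_mul _)
    (Filter.Eventually.of_forall fun t => ?_)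
  rw [← sub_mul, norm_mul]
  -- Pointwise in `t`, the slice error is multiplied by the kernel bound; integration over `t` and
  -- summation over `n` rebuild the `(d+1)`-dimensional norm.
  calc _ ≤ (ε' * boxNorm w r R d (D n t)) * (ε * w t) :=
        mul_le_mul (hM _ (hDt n t)) (hb n t) (abs_nonneg _)
          (mul_nonneg hε' (boxNorm_nonneg hw0 r _))
    _ = _ := by ring

end Tensor

/-! ### Smolyak's construction: number of nodes and error. -/

section Smolyak

/-- The differences of consecutive univariate rules. -/
def ruleDiff (Q : ℕ → (ℝ → ℝ) → ℝ) : ℕ → (ℝ → ℝ) → ℝ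
  | 0 => Q 0
  | k + 1 => fun f => Q (k + 1) f - Q k f

/-- The Smolyak quadrature of level `m` built from the univariate rules `Q`. -/
def smolyak (Q : ℕ → (ℝ → ℝ) → ℝ) : (d : ℕ) → ℕ → ((Fin d → ℝ) → ℝ) → ℝ
  | 0, _ => fun F => F default
  | d + 1, m => fun F => ∑ k ∈ Finset.range (m + 1),
      smolyak Q d (m - k) fun y => ruleDiff Q k fun t => F (Fin.snoc y t)

variable {Q : ℕ → (ℝ → ℝ) → ℝ} {N : ℕ}

theorem sum_ruleDiff (Q : ℕ → (ℝ → ℝ) → ℝ) (m : ℕ) (f : ℝ → ℝ) :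
    ∑ k ∈ Finset.range (m + 1), ruleDiff Q k f = Q m f := by
  induction m with
  | zero => simp [ruleDiff]
  | succ m ih => rw [Finset.sum_range_succ, ih]; simp [ruleDiff]

theorem isQuadrature_ruleDiff (hQ : ∀ k, IsQuadrature (N * 2 ^ k) (Q k)) (k : ℕ) :
    IsQuadrature (2 * N * 2 ^ k) (ruleDiff Q k) := by
  cases k with
  | zero => exact (hQ 0).mono (by simp; omega)
  | succ k =>
    refine ((hQ (k + 1)).sub (hQ k)).mono ?_
    rw [pow_succ]; nlinarith [Nat.zero_le (N * 2 ^ k)]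

/-- In dimension one the geometric sum of node counts costs no logarithm. In each further dimension
every `k` contributes at most a multiple of `2^(m-k) * 2^k = 2^m` times the previous power, and the
`m + 1` values of `k` add one factor `m + 1`. -/
theorem isQuadrature_smolyak (hQ : ∀ k, IsQuadrature (N * 2 ^ k) (Q k)) (d m : ℕ) :
    IsQuadrature ((4 * N) ^ (d + 1) * (2 ^ m * (m + 1) ^ d)) (smolyak Q (d + 1) m) := by
  induction d generalizing m with
  | zero =>
    have h : IsQuadrature (∑ k ∈ Finset.range (m + 1), 1 * (2 * N * 2 ^ k)) (smolyak Q 1 m) :=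
      IsQuadrature.sum _ fun k _ => (IsQuadrature.eval default).tensor (isQuadrature_ruleDiff hQ k)
    refine h.mono ?_
    simp only [one_mul, zero_add, pow_one, pow_zero, mul_one]
    rw [← Finset.mul_sum, show 4 * N * 2 ^ m = 2 * N * 2 ^ (m + 1) by ring]
    exact Nat.mul_le_mul_left _ (Nat.geomSum_lt (le_refl 2) (by simp)).le
  | succ d ih =>
    have h : IsQuadrature (∑ k ∈ Finset.range (m + 1),
        ((4 * N) ^ (d + 1) * (2 ^ (m - k) * (m - k + 1) ^ d)) * (2 * N * 2 ^ k))
        (smolyak Q (d + 2) m) :=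
      IsQuadrature.sum _ fun k _ => (ih (m - k)).tensor (isQuadrature_ruleDiff hQ k)
    refine h.mono ?_
    calc _ ≤ ∑ k ∈ Finset.range (m + 1), (4 * N) ^ (d + 2) * (2 ^ m * (m + 1) ^ d) := by
          refine Finset.sum_le_sum fun k hk => ?_
          have hk' : k ≤ m := Nat.lt_succ_iff.1 (Finset.mem_range.1 hk)
          have e : 2 ^ m = 2 ^ (m - k) * 2 ^ k := by rw [← pow_add]; congr 1; omega
          have h1 : (m - k + 1) ^ d ≤ (m + 1) ^ d := Nat.pow_le_pow_left (by omega) d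
          calc _ = (4 * N) ^ (d + 1) * (2 * N) * (2 ^ m * (m - k + 1) ^ d) := by rw [e]; ring
            _ ≤ (4 * N) ^ (d + 1) * (4 * N) * (2 ^ m * (m + 1) ^ d) := by gcongr; norm_num
            _ = _ := by ring
      _ = _ := by
          rw [Finset.sum_const, Finset.card_range, smul_eq_mul]; ring

variable {w : ℝ → ℝ} {r : ℕ} {R C q : ℝ}

theorem kernelBound_integral (hw : Continuous w) (hw0 : ∀ s, 0 ≤ w s) (r : ℕ) (R : ℝ) :
    KernelBound w r R 1 (fun f => ∫ t in Set.Icc (-R) R, f t * w t) := by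
  refine (KernelBound.of_single (K := (Set.Icc (-R) R).indicator w) (q := 0) (ε := 1)
    (hw.measurable.indicator measurableSet_Icc) (fun s => ?_)
    (fun s hs => Set.indicator_of_notMem hs _) zero_le_one hw0 (Nat.zero_le r)).congr fun f _ => ?_
  · rw [one_mul]
    by_cases hs : s ∈ Set.Icc (-R) R
    · rw [Set.indicator_of_mem hs, abs_of_nonneg (hw0 s)]
    · rw [Set.indicator_of_notMem hs, abs_zero]; exact hw0 s
  · rw [← integral_indicator measurableSet_Icc]
    congr 1; ext s
    simp only [Set.indicator, iteratedDeriv_zero]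
    split_ifs <;> simp

/-- A difference of rules is a difference of their errors. The term `C / q` accounts for the coarser
of the two levels, and the term `1` for the full integral at level `0`, which has no predecessor. -/
theorem kernelBound_ruleDiff (hw : Continuous w) (hw0 : ∀ s, 0 ≤ w s) (hC : 0 < C) (hq : 0 < q)
    {m : ℕ} (hQ : ∀ k ≤ m, KernelBound w r R (C * q ^ k)
      (fun f => (∫ t in Set.Icc (-R) R, f t * w t) - Q k f)) {k : ℕ} (hk : k ≤ m) :
    KernelBound w r R ((1 + C + C / q) * q ^ k) (ruleDiff Q k) := by
  cases k with
  | zero =>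
    refine (((kernelBound_integral hw hw0 r R).sub hw (hQ 0 hk)).mono hw0 ?_).congr
      fun f _ => by simp [ruleDiff]
    have : 0 < C / q := by positivity
    simp; linarith
  | succ k =>
    refine (((hQ k (by omega)).sub hw (hQ (k + 1) hk)).mono hw0 ?_).congr
      fun f _ => by simp [ruleDiff]
    have h1 : 0 < q ^ (k + 1) := by positivity
    have h2 : C / q * q ^ (k + 1) = C * q ^ k := by rw [pow_succ]; field_simp
    rw [add_mul, add_mul, h2]; linarith

theorem boxIntegral_succ (hw : Continuous w) {d : ℕ} {F : (Fin (d + 1) → ℝ) → ℝ}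
    (hF : Continuous F) :
    boxIntegral w R (d + 1) F =
      boxIntegral w R d (fun y => ∫ t in Set.Icc (-R) R, F (Fin.snoc y t) * w t) ∧
    IntegrableOn (fun y => (∫ t in Set.Icc (-R) R, F (Fin.snoc y t) * w t) * ∏ i, w (y i))
      (box d R) := by
  obtain ⟨B, hB⟩ := isCompact_Icc (a := -R) (b := R) |>.exists_bound_of_continuousOn
      hw.continuousOn
  have hint := integrable_slices (R := R) (G := fun t (y : Fin d → ℝ) =>
    F (Fin.snoc y t) * ∏ i, w (y i)) ((hF.comp continuous_snoc).mul
      ((continuous_prod_weight hw d).comp continuous_snd)) hw.measurable hB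
  have e : ∀ y : Fin d → ℝ, (∫ t in Set.Icc (-R) R, F (Fin.snoc y t) * w t) * ∏ i, w (y i) =
      ∫ t in Set.Icc (-R) R, F (Fin.snoc y t) * (∏ i, w (y i)) * w t := fun y => by
    rw [← integral_mul_const]
    congr 1; ext t; ring
  constructor
  · simp only [boxIntegral, e]
    rw [← integral_integral_swap hint,
      setIntegral_box_succ R (g := fun x => F x * ∏ i, w (x i))
        (hF.mul (continuous_prod_weight hw (d + 1)))]
    congr 1; ext t; congr 1; ext y
    rw [Fin.prod_univ_castSucc]
    simp only [Fin.snoc_castSucc, Fin.snoc_last]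
    ring
  · simp only [e]
    exact hint.integral_prod_right

/-- Telescoping: with `I` the integral, `S` the Smolyak rule and `Δ_k` the differences, `∑_{k ≤ m}
Δ_k = Q m` turns `I ⊗ I - ∑ S_{m-k} ⊗ Δ_k` into `∑ (I - S_{m-k}) ⊗ Δ_k + I ⊗ (I - Q m)`. -/
theorem boxIntegral_sub_smolyak_succ (hw : Continuous w)
    (hQ : ∀ k, IsQuadrature (N * 2 ^ k) (Q k)) (d m : ℕ) {F : (Fin (d + 1) → ℝ) → ℝ}
    (hF : Continuous F) :
    boxIntegral w R (d + 1) F - smolyak Q (d + 1) m F =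
      (∑ k ∈ Finset.range (m + 1),
        (boxIntegral w R d (fun y => ruleDiff Q k fun t => F (Fin.snoc y t)) -
          smolyak Q d (m - k) fun y => ruleDiff Q k fun t => F (Fin.snoc y t))) +
      boxIntegral w R d (fun y => (∫ t in Set.Icc (-R) R, F (Fin.snoc y t) * w t) -
        Q m fun t => F (Fin.snoc y t)) := by
  obtain ⟨h1, h2⟩ := boxIntegral_succ (R := R) hw hF
  have hW := continuous_prod_weight hw d
  have hc : ∀ g : (Fin d → ℝ) → ℝ, Continuous g →
      IntegrableOn (fun y => g y * ∏ i, w (y i)) (box d R) := fun g hg =>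
    (hg.mul hW).continuousOn.integrableOn_compact (isCompact_box d R)
  have h3 : ∑ k ∈ Finset.range (m + 1),
      boxIntegral w R d (fun y => ruleDiff Q k fun t => F (Fin.snoc y t)) =
      boxIntegral w R d (fun y => Q m fun t => F (Fin.snoc y t)) := by
    simp only [boxIntegral]
    rw [← integral_finsetSum _ fun k _ =>
      hc _ ((isQuadrature_ruleDiff hQ k).continuous_slice hF)]
    simp only [← Finset.sum_mul, sum_ruleDiff]
  have h4 : boxIntegral w R d (fun y => (∫ t in Set.Icc (-R) R, F (Fin.snoc y t) * w t) -
        Q m fun t => F (Fin.snoc y t)) = boxIntegral w R (d + 1) F -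
      boxIntegral w R d (fun y => Q m fun t => F (Fin.snoc y t)) := by
    rw [h1]
    simp only [boxIntegral, sub_mul]
    exact integral_sub h2 (hc _ ((hQ m).continuous_slice hF))
  rw [Finset.sum_sub_distrib, h3, h4]
  simp only [smolyak]
  ring

/-- In the telescoped error each term has size at most `q^(m-k) * q^k = q^m` times the previous
power of `m + 1`, so every added dimension costs one factor `m + 1`. -/
theorem abs_boxIntegral_sub_smolyak_le (hw : Continuous w) (hw0 : ∀ s, 0 ≤ w s)
    (hQ : ∀ k, IsQuadrature (N * 2 ^ k) (Q k)) (hC : 0 < C) (hq : 0 < q) (r d : ℕ) :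
    ∃ K : ℝ, 0 < K ∧ ∀ (m : ℕ) (R : ℝ), (∀ k ≤ m, KernelBound w r R (C * q ^ k)
        (fun f => (∫ t in Set.Icc (-R) R, f t * w t) - Q k f)) →
      ∀ F : (Fin (d + 1) → ℝ) → ℝ, ContDiff ℝ ∞ F →
        |boxIntegral w R (d + 1) F - smolyak Q (d + 1) m F| ≤
          K * (q ^ m * (m + 1) ^ d) * boxNorm w r R (d + 1) F := by
  have hlast : ∀ (d m : ℕ) (R : ℝ), (∀ k ≤ m, KernelBound w r R (C * q ^ k)
        (fun f => (∫ t in Set.Icc (-R) R, f t * w t) - Q k f)) →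
      ∀ F : (Fin (d + 1) → ℝ) → ℝ, ContDiff ℝ ∞ F →
        |boxIntegral w R d (fun y => (∫ t in Set.Icc (-R) R, F (Fin.snoc y t) * w t) -
          Q m fun t => F (Fin.snoc y t))| ≤ C * q ^ m * boxNorm w r R (d + 1) F := by
    intro d m R hK F hF
    -- With the zero quadrature in the first `d` variables, the tensor bound concerns the box
    -- integral itself, whose norm is at most `1`.
    have := abs_tensor_le hw hw0 (ε' := 1) (IsQuadrature.zero (α := Fin d → ℝ))
      (fun G _ => by rw [sub_zero, one_mul]; exact abs_boxIntegral_le hw0 r G) zero_le_one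
      (hK m le_rfl) hF
    rwa [sub_zero, mul_one] at this
  induction d with
  | zero =>
    refine ⟨C, hC, fun m R hK F hF => ?_⟩
    -- In dimension zero both the box integral and the Smolyak rule are evaluation at the only
    -- point, so only the univariate error remains.
    rw [boxIntegral_sub_smolyak_succ hw hQ 0 m hF.continuous, Finset.sum_eq_zero, zero_add]
    · simpa using hlast 0 m R hK F hF
    · intro k _
      have : box 0 R = Set.univ := Set.eq_univ_of_forall fun x => ⟨fun i => i.elim0, fun i => i.elim0⟩
      have hv : (volume : Measure (Fin 0 → ℝ)).real Set.univ = 1 := by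
        simp [Measure.real, volume_pi]
      simp only [boxIntegral, smolyak, this]
      rw [setIntegral_univ, integral_unique, hv]
      simp
      exact sub_eq_zero_of_eq rfl
  | succ d ih =>
    obtain ⟨K, hK0, ih⟩ := ih
    set C' := 1 + C + C / q with hC'
    have hC'0 : 0 < C' := by positivity
    refine ⟨C' * K + C, by positivity, fun m R hK F hF => ?_⟩
    rw [boxIntegral_sub_smolyak_succ hw hQ (d + 1) m hF.continuous]
    have hBN := boxNorm_nonneg (R := R) hw0 r F
    have hm1 : (1 : ℝ) ≤ (m : ℝ) + 1 := by linarith [(Nat.cast_nonneg m : (0 : ℝ) ≤ m)]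
    have hterm : ∀ k ∈ Finset.range (m + 1),
        |boxIntegral w R (d + 1) (fun y => ruleDiff Q k fun t => F (Fin.snoc y t)) -
          smolyak Q (d + 1) (m - k) fun y => ruleDiff Q k fun t => F (Fin.snoc y t)| ≤
        C' * K * (q ^ m * (m + 1) ^ d) * boxNorm w r R (d + 2) F := by
      intro k hk
      have hk' : k ≤ m := Nat.lt_succ_iff.1 (Finset.mem_range.1 hk)
      have h1 := abs_tensor_le hw hw0 (isQuadrature_smolyak hQ d (m - k))
        (ih (m - k) R fun j hj => hK j (by omega)) (by positivity)
        (kernelBound_ruleDiff hw hw0 hC hq hK hk') hF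
      refine h1.trans (mul_le_mul_of_nonneg_right ?_ hBN)
      have e : q ^ m = q ^ k * q ^ (m - k) := by rw [← pow_add]; congr 1; omega
      have h2 : ((m - k : ℕ) : ℝ) + 1 ≤ m + 1 := by
        have : ((m - k : ℕ) : ℝ) ≤ m := by exact_mod_cast Nat.sub_le m k
        linarith
      calc _ = C' * K * (q ^ m * (((m - k : ℕ) : ℝ) + 1) ^ d) := by rw [e]; ring
        _ ≤ _ := by gcongr
    calc _ ≤ (∑ k ∈ Finset.range (m + 1), C' * K * (q ^ m * (m + 1) ^ d) *
            boxNorm w r R (d + 2) F) + C * q ^ m * boxNorm w r R (d + 2) F :=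
          (abs_add_le _ _).trans (add_le_add ((Finset.abs_sum_le_sum_abs _ _).trans
            (Finset.sum_le_sum hterm)) (hlast (d + 1) m R hK F hF))
      _ = (C' * K * (q ^ m * (m + 1) ^ (d + 1)) + C * (q ^ m * 1)) * boxNorm w r R (d + 2) F := by
          rw [Finset.sum_const, Finset.card_range, nsmul_eq_mul]; push_cast; ring
      _ ≤ (C' * K * (q ^ m * (m + 1) ^ (d + 1)) + C * (q ^ m * (m + 1) ^ (d + 1))) *
            boxNorm w r R (d + 2) F := by
          gcongr; exact one_le_pow₀ hm1
      _ = _ := by ring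

end Smolyak

/-! ### Mollification of weak derivatives in the weighted norm. -/

section Mollification

open scoped Convolution

variable {d : ℕ} {f u : (Fin d → ℝ) → ℝ}

theorem hasCompactSupport_partialDeriv (i : Fin d) (hu : HasCompactSupport u) :
    HasCompactSupport (partialDeriv i u) := hu.fderiv_apply (𝕜 := ℝ) _

theorem hasCompactSupport_partialDeriv_iterate (i : Fin d) (n : ℕ) (hu : HasCompactSupport u) :
    HasCompactSupport ((partialDeriv i)^[n] u) := by
  induction n with
  | zero => exact hu
  | succ n ih => rw [Function.iterate_succ_apply']; exact hasCompactSupport_partialDeriv i ih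

theorem hasCompactSupport_foldr_partialDeriv (l : List (Fin d)) (k : Fin d → ℕ)
    (hu : HasCompactSupport u) :
    HasCompactSupport (l.foldr (fun i ψ => (partialDeriv i)^[k i] ψ) u) := by
  induction l with
  | nil => exact hu
  | cons i l ih => exact hasCompactSupport_partialDeriv_iterate i _ ih

theorem partialDeriv_convolution (i : Fin d) (hf : LocallyIntegrable f volume)
    (hu : ContDiff ℝ ∞ u) (hc : HasCompactSupport u) :
    partialDeriv i (f ⋆[ContinuousLinearMap.mul ℝ ℝ, volume] u) =
      f ⋆[ContinuousLinearMap.mul ℝ ℝ, volume] partialDeriv i u := by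
  ext x
  have h1 : ContDiff ℝ 1 u := contDiff_nat_of_smooth hu 1
  rw [partialDeriv, (hc.hasFDerivAt_convolution_right _ hf h1 x).fderiv,
    convolution_precompR_apply _ hf (hc.fderiv ℝ) (h1.continuous_fderiv one_ne_zero)]
  rfl

theorem partialDeriv_iterate_convolution (i : Fin d) (n : ℕ) (hf : LocallyIntegrable f volume)
    (hu : ContDiff ℝ ∞ u) (hc : HasCompactSupport u) :
    (partialDeriv i)^[n] (f ⋆[ContinuousLinearMap.mul ℝ ℝ, volume] u) =
      f ⋆[ContinuousLinearMap.mul ℝ ℝ, volume] (partialDeriv i)^[n] u := by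
  induction n with
  | zero => rfl
  | succ n ih =>
    rw [Function.iterate_succ_apply', Function.iterate_succ_apply', ih,
      partialDeriv_convolution i hf (contDiff_partialDeriv_iterate i n hu)
        (hasCompactSupport_partialDeriv_iterate i n hc)]

theorem mixedDeriv_convolution (k : Fin d → ℕ) (hf : LocallyIntegrable f volume)
    (hu : ContDiff ℝ ∞ u) (hc : HasCompactSupport u) :
    mixedDeriv k (f ⋆[ContinuousLinearMap.mul ℝ ℝ, volume] u) =
      f ⋆[ContinuousLinearMap.mul ℝ ℝ, volume] mixedDeriv k u := by
  unfold mixedDeriv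
  induction List.finRange d with
  | nil => rfl
  | cons i l ih =>
    simp only [List.foldr_cons, ih]
    exact partialDeriv_iterate_convolution i _ hf (contDiff_foldr_partialDeriv l k hu)
      (hasCompactSupport_foldr_partialDeriv l k hc)

theorem partialDeriv_const_mul_reflect (i : Fin d) (hu : ContDiff ℝ ∞ u) (c : ℝ)
    (x : Fin d → ℝ) : partialDeriv i (fun y => c * u (x - y)) =
      fun y => -c * partialDeriv i u (x - y) := by
  ext y
  have h1 : HasFDerivAt u (fderiv ℝ u (x - y)) (x - y) :=
    (hu.differentiable (by simp) _).hasFDerivAt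
  have h2 := (h1.comp y ((hasFDerivAt_id y).const_sub x)).const_mul c
  simp only [partialDeriv]
  rw [HasFDerivAt.fderiv (f := fun y => c * u (x - y)) h2]
  simp

theorem partialDeriv_iterate_const_mul_reflect (i : Fin d) (n : ℕ) (hu : ContDiff ℝ ∞ u) (c : ℝ)
    (x : Fin d → ℝ) : (partialDeriv i)^[n] (fun y => c * u (x - y)) =
      fun y => (-1) ^ n * c * (partialDeriv i)^[n] u (x - y) := by
  induction n with
  | zero => simp
  | succ n ih =>
    rw [Function.iterate_succ_apply', ih,
      partialDeriv_const_mul_reflect i (contDiff_partialDeriv_iterate i n hu),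
      Function.iterate_succ_apply']
    ext y; ring

theorem mixedDeriv_reflect (k : Fin d → ℕ) (hu : ContDiff ℝ ∞ u) (x : Fin d → ℝ) :
    mixedDeriv k (fun y => u (x - y)) = fun y => (-1) ^ (∑ i, k i) * mixedDeriv k u (x - y) := by
  unfold mixedDeriv
  rw [Fin.sum_univ_def]
  induction List.finRange d with
  | nil => simp
  | cons i l ih =>
    simp only [List.foldr_cons, ih, List.map_cons, List.sum_cons]
    rw [partialDeriv_iterate_const_mul_reflect i _ (contDiff_foldr_partialDeriv l k hu)]
    ext y; rw [pow_add]

/-- The weak derivative is tested against the reflected mollifier `y ↦ u (x - y)`; the sign produced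
by the reflection cancels the one in the definition. -/
theorem HasWeakDeriv.mixedDeriv_convolution {k : Fin d → ℕ} {g : (Fin d → ℝ) → ℝ}
    (h : HasWeakDeriv k f g) (hu : ContDiff ℝ ∞ u) (hc : HasCompactSupport u) :
    mixedDeriv k (f ⋆[ContinuousLinearMap.mul ℝ ℝ, volume] u) =
      g ⋆[ContinuousLinearMap.mul ℝ ℝ, volume] u := by
  rw [FreudQuadrature.mixedDeriv_convolution k h.locallyIntegrable_left hu hc]
  ext x
  rw [convolution_mul, convolution_mul]
  have h1 := h.integral_eq (fun y => u (x - y)) (hu.comp (contDiff_const.sub contDiff_id))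
    (hc.comp_homeomorph (Homeomorph.subLeft x))
  rw [mixedDeriv_reflect k hu x] at h1
  have h2 : ∀ y, f y * ((-1) ^ (∑ i, k i) * mixedDeriv k u (x - y)) =
      (-1) ^ (∑ i, k i) * (f y * mixedDeriv k u (x - y)) := fun y => by ring
  simp only [h2, integral_const_mul] at h1
  exact mul_left_cancel₀ (by positivity) h1

/-- Uniform continuity near the compact set, with tolerance half the minimum of `W` on it. The
second point may lie outside `K`, as mollification requires. -/
theorem exists_weight_ratio_le {W : (Fin d → ℝ) → ℝ} (hW : Continuous W) (hW0 : ∀ x, 0 < W x)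
    {K : Set (Fin d → ℝ)} (hK : IsCompact K) :
    ∃ δ > 0, ∀ x ∈ K, ∀ t, dist x t < δ → W x ≤ 2 * W t := by
  rcases K.eq_empty_or_nonempty with rfl | hne
  · exact ⟨1, one_pos, by simp⟩
  obtain ⟨x₀, -, hx₀⟩ := hK.exists_isMinOn hne hW.continuousOn
  have hpos := half_pos (hW0 x₀)
  have h := hK.uniformContinuousAt_of_continuousAt W (fun a _ => hW.continuousAt)
    (Metric.dist_mem_uniformity hpos)
  obtain ⟨δ, hδ, h⟩ := Metric.mem_uniformity_dist.1 h
  refine ⟨δ, hδ, fun x hx t hxt => ?_⟩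
  have h1 : dist (W x) (W t) < W x₀ / 2 := h hxt hx
  rw [Real.dist_eq, abs_lt] at h1
  have h2 : W x₀ ≤ W x := hx₀ hx
  linarith [h1.2]

/-- On the support of the mollifier `W x ≤ 2 * W t`, so the weight moves inside the convolution at
the cost of a factor `2`; then the integral of a convolution is the product of the integrals. -/
theorem setIntegral_convolution_le {W g : (Fin d → ℝ) → ℝ} (hW : Continuous W)
    (hW0 : ∀ x, 0 < W x) (hg : LocallyIntegrable g volume)
    (hgW : Integrable (fun x => g x * W x) volume) {K : Set (Fin d → ℝ)} (hK : IsCompact K)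
    {δ : ℝ} (hδ : ∀ x ∈ K, ∀ t, dist x t < δ → W x ≤ 2 * W t) (hu : ContDiff ℝ ∞ u)
    (hc : HasCompactSupport u) (hu0 : ∀ x, 0 ≤ u x) (hu1 : ∫ x, u x = 1)
    (hus : Function.support u ⊆ Metric.ball 0 δ) :
    ∫ x in K, |(g ⋆[ContinuousLinearMap.mul ℝ ℝ, volume] u) x| * W x ≤
      2 * ∫ x, |g x * W x| := by
  set G : (Fin d → ℝ) → ℝ := fun x => |g x * W x| with hG
  have hGi : Integrable G volume := hgW.abs
  have hui : Integrable u volume := hu.continuous.integrable_of_hasCompactSupport hc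
  have hconv := hGi.integrable_convolution (ContinuousLinearMap.mul ℝ ℝ) hui
  have hcg : Continuous (g ⋆[ContinuousLinearMap.mul ℝ ℝ, volume] u) :=
    hc.continuous_convolution_right _ hg hu.continuous
  have e : ∫ x, (G ⋆[ContinuousLinearMap.mul ℝ ℝ, volume] u) x = ∫ x, G x := by
    rw [integral_convolution _ hGi hui, hu1]; simp
  rw [← e, ← integral_const_mul]
  have hnn : ∀ x, 0 ≤ 2 * (G ⋆[ContinuousLinearMap.mul ℝ ℝ, volume] u) x := fun x => by
    rw [convolution_mul]
    exact mul_nonneg zero_le_two (integral_nonneg fun t => mul_nonneg (abs_nonneg _) (hu0 _))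
  refine le_trans (setIntegral_mono_on ?_ (hconv.const_mul 2).integrableOn hK.measurableSet ?_)
    (setIntegral_le_integral (hconv.const_mul 2) (Filter.Eventually.of_forall hnn))
  · exact (hcg.abs.mul hW).continuousOn.integrableOn_compact hK
  · intro x hx
    rw [convolution_mul, convolution_mul, ← integral_const_mul, ← abs_of_pos (hW0 x), ← abs_mul,
      ← integral_mul_const]
    refine norm_integral_le_of_norm_le (G := ℝ) ?_ (Filter.Eventually.of_forall fun t => ?_)
    · obtain ⟨B, hB⟩ := hc.exists_bound_of_continuous hu.continuous
      have h1 : Integrable (fun t => G t * u (x - t)) volume := by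
        refine hGi.mul_bdd (c := B) (hu.continuous.comp (by fun_prop)).aestronglyMeasurable
          (Filter.Eventually.of_forall fun t => hB (x - t))
      exact h1.const_mul 2
    · by_cases h0 : u (x - t) = 0
      · simp [h0]
      · have hd : dist x t < δ := by
          have := hus (Function.mem_support.2 h0)
          rwa [mem_ball_zero_iff, ← dist_eq_norm] at this
        have h2 := hδ x hx t hd
        rw [norm_mul, norm_mul, Real.norm_eq_abs, Real.norm_eq_abs, Real.norm_eq_abs,
          abs_of_nonneg (hu0 _), abs_of_pos (hW0 x)]
        simp only [hG, abs_mul, abs_of_pos (hW0 t)]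
        have h3 : 0 ≤ |g t| * u (x - t) := mul_nonneg (abs_nonneg _) (hu0 _)
        nlinarith

end Mollification

/-! ### From smooth functions on cubes to the Sobolev ball on the whole space. -/

section Density

open scoped Convolution
open Filter Topology

variable {d : ℕ} {w : ℝ → ℝ} {R : ℝ}

theorem HasWeakDeriv.ae_eq_of_zero {f g : (Fin d → ℝ) → ℝ} (h : HasWeakDeriv 0 f g) :
    f =ᵐ[volume] g := by
  refine ae_eq_of_integral_contDiff_smul_eq h.locallyIntegrable_left h.locallyIntegrable_right
    fun φ hφ hc => ?_
  have := h.integral_eq φ hφ hc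
  rw [mixedDeriv_zero] at this
  simpa [mul_comm] using this

/-- An error bound for smooth functions extends to the weighted Sobolev ball. -/
theorem abs_boxIntegral_sub_le_of_smooth (hw : Continuous w) (hw0 : ∀ s, 0 < w s) {r N : ℕ}
    {ε : ℝ} (hε : 0 ≤ ε) {Q : ((Fin d → ℝ) → ℝ) → ℝ} (hQ : IsQuadrature N Q)
    (hM : ∀ F, ContDiff ℝ ∞ F → |boxIntegral w R d F - Q F| ≤ ε * boxNorm w r R d F)
    {f : (Fin d → ℝ) → ℝ} (hf : f ∈ sobolevUnitBall r fun x : Fin d → ℝ => ∏ i, w (x i)) :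
    |boxIntegral w R d f - Q f| ≤ 2 * ε := by
  obtain ⟨hfc, g, hg, hsum⟩ := hf
  set W : (Fin d → ℝ) → ℝ := fun x => ∏ i, w (x i) with hWdef
  have hW : Continuous W := continuous_prod_weight hw d
  have hW0 : ∀ x, 0 < W x := fun x => Finset.prod_pos fun i _ => hw0 _
  obtain ⟨δ, hδ0, hδ⟩ := exists_weight_ratio_le hW hW0 (isCompact_box d R)
  obtain ⟨ι, hι, c, x, -, hQ⟩ := hQ
  have hfl : LocallyIntegrable f volume := hfc.locallyIntegrable
  -- Radii below `δ` allow the weight comparison; radii at most `1` keep the mollified values on the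
  -- cube controlled by `f` on `[-R-1, R+1]^d`, for dominated convergence.
  let φ : ℕ → ContDiffBump (0 : Fin d → ℝ) := fun n =>
    ⟨min δ 1 / (n + 1) / 2, min δ 1 / (n + 1), by positivity, half_lt_self (by positivity)⟩
  have hφr : ∀ n, (φ n).rOut = min δ 1 / (n + 1) := fun n => rfl
  have hφle : ∀ n, (φ n).rOut ≤ min δ 1 := fun n => by
    rw [hφr]
    exact div_le_self (by positivity) (by linarith [(Nat.cast_nonneg n : (0 : ℝ) ≤ n)])
  have hφlim : Tendsto (fun n => (φ n).rOut) atTop (𝓝 0) := by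
    simp only [hφr]
    exact tendsto_const_div_atTop_nhds_zero_nat (min δ 1) |>.comp (tendsto_add_atTop_nat 1)
      |>.congr fun n => by simp
  set F : ℕ → (Fin d → ℝ) → ℝ := fun n =>
    f ⋆[ContinuousLinearMap.mul ℝ ℝ, volume] (φ n).normed volume with hF
  have hFalt : ∀ n, F n = (φ n).normed volume ⋆[ContinuousLinearMap.lsmul ℝ ℝ, volume] f := by
    intro n
    ext x
    rw [convolution_lsmul_swap]
    simp only [hF]
    rw [convolution_mul]
    congr 1; ext t; rw [smul_eq_mul, mul_comm]
  have hs : ∀ n, ContDiff ℝ ∞ ((φ n).normed volume) := fun n => (φ n).contDiff_normed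
  have hcs : ∀ n, HasCompactSupport ((φ n).normed (volume : Measure (Fin d → ℝ))) := fun n =>
    (φ n).hasCompactSupport_normed
  have hFs : ∀ n, ContDiff ℝ ∞ (F n) := fun n =>
    (hcs n).contDiff_convolution_right _ hfl (hs n)
  have hlim : ∀ y, Tendsto (fun n => F n y) atTop (𝓝 (f y)) := fun y => by
    simp only [hFalt]
    exact ContDiffBump.convolution_tendsto_right_of_continuous hφlim hfc y
  have hnorm : ∀ n, boxNorm w r R d (F n) ≤ 2 := by
    intro n
    have hk : ∀ k ∈ Fintype.piFinset (fun _ : Fin d => Finset.range (r + 1)),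
        ∫ x in box d R, |mixedDeriv k (F n) x| * W x ≤ 2 * ∫ x, |g k x * W x| := by
      intro k hk
      obtain ⟨h1, h2⟩ := hg k fun i =>
        Nat.lt_succ_iff.1 (Finset.mem_range.1 (Fintype.mem_piFinset.1 hk i))
      rw [h1.mixedDeriv_convolution (hs n) (hcs n)]
      refine setIntegral_convolution_le hW hW0 h1.locallyIntegrable_right h2 (isCompact_box d R)
        hδ (hs n) (hcs n) (fun x => (φ n).nonneg_normed x) (φ n).integral_normed ?_
      rw [(φ n).support_normed_eq]
      exact Metric.ball_subset_ball ((hφle n).trans (min_le_left _ _))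
    calc boxNorm w r R d (F n) ≤ ∑ k ∈ Fintype.piFinset (fun _ : Fin d => Finset.range (r + 1)),
          2 * ∫ x, |g k x * W x| := Finset.sum_le_sum hk
      _ ≤ 2 := by rw [← Finset.mul_sum]; linarith
  have hlimQ : Tendsto (fun n => Q (F n)) atTop (𝓝 (Q f)) := by
    simp only [hQ]
    exact tendsto_finsetSum _ fun i _ => (hlim (x i)).const_mul (c i)
  have hlimI : Tendsto (fun n => boxIntegral w R d (F n)) atTop (𝓝 (boxIntegral w R d f)) := by
    obtain ⟨B, hB⟩ := (isCompact_box d (R + 1)).exists_bound_of_continuousOn hfc.continuousOn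
    refine tendsto_integral_of_dominated_convergence (fun x => 3 * B * W x) (fun n => ?_) ?_
      (fun n => ?_) ?_
    · exact ((hFs n).continuous.mul hW).aestronglyMeasurable
    · exact (continuous_const.mul hW).continuousOn.integrableOn_compact (isCompact_box d R)
    · filter_upwards [ae_restrict_mem (measurableSet_box d R)] with y hy
      have hsub : ∀ z ∈ Metric.closedBall y 1, z ∈ box d (R + 1) := by
        intro z hz
        rw [Metric.mem_closedBall, dist_pi_le_iff zero_le_one] at hz
        refine ⟨fun i => ?_, fun i => ?_⟩
        · have h1 := hz i; have h2 := hy.1 i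
          rw [Real.dist_eq, abs_le] at h1
          simp only at h2 ⊢; linarith [h1.1]
        · have h1 := hz i; have h2 := hy.2 i
          rw [Real.dist_eq, abs_le] at h1
          simp only at h2 ⊢; linarith [h1.2]
      have hy1 := hB y (hsub y (by simp))
      have h1 : dist (F n y) (f y) ≤ 2 * B := by
        rw [hFalt]
        refine (φ n).dist_normed_convolution_le hfc.aestronglyMeasurable fun z hz => ?_
        have hz1 := hB z (hsub z (Metric.ball_subset_closedBall.trans
          (Metric.closedBall_subset_closedBall ((hφle n).trans (min_le_right _ _))) hz))
        calc dist (f z) (f y) ≤ ‖f z‖ + ‖f y‖ := dist_le_norm_add_norm _ _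
          _ ≤ _ := by linarith
      have h2 : ‖F n y‖ ≤ 3 * B := by
        have h3 : ‖F n y‖ ≤ ‖F n y - f y‖ + ‖f y‖ := by
          simpa using norm_add_le (F n y - f y) (f y)
        rw [← dist_eq_norm] at h3
        linarith
      rw [norm_mul, Real.norm_of_nonneg (hW0 y).le]
      exact mul_le_mul_of_nonneg_right h2 (hW0 y).le
    · exact Filter.Eventually.of_forall fun y => (hlim y).mul_const _
  refine le_of_tendsto ((hlimI.sub hlimQ).abs) (Filter.Eventually.of_forall fun n => ?_)
  refine (hM _ (hFs n)).trans ?_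
  rw [mul_comm 2]
  exact mul_le_mul_of_nonneg_left (hnorm n) hε

theorem integrable_mul_of_mem_sobolevUnitBall {r : ℕ} {W f : (Fin d → ℝ) → ℝ}
    (hf : f ∈ sobolevUnitBall r W) : Integrable (fun x => f x * W x) volume := by
  obtain ⟨-, g, hg, -⟩ := hf
  obtain ⟨h1, h2⟩ := hg 0 (by simp)
  refine h2.congr ?_
  filter_upwards [h1.ae_eq_of_zero] with x hx
  rw [hx]

theorem tendsto_boxIntegral {f : (Fin d → ℝ) → ℝ}
    (hf : Integrable (fun x => f x * ∏ i, w (x i)) volume) :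
    Tendsto (fun n : ℕ => boxIntegral w n d f) atTop (𝓝 (∫ x, f x * ∏ i, w (x i))) := by
  have hb : ∀ n : ℕ, box d n = Metric.closedBall 0 n := fun n => by
    ext x
    rw [Metric.mem_closedBall, dist_pi_le_iff (Nat.cast_nonneg n)]
    simp [box, Pi.le_def, abs_le, forall_and]
  have hc : AECover volume atTop fun n : ℕ => box d n := by
    simp only [hb]
    exact aecover_closedBall tendsto_natCast_atTop_atTop
  exact hc.integral_tendsto_of_countably_generated hf

/-- The bound on cubes is uniform in `R ≥ R₀` while `Q` stays fixed, so `R → ∞` recovers the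
integral over the whole space. The factor `2` is the price of mollification. -/
theorem abs_integral_sub_le_of_smooth (hw : Continuous w) (hw0 : ∀ s, 0 < w s) {r N : ℕ}
    {ε : ℝ} (hε : 0 ≤ ε) {Q : ((Fin d → ℝ) → ℝ) → ℝ} (hQ : IsQuadrature N Q) {R₀ : ℝ}
    (hM : ∀ R ≥ R₀, ∀ F, ContDiff ℝ ∞ F →
      |boxIntegral w R d F - Q F| ≤ ε * boxNorm w r R d F)
    {f : (Fin d → ℝ) → ℝ} (hf : f ∈ sobolevUnitBall r fun x : Fin d → ℝ => ∏ i, w (x i)) :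
    |(∫ x, f x * ∏ i, w (x i)) - Q f| ≤ 2 * ε := by
  refine le_of_tendsto (((tendsto_boxIntegral
    (integrable_mul_of_mem_sobolevUnitBall hf)).sub_const (Q f)).abs) ?_
  filter_upwards [tendsto_natCast_atTop_atTop.eventually_ge_atTop R₀] with n hn
  exact abs_boxIntegral_sub_le_of_smooth hw hw0 hε hQ (hM n hn) hf

end Density

/-! ### The upper bound: choice of the Smolyak level. -/

section UpperBound

theorem optimalError_le_of_isQuadrature {d N n : ℕ} {W : (Fin d → ℝ) → ℝ}
    {𝓕 : Set ((Fin d → ℝ) → ℝ)} {Q : ((Fin d → ℝ) → ℝ) → ℝ} (hQ : IsQuadrature N Q) (hN : N ≤ n)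
    {e : ℝ} (he : ∀ f ∈ 𝓕, |(∫ x, f x * W x) - Q f| ≤ e) :
    optimalError W 𝓕 n ≤ ENNReal.ofReal e := by
  obtain ⟨m, hm, ξ, c, hξ⟩ := hQ.exists_fin
  refine iInf₂_le_of_le m (hm.trans hN) (iInf₂_le_of_le ξ c (iSup₂_le fun f hf => ?_))
  rw [← hξ]
  exact ENNReal.ofReal_le_ofReal (he f hf)

/-- The predecessor of the first level whose node count exceeds the budget `n`. -/
theorem exists_smolyak_level {A n : ℕ} (hA : 1 ≤ A) (hn : A ≤ n) (D : ℕ) :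
    ∃ m : ℕ, A * (2 ^ m * (m + 1) ^ D) ≤ n ∧ n < A * (2 ^ (m + 1) * (m + 2) ^ D) := by
  have hex : ∃ m : ℕ, n < A * (2 ^ m * (m + 1) ^ D) := by
    refine ⟨n, n.lt_two_pow_self.trans_le ?_⟩
    have h1 : 1 ≤ (n + 1) ^ D := Nat.one_le_pow _ _ (by omega)
    nlinarith [Nat.mul_le_mul hA (Nat.mul_le_mul (le_refl (2 ^ n)) h1)]
  have hpos : Nat.find hex ≠ 0 := fun h0 => by
    have := Nat.find_spec hex
    rw [h0] at this
    simp at this; omega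
  obtain ⟨m, hm⟩ := Nat.exists_eq_succ_of_ne_zero hpos
  refine ⟨m, ?_, ?_⟩
  · have := Nat.find_min hex (m := m) (by omega)
    omega
  · have := Nat.find_spec hex
    rwa [hm] at this

/-- Maximality of `m` gives `2^(-m*α) ≲ n^(-α) * (m+1)^(α*D)`; the factor `(m+1)^D` of the Smolyak
error raises the exponent to `(α+1)*D`, and `m + 1 ≲ log n` because `2^m ≤ n`. -/
theorem smolyak_rate_le {A n m D : ℕ} (hA : 1 ≤ A) (hn : 2 ≤ n) {α : ℝ} (hα : 0 ≤ α)
    (h1 : A * (2 ^ m * (m + 1) ^ D) ≤ n) (h2 : n < A * (2 ^ (m + 1) * (m + 2) ^ D)) :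
    ((2 : ℝ) ^ m) ^ (-α) * (m + 1) ^ D ≤
      ((A * 2 ^ (D + 1) : ℝ) ^ α * (2 / Real.log 2) ^ ((α + 1) * D)) *
        ((n : ℝ) ^ (-α) * Real.log n ^ ((α + 1) * D)) := by
  have hn0 : (0 : ℝ) < n := by exact_mod_cast (by omega : 0 < n)
  have hA0 : (0 : ℝ) < A := by exact_mod_cast (by omega : 0 < A)
  have hm1 : (0 : ℝ) < (m : ℝ) + 1 := by positivity
  have hl2 : 0 < Real.log 2 := Real.log_pos one_lt_two
  have hln : Real.log 2 ≤ Real.log n := Real.log_le_log two_pos (by exact_mod_cast hn)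
  have hlog : (m : ℝ) + 1 ≤ 2 / Real.log 2 * Real.log n := by
    have h3 : (2 : ℝ) ^ m ≤ n := by
      have : 2 ^ m ≤ n := by
        refine le_trans ?_ h1
        have h4 : 1 ≤ (m + 1) ^ D := Nat.one_le_pow _ _ (by omega)
        nlinarith [Nat.mul_le_mul hA (Nat.mul_le_mul (le_refl (2 ^ m)) h4)]
      exact_mod_cast this
    have h4 : (m : ℝ) * Real.log 2 ≤ Real.log n := by
      rw [← Real.log_pow]; exact Real.log_le_log (by positivity) h3
    rw [div_mul_eq_mul_div, le_div_iff₀ hl2]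
    linarith
  have hB : (n : ℝ) ≤ (A * 2 ^ (D + 1)) * ((2 : ℝ) ^ m * (m + 1) ^ D) := by
    have h3 : (n : ℝ) ≤ A * (2 ^ (m + 1) * ((m : ℝ) + 2) ^ D) := by exact_mod_cast h2.le
    have h4 : ((m : ℝ) + 2) ^ D ≤ (2 * ((m : ℝ) + 1)) ^ D := by
      gcongr; linarith [(Nat.cast_nonneg m : (0 : ℝ) ≤ m)]
    calc (n : ℝ) ≤ A * (2 ^ (m + 1) * (2 * ((m : ℝ) + 1)) ^ D) := h3.trans (by gcongr)
      _ = _ := by rw [mul_pow]; ring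
  have hrate : ((2 : ℝ) ^ m) ^ (-α) ≤
      (A * 2 ^ (D + 1) : ℝ) ^ α * ((n : ℝ) ^ (-α) * ((m : ℝ) + 1) ^ (α * D)) := by
    have h3 := Real.rpow_le_rpow hn0.le hB hα
    rw [Real.mul_rpow (x := (A * 2 ^ (D + 1) : ℝ)) (by positivity) (by positivity),
      Real.mul_rpow (x := (2 : ℝ) ^ m) (by positivity) (by positivity), ← Real.rpow_natCast ((m : ℝ) + 1) D,
      ← Real.rpow_mul hm1.le, mul_comm (D : ℝ) α] at h3
    rw [Real.rpow_neg (by positivity), Real.rpow_neg hn0.le]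
    have h4 : 0 < (n : ℝ) ^ α := by positivity
    have h5 : 0 < ((2 : ℝ) ^ m) ^ α := by positivity
    rw [inv_le_iff_one_le_mul₀ h5]
    calc (1 : ℝ) = ((n : ℝ) ^ α)⁻¹ * (n : ℝ) ^ α := (inv_mul_cancel₀ h4.ne').symm
      _ ≤ ((n : ℝ) ^ α)⁻¹ * _ := mul_le_mul_of_nonneg_left h3 (by positivity)
      _ = _ := by ring
  have hpow : ((m : ℝ) + 1) ^ ((α + 1) * D) ≤
      (2 / Real.log 2) ^ ((α + 1) * D) * Real.log n ^ ((α + 1) * D) := by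
    rw [← Real.mul_rpow (by positivity) (hl2.le.trans hln)]
    exact Real.rpow_le_rpow hm1.le hlog (by positivity)
  calc _ ≤ (A * 2 ^ (D + 1) : ℝ) ^ α * ((n : ℝ) ^ (-α) * ((m : ℝ) + 1) ^ (α * D)) *
        ((m : ℝ) + 1) ^ D := mul_le_mul_of_nonneg_right hrate (by positivity)
    _ = (A * 2 ^ (D + 1) : ℝ) ^ α * ((n : ℝ) ^ (-α) * ((m : ℝ) + 1) ^ ((α + 1) * D)) := by
        rw [add_mul, one_mul, Real.rpow_add hm1, Real.rpow_natCast]; ring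
    _ ≤ (A * 2 ^ (D + 1) : ℝ) ^ α * ((n : ℝ) ^ (-α) *
          ((2 / Real.log 2) ^ ((α + 1) * D) * Real.log n ^ ((α + 1) * D))) := by gcongr
    _ = _ := by ring

theorem exists_optimalError_le {lam a : ℝ} (hlam : 1 < lam) (ha : 0 < a) (b : ℝ) {r : ℕ}
    (hr : 1 ≤ r) (D : ℕ) : ∃ C : ℝ, 0 < C ∧ ∀ n : ℕ, 2 ≤ n →
      optimalError (productWeight (D + 1) lam a b)
          (sobolevUnitBall r (productWeight (D + 1) lam a b)) n ≤
        ENNReal.ofReal (C * ((n : ℝ) ^ (-((1 - 1 / lam) * r)) *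
          Real.log n ^ (((1 - 1 / lam) * r + 1) * D))) := by
  have hlam0 : 0 < lam := by linarith
  have hw := continuous_freudWeight hlam0 a b
  have hwpos := freudWeight_pos lam a b
  have hw0 : ∀ s, 0 ≤ freudWeight lam a b s := fun s => (hwpos s).le
  set α : ℝ := (1 - 1 / lam) * r with hα
  have hα0 : 0 ≤ α := by
    have : 1 / lam ≤ 1 := by rw [div_le_one hlam0]; exact hlam.le
    exact mul_nonneg (by linarith) (Nat.cast_nonneg r)
  obtain ⟨C, hC, Q, hQ⟩ := exists_univariate_rules hlam ha b hr
  have hQq : ∀ k, IsQuadrature (2 * r * 2 ^ k) (Q k) := fun k => (hQ k).1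
  have hpow : ∀ k : ℕ, ((2 : ℝ) ^ k) ^ (-α) = ((2 : ℝ) ^ (-α)) ^ k := fun k => by
    rw [← Real.rpow_natCast, ← Real.rpow_mul zero_le_two, mul_comm, Real.rpow_mul zero_le_two,
      Real.rpow_natCast]
  obtain ⟨K, hK, hsm⟩ := abs_boxIntegral_sub_smolyak_le hw hw0 hQq hC
    (by positivity : (0 : ℝ) < 2 ^ (-α)) r D
  set A : ℕ := (4 * (2 * r)) ^ (D + 1) with hA
  have hA1 : 1 ≤ A := Nat.one_le_pow _ _ (by omega)
  have hA0 : (0 : ℝ) < A := by exact_mod_cast (by omega : 0 < A)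
  have hl2 : 0 < Real.log 2 := Real.log_pos one_lt_two
  set C₁ : ℝ := 2 * K * ((A * 2 ^ (D + 1) : ℝ) ^ α * (2 / Real.log 2) ^ ((α + 1) * D)) with hC₁
  set C₂ : ℝ := 2 * ((A : ℝ) ^ α * (Real.log 2 ^ ((α + 1) * D))⁻¹) with hC₂
  have hC₁0 : 0 < C₁ := by positivity
  have hC₂0 : 0 < C₂ := by positivity
  refine ⟨C₁ + C₂, by positivity, fun n hn => ?_⟩
  have hn0 : (0 : ℝ) < n := by exact_mod_cast (by omega : 0 < n)
  have hln : Real.log 2 ≤ Real.log n := Real.log_le_log two_pos (by exact_mod_cast hn)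
  have hX : 0 ≤ (n : ℝ) ^ (-α) * Real.log n ^ ((α + 1) * D) :=
    mul_nonneg (by positivity) (Real.rpow_nonneg (hl2.le.trans hln) _)
  rcases le_or_gt A n with hAn | hAn
  · obtain ⟨m, h1, h2⟩ := exists_smolyak_level hA1 hAn D
    have hrate := smolyak_rate_le hA1 hn hα0 h1 h2
    refine (optimalError_le_of_isQuadrature (isQuadrature_smolyak hQq D m) h1
      (e := 2 * (K * (((2 : ℝ) ^ (-α)) ^ m * (m + 1) ^ D))) fun f hf => ?_).trans
        (ENNReal.ofReal_le_ofReal ?_)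
    -- The threshold of level `m` exceeds those of all lower levels, so a single `R` serves every
    -- univariate rule involved.
    · refine abs_integral_sub_le_of_smooth hw hwpos (by positivity) (isQuadrature_smolyak hQq D m)
        (R₀ := ((2 : ℝ) ^ m) ^ (1 / lam)) (fun R hR => hsm m R fun k hk => ?_) hf
      rw [← hpow]
      refine (hQ k).2 R (le_trans ?_ hR)
      exact Real.rpow_le_rpow (by positivity) (pow_le_pow_right₀ one_le_two hk) (by positivity)
    · rw [← hpow]
      calc _ = 2 * K * (((2 : ℝ) ^ m) ^ (-α) * (m + 1) ^ D) := by ring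
        _ ≤ 2 * K * (_ * _) := mul_le_mul_of_nonneg_left hrate (by positivity)
        _ = C₁ * ((n : ℝ) ^ (-α) * Real.log n ^ ((α + 1) * D)) := by rw [hC₁]; ring
        _ ≤ _ := by gcongr; linarith
  -- For the finitely many `n < A` even the coarsest rule may be too large; the zero quadrature
  -- suffices and `C₂` absorbs its error.
  · refine (optimalError_le_of_isQuadrature IsQuadrature.zero (Nat.zero_le n) (e := 2 * 1)
      fun f hf => ?_).trans (ENNReal.ofReal_le_ofReal ?_)
    · refine abs_integral_sub_le_of_smooth hw hwpos zero_le_one IsQuadrature.zero (R₀ := 0)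
        (fun R _ F _ => ?_) hf
      rw [sub_zero, one_mul]
      exact abs_boxIntegral_le hw0 r F
    · have h1 : (A : ℝ) ^ (-α) ≤ (n : ℝ) ^ (-α) :=
        Real.rpow_le_rpow_of_nonpos hn0 (by exact_mod_cast hAn.le) (by linarith)
      have h2 : Real.log 2 ^ ((α + 1) * D) ≤ Real.log n ^ ((α + 1) * D) :=
        Real.rpow_le_rpow hl2.le hln (by positivity)
      have h3 : 0 < Real.log 2 ^ ((α + 1) * D) := by positivity
      have h4 : (A : ℝ) ^ α * (A : ℝ) ^ (-α) = 1 := by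
        rw [← Real.rpow_add hA0]; simp
      calc (2 : ℝ) * 1 = C₂ * ((A : ℝ) ^ (-α) * Real.log 2 ^ ((α + 1) * D)) := by
            rw [hC₂]
            calc (2 : ℝ) * 1 = 2 * (((A : ℝ) ^ α * (A : ℝ) ^ (-α)) *
                  ((Real.log 2 ^ ((α + 1) * D))⁻¹ * Real.log 2 ^ ((α + 1) * D))) := by
                  rw [h4, inv_mul_cancel₀ h3.ne']; norm_num
              _ = _ := by ring
        _ ≤ C₂ * ((n : ℝ) ^ (-α) * Real.log n ^ ((α + 1) * D)) := by gcongr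
        _ ≤ _ := by gcongr; linarith

end UpperBound

/-! ### Bumps on cells where the weight varies by a fixed factor. -/

section UnivariateBump

/-- Bernoulli's inequality for exponents at most `1`, applied at both ends; the half comes from
`(j+1)^(β-1) ≥ (2*j)^(β-1) ≥ j^(β-1) / 2`. It estimates the length of the cell from `j^(1/lam)` to
`(j+1)^(1/lam)`. -/
theorem rpow_succ_sub_rpow {β : ℝ} (hβ0 : 0 < β) (hβ1 : β ≤ 1) {j : ℝ} (hj : 1 ≤ j) :
    β / 2 * j ^ (β - 1) ≤ (j + 1) ^ β - j ^ β ∧ (j + 1) ^ β - j ^ β ≤ 1 := by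
  have hj0 : 0 < j := by linarith
  have hj1 : 0 < j + 1 := by linarith
  constructor
  · have h1 := rpow_one_add_le_one_add_mul_self (s := -1 / (j + 1))
      (by rw [neg_div, neg_le_neg_iff, div_le_one hj1]; linarith) hβ0.le hβ1
    have h0 : 0 ≤ 1 + -1 / (j + 1) := by
      have : 1 / (j + 1) ≤ 1 := by rw [div_le_one hj1]; linarith
      rw [neg_div]; linarith
    have h2 : j ^ β = (j + 1) ^ β * (1 + -1 / (j + 1)) ^ β := by
      rw [← Real.mul_rpow hj1.le h0]
      congr 1; field_simp; ring
    have h3 : (j + 1) ^ (β - 1) = (j + 1) ^ β / (j + 1) := Real.rpow_sub_one hj1.ne' β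
    have h4 : (0 : ℝ) < (j + 1) ^ β := by positivity
    have h5 : β * (j + 1) ^ (β - 1) ≤ (j + 1) ^ β - j ^ β := by
      rw [h3, h2]
      have h6 := mul_le_mul_of_nonneg_left h1 h4.le
      have h7 : (j + 1) ^ β * (1 + β * (-1 / (j + 1))) =
          (j + 1) ^ β - β * ((j + 1) ^ β / (j + 1)) := by field_simp; ring
      linarith
    refine le_trans ?_ h5
    have h8 : (2 * j) ^ (β - 1) ≤ (j + 1) ^ (β - 1) :=
      Real.rpow_le_rpow_of_nonpos hj1 (by linarith) (by linarith)
    rw [Real.mul_rpow zero_le_two hj0.le] at h8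
    have h9 : (1 : ℝ) / 2 ≤ 2 ^ (β - 1) := by
      rw [one_div, ← Real.rpow_neg_one]
      exact Real.rpow_le_rpow_of_exponent_le one_le_two (by linarith)
    have h10 : (0 : ℝ) < j ^ (β - 1) := by positivity
    calc β / 2 * j ^ (β - 1) = β * (1 / 2 * j ^ (β - 1)) := by ring
      _ ≤ β * (2 ^ (β - 1) * j ^ (β - 1)) := by gcongr
      _ ≤ _ := by gcongr
  · have h1 := rpow_one_add_le_one_add_mul_self (s := 1 / j)
      (by have : 0 < 1 / j := by positivity
          linarith) hβ0.le hβ1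
    have h2 : (j + 1) ^ β = j ^ β * (1 + 1 / j) ^ β := by
      rw [← Real.mul_rpow hj0.le (by positivity)]
      congr 1; field_simp
    have h3 : j ^ (β - 1) = j ^ β / j := Real.rpow_sub_one hj0.ne' β
    have h4 : j ^ (β - 1) ≤ 1 := Real.rpow_le_one_of_one_le_of_nonpos hj (by linarith)
    have h5 := mul_le_mul_of_nonneg_left h1 (by positivity : 0 ≤ j ^ β)
    have h6 : j ^ β * (1 + β * (1 / j)) = j ^ β + β * (j ^ β / j) := by ring
    rw [h2, ← sub_nonneg]
    rw [h6, ← h3] at h5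
    have h7 : 0 ≤ j ^ (β - 1) := by positivity
    nlinarith

theorem exists_reference_bump (r : ℕ) : ∃ (ψ : ℝ → ℝ) (M : ℝ), ContDiff ℝ ∞ ψ ∧ 0 < M ∧
    (∀ s, 0 ≤ ψ s) ∧ (∀ s, s ∉ Set.Ioo (0 : ℝ) 1 → ψ s = 0) ∧
    (∀ k s, s ∉ Set.Icc (0 : ℝ) 1 → iteratedDeriv k ψ s = 0) ∧
    (∀ k ≤ r, ∀ s, |iteratedDeriv k ψ s| ≤ M) ∧ 0 < ∫ s, ψ s := by
  let φ : ContDiffBump (1 / 2 : ℝ) := ⟨1 / 4, 1 / 2, by norm_num, by norm_num⟩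
  have hr : φ.rOut = 1 / 2 := rfl
  have hs : ∀ s, s ∉ Set.Ioo (0 : ℝ) 1 → φ s = 0 := fun s hs => by
    apply φ.zero_of_le_dist
    rw [hr, Real.dist_eq]
    by_contra h
    rw [not_le, abs_lt] at h
    exact hs ⟨by linarith [h.1], by linarith [h.2]⟩
  have hts : ∀ k s, s ∉ Set.Icc (0 : ℝ) 1 → iteratedDeriv k φ s = 0 := fun k s hns => by
    have h1 : s ∉ tsupport φ := fun h => hns (by
      rw [φ.tsupport_eq, hr, Real.closedBall_eq_Icc] at h
      norm_num at h; exact h)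
    have h2 : s ∉ Function.support (iteratedFDeriv ℝ k φ) := fun h =>
      h1 (support_iteratedFDeriv_subset k h)
    rw [iteratedDeriv, Function.notMem_support.1 h2]; rfl
  have hφ : ContDiff ℝ ∞ φ := φ.contDiff
  have hb : ∀ k, ∃ B, ∀ s ∈ Set.Icc (0 : ℝ) 1, |iteratedDeriv k φ s| ≤ B := fun k =>
    isCompact_Icc.exists_bound_of_continuousOn (continuous_iteratedDeriv_of_smooth hφ k).continuousOn
  choose B hB using hb
  have hB0 : ∀ k, 0 ≤ B k := fun k => (abs_nonneg _).trans (hB k 0 (by simp))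
  refine ⟨φ, ∑ k ∈ Finset.range (r + 1), B k + 1, hφ,
    by have := Finset.sum_nonneg fun k (_ : k ∈ Finset.range (r + 1)) => hB0 k; linarith,
    fun s => φ.nonneg, hs, hts, fun k hk s => ?_, φ.integral_pos⟩
  have h1 : B k ≤ ∑ k ∈ Finset.range (r + 1), B k :=
    Finset.single_le_sum (f := B) (fun k _ => hB0 k) (Finset.mem_range.2 (by omega))
  by_cases hm : s ∈ Set.Icc (0 : ℝ) 1
  · linarith [hB k s hm]
  · rw [hts k s hm, abs_zero]; linarith [hB0 k]

theorem exists_univariate_bump {lam a : ℝ} (hlam : 1 < lam) (ha : 0 < a) (b : ℝ) {r : ℕ}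
    (hr : 1 ≤ r) : ∃ c : ℝ, 0 < c ∧ ∀ j : ℕ, 1 ≤ j → ∃ u : ℝ → ℝ, ContDiff ℝ ∞ u ∧
      HasCompactSupport u ∧ (∀ t, u t ≠ 0 → (j : ℝ) < t ^ lam ∧ t ^ lam < j + 1) ∧
      (∀ k ≤ r, ∫ t, |iteratedDeriv k u t * freudWeight lam a b t| ≤ 1 / (r + 1)) ∧
      c * (j : ℝ) ^ (-((1 - 1 / lam) * r)) ≤ ∫ t, u t * freudWeight lam a b t := by
  obtain ⟨ψ, M, hψ, hM, hψ0, hψs, hψts, hψM, hψI⟩ := exists_reference_bump r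
  have hlam0 : 0 < lam := by linarith
  have hw := continuous_freudWeight hlam0 a b
  have hwpos := freudWeight_pos lam a b
  have hr1 : (0 : ℝ) < (r : ℝ) + 1 := by positivity
  set I₀ := ∫ s, ψ s with hI₀
  refine ⟨(1 / lam / 2) ^ r * (Real.exp (-a) * I₀ / (M * (r + 1))), by positivity,
    fun j hj => ?_⟩
  have hj1 : (1 : ℝ) ≤ j := by exact_mod_cast hj
  have hj0 : (0 : ℝ) < j := by linarith
  obtain ⟨hh_low, hh_one⟩ := rpow_succ_sub_rpow (β := 1 / lam) (by positivity)
    (by rw [div_le_one hlam0]; exact hlam.le) hj1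
  set p : ℝ := (j : ℝ) ^ (1 / lam) with hp
  set h : ℝ := ((j : ℝ) + 1) ^ (1 / lam) - p with hh
  have hp0 : 0 < p := by positivity
  have hh0 : 0 < h := lt_of_lt_of_le (by positivity) hh_low
  have hpl : p ^ lam = j := by
    rw [hp, ← Real.rpow_mul hj0.le]; field_simp; exact Real.rpow_one _
  have hphl : (p + h) ^ lam = j + 1 := by
    rw [hh, add_sub_cancel, ← Real.rpow_mul (by positivity)]; field_simp; exact Real.rpow_one _
  have hwph : freudWeight lam a b (p + h) = Real.exp (-a) * freudWeight lam a b p := by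
    unfold freudWeight
    rw [← Real.exp_add, abs_of_pos hp0, abs_of_pos (by positivity), hpl, hphl]
    congr 1; ring
  have hwp := hwpos p
  -- Each derivative costs `1/h` and integration over the cell gains `h`. This amplitude thus bounds
  -- the `k`-th norm by `h^(r-k) / (r+1)`, admissible since `h ≤ 1`, and leaves an integral at least
  -- a constant times `h^r`.
  set A : ℝ := h ^ (r - 1) / (freudWeight lam a b p * (M * (r + 1))) with hA
  have hA0 : 0 < A := by positivity
  set u : ℝ → ℝ := fun t => A * ψ (h⁻¹ * (t - p)) with hu
  have harg : ∀ t, h⁻¹ * (t - p) ∈ Set.Icc (0 : ℝ) 1 → t ∈ Set.Icc p (p + h) := fun t ht => by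
    rw [inv_mul_eq_div] at ht
    have h1 := ht.1; have h2 := ht.2
    rw [le_div_iff₀ hh0] at h1; rw [div_le_iff₀ hh0] at h2
    exact ⟨by linarith, by linarith⟩
  have hargo : ∀ t, h⁻¹ * (t - p) ∈ Set.Ioo (0 : ℝ) 1 → t ∈ Set.Ioo p (p + h) := fun t ht => by
    rw [inv_mul_eq_div] at ht
    have h1 := ht.1; have h2 := ht.2
    rw [lt_div_iff₀ hh0] at h1; rw [div_lt_iff₀ hh0] at h2
    exact ⟨by linarith, by linarith⟩
  have hud : ∀ k t, iteratedDeriv k u t =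
      A * ((h⁻¹) ^ k * iteratedDeriv k ψ (h⁻¹ * (t - p))) := by
    intro k t
    rw [hu, iteratedDeriv_const_mul_field]
    have h1 := congrFun (iteratedDeriv_comp_sub_const k (fun s => ψ (h⁻¹ * s)) p) t
    rw [h1, iteratedDeriv_comp_const_mul (contDiff_nat_of_smooth hψ k)]
  have hus : ∀ t, t ∉ Set.Ioo p (p + h) → u t = 0 := fun t ht => by
    simp only [hu]
    rw [hψs _ fun h' => ht (hargo t h'), mul_zero]
  have hsm : ContDiff ℝ ∞ u := by
    have : ContDiff ℝ ∞ fun t : ℝ => h⁻¹ * (t - p) := by fun_prop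
    exact contDiff_const.mul (hψ.comp this)
  refine ⟨u, hsm, HasCompactSupport.intro isCompact_Icc (K := Set.Icc p (p + h)) fun t ht =>
    hus t fun h' => ht ⟨h'.1.le, h'.2.le⟩, fun t ht => ?_, fun k hk => ?_, ?_⟩
  · have ht' : t ∈ Set.Ioo p (p + h) := by
      by_contra h'; exact ht (hus t h')
    have ht0 : 0 < t := hp0.trans ht'.1
    constructor
    · rw [← hpl]; exact Real.rpow_lt_rpow hp0.le ht'.1 hlam0
    · rw [← hphl]; exact Real.rpow_lt_rpow ht0.le ht'.2 hlam0
  · set E : ℝ := A * ((h⁻¹) ^ k * M) * freudWeight lam a b p with hE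
    have h1 : ∀ t, |iteratedDeriv k u t * freudWeight lam a b t| ≤
        (Set.Icc p (p + h)).indicator (fun _ => E) t := by
      intro t
      rw [hud, abs_mul, abs_mul, abs_mul, abs_of_pos hA0, abs_of_pos (hwpos t),
        abs_of_pos (by positivity : 0 < (h⁻¹) ^ k)]
      by_cases ht : t ∈ Set.Icc p (p + h)
      · rw [Set.indicator_of_mem ht, hE]
        have h2 := hψM k hk (h⁻¹ * (t - p))
        have h3 := freudWeight_anti hlam0 ha b hp0.le ht.1
        have h4 := (hwpos t).le
        gcongr
      · rw [Set.indicator_of_notMem ht, hψts k _ fun h' => ht (harg t h')]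
        simp
    have h2 : ∫ t, (Set.Icc p (p + h)).indicator (fun _ => E) t = h * E := by
      rw [integral_indicator measurableSet_Icc, setIntegral_const]
      simp [Measure.real, hh0.le]
    have hint : Integrable ((Set.Icc p (p + h)).indicator fun _ => E) volume :=
      (integrable_indicator_iff measurableSet_Icc).2 (integrableOn_const (by simp) (by simp))
    have h3 : ∫ t, |iteratedDeriv k u t * freudWeight lam a b t| ≤ h * E := by
      rw [← h2]
      exact integral_mono_of_nonneg (Filter.Eventually.of_forall fun t => abs_nonneg _) hint
        (Filter.Eventually.of_forall h1)
    refine h3.trans ?_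
    have h4 : h * E = h ^ (r - k) / (r + 1) := by
      have e1 : h ^ (r - 1) * h = h ^ r := by rw [← pow_succ]; congr 1; omega
      have e2 : h ^ r = h ^ (r - k) * h ^ k := by rw [← pow_add]; congr 1; omega
      have e3 : h * E = (h ^ (r - 1) * h) / h ^ k / (r + 1) := by
        rw [hE, hA, inv_pow]; field_simp
      rw [e3, e1, e2]; field_simp
    rw [h4]
    gcongr
    exact pow_le_one₀ hh0.le hh_one
  · have hI : ∫ t, ψ (h⁻¹ * (t - p)) = h * I₀ := by
      rw [integral_sub_right_eq_self (fun s => ψ (h⁻¹ * s)) p, Measure.integral_comp_mul_left]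
      simp [abs_of_pos hh0, hI₀]
    have hψc := hψ.continuous
    have hint1 : Integrable (fun t => u t * freudWeight lam a b t) volume := by
      refine (Continuous.mul hsm.continuous hw).integrable_of_hasCompactSupport ?_
      exact HasCompactSupport.intro isCompact_Icc (K := Set.Icc p (p + h)) fun t ht => by
        rw [Pi.mul_apply, hus t fun h' => ht ⟨h'.1.le, h'.2.le⟩, zero_mul]
    have hnn : ∀ t, 0 ≤ u t := fun t => mul_nonneg hA0.le (hψ0 _)
    have hlow : ∀ t, Real.exp (-a) * freudWeight lam a b p * A * ψ (h⁻¹ * (t - p)) ≤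
        u t * freudWeight lam a b t := by
      intro t
      by_cases ht : t ∈ Set.Ioo p (p + h)
      · have h1 := freudWeight_anti hlam0 ha b (hp0.trans ht.1).le ht.2.le
        rw [hwph] at h1
        calc _ = u t * (Real.exp (-a) * freudWeight lam a b p) := by simp only [hu]; ring
          _ ≤ _ := mul_le_mul_of_nonneg_left h1 (hnn t)
      · rw [hψs _ fun h' => ht (hargo t h'), hus t ht]; simp
    have h1 : Real.exp (-a) * freudWeight lam a b p * A * (h * I₀) ≤
        ∫ t, u t * freudWeight lam a b t := by
      rw [← hI, ← integral_const_mul]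
      exact integral_mono_of_nonneg (Filter.Eventually.of_forall fun t =>
        mul_nonneg (by positivity) (hψ0 _)) hint1 (Filter.Eventually.of_forall hlow)
    refine le_trans ?_ h1
    have h2 : Real.exp (-a) * freudWeight lam a b p * A * (h * I₀) =
        h ^ r * (Real.exp (-a) * I₀ / (M * (r + 1))) := by
      have e1 : h ^ (r - 1) * h = h ^ r := by rw [← pow_succ]; congr 1; omega
      rw [hA, ← e1]; field_simp
    rw [h2, mul_right_comm]
    refine mul_le_mul_of_nonneg_right ?_ (by positivity)
    have h3 : (j : ℝ) ^ (-((1 - 1 / lam) * r)) = ((j : ℝ) ^ (1 / lam - 1)) ^ r := by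
      rw [← Real.rpow_natCast, ← Real.rpow_mul hj0.le]; congr 1; ring
    rw [h3, ← mul_pow]
    exact pow_le_pow_left₀ (by positivity) hh_low r

end UnivariateBump

/-! ### Tensor products of bumps as elements of the Sobolev ball. -/

section Products

variable {d : ℕ}

/-- The tensor product of univariate functions. -/
def prodFun (u : Fin d → ℝ → ℝ) (x : Fin d → ℝ) : ℝ := ∏ i, u i (x i)

theorem contDiff_prodFun {u : Fin d → ℝ → ℝ} (hu : ∀ i, ContDiff ℝ ∞ (u i)) :
    ContDiff ℝ ∞ (prodFun u) :=
  contDiff_prod fun i _ => (hu i).comp (contDiff_apply ℝ ℝ i)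

theorem hasCompactSupport_prodFun {u : Fin d → ℝ → ℝ} (hu : ∀ i, HasCompactSupport (u i)) :
    HasCompactSupport (prodFun u) := by
  refine HasCompactSupport.intro (isCompact_univ_pi fun i => (hu i).isCompact) fun x hx => ?_
  simp only [Set.mem_pi, Set.mem_univ, true_implies, not_forall] at hx
  obtain ⟨i, hi⟩ := hx
  exact Finset.prod_eq_zero (Finset.mem_univ i) (image_eq_zero_of_notMem_tsupport hi)

theorem partialDeriv_prodFun (i : Fin d) {u : Fin d → ℝ → ℝ} (hu : ∀ i, ContDiff ℝ ∞ (u i)) :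
    partialDeriv i (prodFun u) = prodFun (Function.update u i (deriv (u i))) := by
  ext x
  rw [partialDeriv_eq_lineDeriv i (contDiff_prodFun hu), lineDeriv]
  have h1 : (fun t : ℝ => prodFun u (x + t • Pi.single i 1)) =
      fun t => (∏ j ∈ Finset.univ.erase i, u j (x j)) * u i (x i + t) := by
    ext t
    rw [prodFun, ← Finset.prod_erase_mul _ _ (Finset.mem_univ i)]
    congr 1
    · refine Finset.prod_congr rfl fun j hj => ?_
      simp [Finset.ne_of_mem_erase hj]
    · simp
  rw [h1, deriv_const_mul_field, deriv_comp_const_add, add_zero, prodFun,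
    ← Finset.prod_erase_mul _ _ (Finset.mem_univ i), Function.update_self]
  congr 1
  refine Finset.prod_congr rfl fun j hj => ?_
  rw [Function.update_of_ne (Finset.ne_of_mem_erase hj)]

theorem contDiff_deriv_of_smooth {f : ℝ → ℝ} (hf : ContDiff ℝ ∞ f) : ContDiff ℝ ∞ (deriv f) :=
  (contDiff_infty_iff_deriv.1 hf).2

theorem contDiff_iteratedDeriv_of_smooth {f : ℝ → ℝ} (hf : ContDiff ℝ ∞ f) (n : ℕ) :
    ContDiff ℝ ∞ (iteratedDeriv n f) := by
  induction n with
  | zero => simpa using hf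
  | succ n ih => rw [iteratedDeriv_succ]; exact contDiff_deriv_of_smooth ih

theorem hasCompactSupport_iteratedDeriv {f : ℝ → ℝ} (hf : HasCompactSupport f) (n : ℕ) :
    HasCompactSupport (iteratedDeriv n f) := by
  induction n with
  | zero => simpa using hf
  | succ n ih => rw [iteratedDeriv_succ]; exact ih.deriv

theorem integral_prodFun_mul_partialDeriv (i : Fin d) {u : Fin d → ℝ → ℝ}
    (hu : ∀ i, ContDiff ℝ ∞ (u i)) {φ : (Fin d → ℝ) → ℝ} (hφ : ContDiff ℝ ∞ φ)
    (hc : HasCompactSupport φ) :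
    ∫ x, prodFun u x * partialDeriv i φ x =
      -∫ x, prodFun (Function.update u i (deriv (u i))) x * φ x := by
  have hs := contDiff_prodFun hu
  have hc' := hasCompactSupport_partialDeriv i hc
  have hi : ∀ f g : (Fin d → ℝ) → ℝ, ContDiff ℝ ∞ f → ContDiff ℝ ∞ g → HasCompactSupport g →
      Integrable (fun x => f x * g x) volume := fun f g hf hg hgc =>
    (hf.continuous.mul hg.continuous).integrable_of_hasCompactSupport hgc.mul_left
  have := integral_mul_fderiv_eq_neg_fderiv_mul_of_integrable (μ := volume) (f := prodFun u)
    (g := φ) (v := Pi.single i 1) (hi _ _ (contDiff_partialDeriv i hs) hφ hc)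
    (hi _ _ hs (contDiff_partialDeriv i hφ) hc') (hi _ _ hs hφ hc)
    (fun x _ => hs.differentiable (by simp) x) (fun x _ => hφ.differentiable (by simp) x)
  rw [← partialDeriv_prodFun i hu]
  exact this

theorem integral_prodFun_mul_partialDeriv_iterate (i : Fin d) (n : ℕ) {u : Fin d → ℝ → ℝ}
    (hu : ∀ i, ContDiff ℝ ∞ (u i)) {φ : (Fin d → ℝ) → ℝ} (hφ : ContDiff ℝ ∞ φ)
    (hc : HasCompactSupport φ) :
    ∫ x, prodFun u x * (partialDeriv i)^[n] φ x =
      (-1) ^ n * ∫ x, prodFun (Function.update u i (iteratedDeriv n (u i))) x * φ x := by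
  induction n generalizing φ with
  | zero => simp
  | succ n ih =>
    rw [Function.iterate_succ_apply, ih (contDiff_partialDeriv i hφ)
      (hasCompactSupport_partialDeriv i hc), integral_prodFun_mul_partialDeriv i _ hφ hc]
    · rw [Function.update_self, Function.update_idem, ← iteratedDeriv_succ, pow_succ]
      ring
    · intro j
      rcases eq_or_ne j i with rfl | hj
      · rw [Function.update_self]; exact contDiff_iteratedDeriv_of_smooth (hu j) n
      · rw [Function.update_of_ne hj]; exact hu j

/-- Integration by parts, one coordinate at a time; since the list has no repetitions, each factor
is modified only once. -/
theorem integral_prodFun_mul_foldr (k : Fin d → ℕ) (l : List (Fin d)) (hl : l.Nodup)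
    {u : Fin d → ℝ → ℝ} (hu : ∀ i, ContDiff ℝ ∞ (u i)) {φ : (Fin d → ℝ) → ℝ}
    (hφ : ContDiff ℝ ∞ φ) (hc : HasCompactSupport φ) :
    ∫ x, prodFun u x * l.foldr (fun i ψ => (partialDeriv i)^[k i] ψ) φ x =
      (-1) ^ (l.map k).sum *
        ∫ x, prodFun (fun i => if i ∈ l then iteratedDeriv (k i) (u i) else u i) x * φ x := by
  induction l generalizing u with
  | nil => simp
  | cons i l ih =>
    obtain ⟨hil, hl⟩ := List.nodup_cons.1 hl
    simp only [List.foldr_cons, List.map_cons, List.sum_cons]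
    rw [integral_prodFun_mul_partialDeriv_iterate i _ hu (contDiff_foldr_partialDeriv l k hφ)
      (hasCompactSupport_foldr_partialDeriv l k hc), ih hl, pow_add, mul_assoc]
    · congr 4
      ext x
      congr 2
      funext j
      rcases eq_or_ne j i with rfl | hj
      · simp [hil]
      · simp [hj]
    · intro j
      rcases eq_or_ne j i with rfl | hj
      · rw [Function.update_self]; exact contDiff_iteratedDeriv_of_smooth (hu j) _
      · rw [Function.update_of_ne hj]; exact hu j

theorem hasWeakDeriv_prodFun (k : Fin d → ℕ) {u : Fin d → ℝ → ℝ}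
    (hu : ∀ i, ContDiff ℝ ∞ (u i)) :
    HasWeakDeriv k (prodFun u) (prodFun fun i => iteratedDeriv (k i) (u i)) where
  locallyIntegrable_left := (contDiff_prodFun hu).continuous.locallyIntegrable
  locallyIntegrable_right := (contDiff_prodFun fun i =>
    contDiff_iteratedDeriv_of_smooth (hu i) (k i)).continuous.locallyIntegrable
  integral_eq φ hφ hc := by
    have := integral_prodFun_mul_foldr k (List.finRange d) (List.nodup_finRange d) hu hφ hc
    simp only [List.mem_finRange, if_true, ← Fin.sum_univ_def] at this
    exact this

/-- There are `(r+1)^d` multi-indices, each contributing at most `(1/(r+1))^d`: hence the univariate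
normalisation `1/(r+1)`. -/
theorem prodFun_mem_sobolevUnitBall {w : ℝ → ℝ} (hw : Continuous w) {r : ℕ} {u : Fin d → ℝ → ℝ}
    (hu : ∀ i, ContDiff ℝ ∞ (u i)) (hc : ∀ i, HasCompactSupport (u i))
    (hb : ∀ i, ∀ k ≤ r, ∫ t, |iteratedDeriv k (u i) t * w t| ≤ 1 / (r + 1)) :
    prodFun u ∈ sobolevUnitBall r fun x : Fin d → ℝ => ∏ i, w (x i) := by
  refine ⟨(contDiff_prodFun hu).continuous,
    fun k => prodFun fun i => iteratedDeriv (k i) (u i), fun k _ =>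
      ⟨hasWeakDeriv_prodFun k hu, ?_⟩, ?_⟩
  · exact ((contDiff_prodFun fun i => contDiff_iteratedDeriv_of_smooth (hu i) (k i)).continuous.mul
      (continuous_prod_weight hw d)).integrable_of_hasCompactSupport
        (hasCompactSupport_prodFun fun i => hasCompactSupport_iteratedDeriv (hc i) (k i)).mul_right
  · have hr : (0 : ℝ) < (r : ℝ) + 1 := by positivity
    calc _ ≤ ∑ k ∈ Fintype.piFinset (fun _ : Fin d => Finset.range (r + 1)),
          (1 / ((r : ℝ) + 1)) ^ d := by
          refine Finset.sum_le_sum fun k hk => ?_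
          have e : ∀ x : Fin d → ℝ, |prodFun (fun i => iteratedDeriv (k i) (u i)) x *
              ∏ i, w (x i)| = ∏ i, |iteratedDeriv (k i) (u i) (x i) * w (x i)| := fun x => by
            rw [prodFun, ← Finset.prod_mul_distrib, Finset.abs_prod]
          simp only [e]
          rw [volume_pi, integral_fintype_prod_eq_prod
            (fun i t => |iteratedDeriv (k i) (u i) t * w t|)]
          calc _ ≤ ∏ _i : Fin d, 1 / ((r : ℝ) + 1) :=
                Finset.prod_le_prod (fun i _ => integral_nonneg fun t => abs_nonneg _)
                  fun i _ => hb i (k i) (Nat.lt_succ_iff.1 (Finset.mem_range.1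
                    (Fintype.mem_piFinset.1 hk i)))
            _ = _ := by simp
      _ = 1 := by
          rw [Finset.sum_const, Fintype.card_piFinset]
          simp only [Finset.card_range, Finset.prod_const, Finset.card_univ, Fintype.card_fin,
            nsmul_eq_mul]
          push_cast
          rw [← mul_pow, mul_one_div_cancel hr.ne', one_pow]

end Products

/-! ### Cardinality of the hyperbolic cross. -/

section Counting

/-- There are at least of the order of `x (log x) ^ d` points of `ℕ ^ (d + 1)` with positive
coordinates whose product is at most `x`. -/
theorem exists_hyperbolic_cross (d : ℕ) : ∃ c : ℝ, 0 < c ∧ ∀ x : ℝ, 1 ≤ x →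
    ∃ S : Finset (Fin (d + 1) → ℕ), (∀ j ∈ S, (∀ i, 1 ≤ j i) ∧ ∏ i, (j i : ℝ) ≤ x) ∧
      c * (x * Real.log x ^ d) ≤ S.card := by
  induction d with
  | zero =>
    refine ⟨1 / 2, by norm_num, fun x hx => ⟨(Finset.Icc 1 ⌊x⌋₊).map
      ⟨fun n _ => n, fun m n h => congrFun h 0⟩, fun j hj => ?_, ?_⟩⟩
    · obtain ⟨n, hn, rfl⟩ := Finset.mem_map.1 hj
      rw [Finset.mem_Icc] at hn
      refine ⟨fun _ => hn.1, ?_⟩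
      have h1 : (n : ℝ) ≤ x := (Nat.le_floor_iff (by linarith)).1 hn.2
      rw [Fin.prod_univ_one]
      exact h1
    · rw [Finset.card_map, Nat.card_Icc, Nat.add_sub_cancel, pow_zero, mul_one]
      have h1 := Nat.lt_floor_add_one x
      have h2 : (1 : ℝ) ≤ ⌊x⌋₊ := by exact_mod_cast (Nat.one_le_floor_iff x).2 hx
      linarith
  | succ d ih =>
    obtain ⟨c, hc, ih⟩ := ih
    refine ⟨c / 2 ^ (d + 1), by positivity, fun x hx => ?_⟩
    have hx0 : 0 < x := by linarith
    have hlx : 0 ≤ Real.log x := Real.log_nonneg hx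
    -- Restricting the first coordinate `n` to `n ≤ √x` keeps `log (x/n) ≥ (log x) / 2` in the
    -- remaining ones; the harmonic sum up to `√x` supplies the new factor `(log x) / 2`.
    set y := Real.sqrt x with hy
    have hyy : y * y = x := Real.mul_self_sqrt hx0.le
    have hy1 : 1 ≤ y := Real.one_le_sqrt.2 hx
    have hq : ∀ n ∈ Finset.Icc 1 ⌊y⌋₊, (1 : ℝ) ≤ n ∧ y ≤ x / n := fun n hn => by
      rw [Finset.mem_Icc] at hn
      have h1 : (1 : ℝ) ≤ n := by exact_mod_cast hn.1
      have h2 : (n : ℝ) ≤ y := (Nat.le_floor_iff (by linarith)).1 hn.2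
      refine ⟨h1, ?_⟩
      rw [le_div_iff₀ (by linarith)]
      nlinarith
    have hex : ∀ n : ℕ, ∃ S : Finset (Fin (d + 1) → ℕ), n ∈ Finset.Icc 1 ⌊y⌋₊ →
        (∀ j ∈ S, (∀ i, 1 ≤ j i) ∧ ∏ i, (j i : ℝ) ≤ x / n) ∧
          c * (x / n * Real.log (x / n) ^ d) ≤ S.card := fun n => by
      by_cases hn : n ∈ Finset.Icc 1 ⌊y⌋₊
      · obtain ⟨S, hS⟩ := ih (x / n) (hy1.trans (hq n hn).2)
        exact ⟨S, fun _ => hS⟩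
      · exact ⟨∅, fun h => absurd h hn⟩
    choose S hS using hex
    refine ⟨((Finset.Icc 1 ⌊y⌋₊).sigma S).map ⟨fun p => Fin.cons p.1 p.2, ?_⟩, ?_, ?_⟩
    · rintro ⟨m, j⟩ ⟨n, k⟩ h
      obtain ⟨rfl, rfl⟩ := Fin.cons_injective2 h
      rfl
    · intro j hj
      obtain ⟨⟨n, k⟩, hnk, rfl⟩ := Finset.mem_map.1 hj
      obtain ⟨hn, hk⟩ := Finset.mem_sigma.1 hnk
      simp only at hn hk
      obtain ⟨h1, h2⟩ := ((hS n hn).1 k hk)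
      have hn1 := (hq n hn).1
      refine ⟨fun i => ?_, ?_⟩
      · exact Fin.cases (Finset.mem_Icc.1 hn).1 h1 i
      · rw [Fin.prod_univ_succ]
        rw [le_div_iff₀ (by linarith), mul_comm] at h2
        exact h2
    · rw [Finset.card_map, Finset.card_sigma]
      push_cast
      have hterm : ∀ n ∈ Finset.Icc 1 ⌊y⌋₊,
          c * x * (Real.log x / 2) ^ d * (n : ℝ)⁻¹ ≤ ((S n).card : ℝ) := fun n hn => by
        refine le_trans ?_ (hS n hn).2
        obtain ⟨h1, h2⟩ := hq n hn
        have h3 : Real.log x / 2 ≤ Real.log (x / n) := by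
          rw [← Real.log_sqrt hx0.le]; exact Real.log_le_log (by linarith) h2
        calc _ = c * (x / n * (Real.log x / 2) ^ d) := by rw [div_eq_mul_inv]; ring
          _ ≤ _ := by gcongr
      refine le_trans ?_ (Finset.sum_le_sum hterm)
      rw [← Finset.mul_sum]
      have h4 : Real.log x / 2 ≤ ∑ n ∈ Finset.Icc 1 ⌊y⌋₊, (n : ℝ)⁻¹ := by
        have := log_le_harmonic_floor y (by linarith)
        rw [harmonic_eq_sum_Icc] at this
        push_cast at this
        rwa [hy, Real.log_sqrt hx0.le] at this
      calc _ = c * x * (Real.log x / 2) ^ d * (Real.log x / 2) := by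
            rw [pow_succ, pow_succ, div_pow]; field_simp
        _ ≤ _ := by gcongr

end Counting

/-! ### The lower bound: a bump on a cell without nodes. -/

section LowerBound

theorem le_optimalError {d n : ℕ} {W : (Fin d → ℝ) → ℝ} {𝓕 : Set ((Fin d → ℝ) → ℝ)} {e : ℝ}
    (h : ∀ m ≤ n, ∀ ξ : Fin m → Fin d → ℝ, ∃ f ∈ 𝓕, (∀ i, f (ξ i) = 0) ∧ e ≤ ∫ x, f x * W x) :
    ENNReal.ofReal e ≤ optimalError W 𝓕 n := by
  refine le_iInf₂ fun m hm => le_iInf₂ fun ξ c => ?_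
  obtain ⟨f, hf, hξ, he⟩ := h m hm ξ
  refine le_iSup₂_of_le f hf (ENNReal.ofReal_le_ofReal ?_)
  have : quadrature ξ c f = 0 := Finset.sum_eq_zero fun i _ => by rw [hξ, mul_zero]
  rw [this, sub_zero]
  exact he.trans (le_abs_self _)

theorem exists_fooling_function {lam a : ℝ} (hlam : 1 < lam) (ha : 0 < a) (b : ℝ) {r : ℕ}
    (hr : 1 ≤ r) (d : ℕ) : ∃ c : ℝ, 0 < c ∧ ∀ (x : ℝ) (S : Finset (Fin d → ℕ)),
      (∀ j ∈ S, (∀ i, 1 ≤ j i) ∧ ∏ i, (j i : ℝ) ≤ x) → ∀ m < S.card, ∀ ξ : Fin m → Fin d → ℝ,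
        ∃ f ∈ sobolevUnitBall r (productWeight d lam a b), (∀ i, f (ξ i) = 0) ∧
          c * x ^ (-((1 - 1 / lam) * r)) ≤ ∫ y, f y * productWeight d lam a b y := by
  obtain ⟨c, hc, hbump⟩ := exists_univariate_bump hlam ha b hr
  have hw := continuous_freudWeight (by linarith : 0 < lam) a b
  refine ⟨c ^ d, by positivity, fun x S hS m hm ξ => ?_⟩
  -- Each node is sent to the index of the cell containing it; the `m` nodes reach at most `m`
  -- indices, so some index of `S` is missed.
  obtain ⟨j, hjS, hj⟩ := Finset.exists_mem_notMem_of_card_lt_card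
    (s := Finset.univ.image fun (i : Fin m) (l : Fin d) => ⌊(ξ i l) ^ lam⌋₊) (t := S)
    (lt_of_le_of_lt (Finset.card_image_le.trans (by simp)) hm)
  obtain ⟨hj1, hjx⟩ := hS j hjS
  choose u hus huc hu0 hub hui using fun l => hbump (j l) (hj1 l)
  refine ⟨prodFun u, prodFun_mem_sobolevUnitBall hw hus huc hub, fun i => ?_, ?_⟩
  · by_contra hne
    refine hj (Finset.mem_image.2 ⟨i, Finset.mem_univ i, funext fun l => ?_⟩)
    obtain ⟨h1, h2⟩ := hu0 l (ξ i l) fun h => hne (Finset.prod_eq_zero (Finset.mem_univ l) h)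
    exact (Nat.floor_eq_iff (le_trans (Nat.cast_nonneg _) h1.le)).2 ⟨h1.le, h2⟩
  · have hpos : ∀ l, (0 : ℝ) < j l := fun l => by exact_mod_cast hj1 l
    have e : ∀ y : Fin d → ℝ, prodFun u y * productWeight d lam a b y =
        ∏ i, (u i (y i) * freudWeight lam a b (y i)) := fun y => by
      rw [prodFun, productWeight, ← Finset.prod_mul_distrib]
    simp only [e]
    rw [volume_pi, integral_fintype_prod_eq_prod (fun i t => u i t * freudWeight lam a b t)]
    have hα : 0 ≤ (1 - 1 / lam) * (r : ℝ) := by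
      have : 1 / lam ≤ 1 := by rw [div_le_one (by linarith)]; exact hlam.le
      exact mul_nonneg (by linarith) (Nat.cast_nonneg r)
    calc c ^ d * x ^ (-((1 - 1 / lam) * r)) ≤
          c ^ d * (∏ i, (j i : ℝ)) ^ (-((1 - 1 / lam) * r)) := by
          refine mul_le_mul_of_nonneg_left ?_ (by positivity)
          exact Real.rpow_le_rpow_of_nonpos (Finset.prod_pos fun l _ => hpos l) hjx (by linarith)
      _ = ∏ i, (c * (j i : ℝ) ^ (-((1 - 1 / lam) * r))) := by
          rw [Finset.prod_mul_distrib, Real.finsetProd_rpow _ _ fun l _ => (hpos l).le]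
          simp
      _ ≤ _ := Finset.prod_le_prod (fun i _ => by positivity) fun i _ => hui i

theorem exists_le_optimalError {lam a : ℝ} (hlam : 1 < lam) (ha : 0 < a) (b : ℝ) {r : ℕ}
    (hr : 1 ≤ r) (D : ℕ) : ∃ C : ℝ, 0 < C ∧ ∀ n : ℕ, 2 ≤ n →
      ENNReal.ofReal (C * ((n : ℝ) ^ (-((1 - 1 / lam) * r)) *
          Real.log n ^ ((1 - 1 / lam) * r * D))) ≤
        optimalError (productWeight (D + 1) lam a b)
          (sobolevUnitBall r (productWeight (D + 1) lam a b)) n := by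
  obtain ⟨c, hc, hfool⟩ := exists_fooling_function hlam ha b hr (D + 1)
  obtain ⟨c', hc', hcount⟩ := exists_hyperbolic_cross D
  set α : ℝ := (1 - 1 / lam) * r with hα
  -- The first summand ensures `x ≥ √n`, hence `log x ≥ (log n) / 2`; the second makes the
  -- hyperbolic cross contain at least `2 * n` points.
  set K : ℝ := (2 * ((D : ℝ) + 1)) ^ D + 2 ^ (D + 1) / c' with hK
  have hK0 : 0 < K := by positivity
  refine ⟨c * K ^ (-α), by positivity, fun n hn => ?_⟩
  have hn1 : (1 : ℝ) < n := by exact_mod_cast (by omega : 1 < n)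
  have hn0 : (0 : ℝ) < n := by linarith
  have hl : 0 < Real.log n := Real.log_pos hn1
  set x : ℝ := K * (n / Real.log n ^ D) with hx
  have hx0 : 0 < x := by positivity
  have hsq : (n : ℝ) ^ (1 / 2 : ℝ) ≤ x := by
    -- Chosen so that `ε * D ≤ 1/2`: then `log n ≤ n^ε / ε` bounds `(log n)^D` by a constant times
    -- `√n`.
    set ε : ℝ := 1 / (2 * ((D : ℝ) + 1)) with hε
    have h1 : Real.log n ≤ 2 * ((D : ℝ) + 1) * (n : ℝ) ^ ε := by
      have := Real.log_le_rpow_div hn0.le (by positivity : 0 < ε)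
      refine this.trans (le_of_eq ?_)
      rw [hε]; field_simp
    have h2 : Real.log n ^ D ≤ K * (n : ℝ) ^ (1 / 2 : ℝ) := by
      calc Real.log n ^ D ≤ (2 * ((D : ℝ) + 1) * (n : ℝ) ^ ε) ^ D := by gcongr
        _ = (2 * ((D : ℝ) + 1)) ^ D * (n : ℝ) ^ (ε * D) := by
            rw [mul_pow, Real.rpow_mul hn0.le, Real.rpow_natCast]
        _ ≤ K * (n : ℝ) ^ (1 / 2 : ℝ) := by
            have h3 : (2 * ((D : ℝ) + 1)) ^ D ≤ K := by
              rw [hK]; have : 0 < 2 ^ (D + 1) / c' := by positivity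
              linarith
            have h4 : ε * D ≤ 1 / 2 := by
              rw [hε, one_div_mul_eq_div, div_le_div_iff₀ (by positivity) two_pos]; linarith
            have h5 := Real.rpow_le_rpow_of_exponent_le hn1.le h4
            gcongr
    rw [hx, ← mul_div_assoc, le_div_iff₀ (by positivity)]
    have h3 : (n : ℝ) = (n : ℝ) ^ (1 / 2 : ℝ) * (n : ℝ) ^ (1 / 2 : ℝ) := by
      rw [← Real.rpow_add hn0]; norm_num
    have h4 : 0 < (n : ℝ) ^ (1 / 2 : ℝ) := by positivity
    nlinarith [mul_le_mul_of_nonneg_left h2 h4.le]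
  have hx1 : 1 ≤ x := (Real.one_le_rpow hn1.le (by norm_num)).trans hsq
  have hlx : Real.log n / 2 ≤ Real.log x := by
    have := Real.log_le_log (by positivity) hsq
    rw [Real.log_rpow hn0] at this
    linarith
  obtain ⟨S, hS, hcard⟩ := hcount x hx1
  have hnS : n < S.card := by
    have h1 : (n : ℝ) < S.card := by
      refine lt_of_lt_of_le ?_ hcard
      have h2 : (2 : ℝ) ^ (D + 1) ≤ c' * K := by
        have h3 : c' * (2 ^ (D + 1) / c') = (2 : ℝ) ^ (D + 1) := mul_div_cancel₀ _ hc'.ne'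
        have h4 : 0 ≤ c' * (2 * ((D : ℝ) + 1)) ^ D := by positivity
        rw [hK, mul_add, h3]; linarith
      calc (n : ℝ) < 2 * n := by linarith
        _ = 2 ^ (D + 1) * (n / Real.log n ^ D * (Real.log n / 2) ^ D) := by
            rw [div_pow, pow_succ]; field_simp
        _ ≤ c' * K * (n / Real.log n ^ D * (Real.log n / 2) ^ D) := by gcongr
        _ = c' * (x * (Real.log n / 2) ^ D) := by rw [hx]; ring
        _ ≤ _ := by gcongr
    exact_mod_cast h1
  refine le_optimalError fun m hm ξ => ?_
  obtain ⟨f, hf, h0, hI⟩ := hfool x S hS m (lt_of_le_of_lt hm hnS) ξ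
  refine ⟨f, hf, h0, le_trans (le_of_eq ?_) hI⟩
  have e : x ^ (-α) = K ^ (-α) * ((n : ℝ) ^ (-α) * Real.log n ^ (α * D)) := by
    rw [hx, Real.mul_rpow hK0.le (by positivity), Real.div_rpow hn0.le (by positivity),
      ← Real.rpow_natCast (Real.log n) D, ← Real.rpow_mul hl.le, mul_neg, Real.rpow_neg hl.le,
      div_inv_eq_mul, mul_comm (D : ℝ) α]
  rw [e]; ring

end LowerBound
end FreudQuadrature

theorem mainTheorem1 (d r : ℕ) (hd : 2 ≤ d) (hr : 1 ≤ r) (lam a b : ℝ)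
    (hlam : 1 < lam) (ha : 0 < a) (rlam : ℝ) (hrlam : rlam = (1 - 1 / lam) * r) :
    ∃ C₁ C₂ : ℝ, 0 < C₁ ∧ 0 < C₂ ∧ ∀ n : ℕ, 2 ≤ n →
      ENNReal.ofReal
          (C₁ * ((n : ℝ) ^ (-rlam) * Real.log n ^ (rlam * ((d : ℝ) - 1)))) ≤
        FreudQuadrature.optimalError (FreudQuadrature.productWeight d lam a b)
          (FreudQuadrature.sobolevUnitBall r (FreudQuadrature.productWeight d lam a b)) n ∧
      FreudQuadrature.optimalError (FreudQuadrature.productWeight d lam a b)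
          (FreudQuadrature.sobolevUnitBall r (FreudQuadrature.productWeight d lam a b)) n ≤
        ENNReal.ofReal
          (C₂ * ((n : ℝ) ^ (-rlam) * Real.log n ^ ((rlam + 1) * ((d : ℝ) - 1)))) := by
  obtain ⟨D, rfl⟩ : ∃ D, d = D + 1 := ⟨d - 1, by omega⟩
  obtain ⟨C₁, hC₁, h₁⟩ := FreudQuadrature.exists_le_optimalError hlam ha b hr D
  obtain ⟨C₂, hC₂, h₂⟩ := FreudQuadrature.exists_optimalError_le hlam ha b hr D
  subst hrlam
  refine ⟨C₁, C₂, hC₁, hC₂, fun n hn => ?_⟩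
  have hD : ((D + 1 : ℕ) : ℝ) - 1 = D := by push_cast; ring
  rw [hD]
  exact ⟨h₁ n hn, h₂ n hn⟩
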